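/- Let $A=\mathbb Z[t]$, regarded as an additive group and ordered by: $\alpha\le\beta$ if $\alpha=\beta$ or the leading coefficient of $\beta-\alpha$ is positive; $1$ is its least positive element. Let $G$ be a group generated by a finite set $\Sigma\subseteq G$ with $1\notin\Sigma$, put $\Gamma=\Sigma\cup\Sigma^{-1}$ and $\bar a=a^{-1}$ for $a\in\Gamma$, and let $\pi:\Gamma^*\to G$ be the evaluation homomorphism. A closed $A$-word is a map $p:[1,\alpha]\to\Gamma$ with $0\le\alpha\in A$, where $[1,\alpha]=\{\gamma\in A: 1\le\gamma\le\alpha\}$; its length is $|p|=\alpha$. Closed $A$-words form a monoid $W(A,\Gamma)$ under concatenation (shift the second word so that it starts right after the end of the first), with the involution $p\mapsto\bar p$ given by $\bar p(\gamma)=\overline{p(|p|+1-\gamma)}$. Words of finite length are identified with the elements of $\Gamma^*$. A factor of $x$ is a word $f$ with $x=pfq$ for some words $p,q$. A word is $G$-reduced if it has no non-empty finite factor $f$ with $\pi(f)=1$; it is a local geodesic if it has no finite factor $f$ for which there is $g\in\Gamma^*$ with $\pi(f)=\pi(g)$ and $|g|<|f|$ (local geodesics are $G$-reduced). Let $R(A,G)$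 be the set of $G$-reduced words, $R^*(A,G)$ the submonoid of $W(A,\Gamma)$ generated by it, and $$M(A,G)=W(A,\Gamma)\big/\{\,u\,\ell\,\bar r\,\bar u=1 : u\in R(A,G),\ \ell,r\in\Gamma^*,\ \pi(\ell)=\pi(r)\,\}.$$ The group $\mathrm{Ext}(A,G)$ is the image of $R^*(A,G)$ in $M(A,G)$. Then the following assertions are equivalent: (i) The group $G$ has a decidable word problem. (ii) For each finite set $\Delta\subseteq W(A,\Gamma)$ of local geodesics there is an algorithm which decides, on input $w\in\Delta^*$ (given as a finite sequence of elements of $\Delta$), whether or not $w=1$ in the group $\mathrm{Ext}(A,G)$. -/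

import Mathlib

/-! ### The discretely ordered group `A = ℤ[t]` -/

namespace ZPoly

/-- A polynomial in `ℤ[t]` is positive when its leading coefficient is positive. -/
def Pos (α : Polynomial ℤ) : Prop := 0 < α.leadingCoeff

theorem Pos.add {α β : Polynomial ℤ} (ha : Pos α) (hb : Pos β) : Pos (α + β) := by
  unfold Pos at *
  rcases lt_trichotomy α.degree β.degree with h | h | h
  · rwa [Polynomial.leadingCoeff_add_of_degree_lt h]
  · rw [Polynomial.leadingCoeff_add_of_degree_eq h (by omega)]
    omega
  · rwa [Polynomial.leadingCoeff_add_of_degree_lt' h]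

theorem Pos.mul {α β : Polynomial ℤ} (ha : Pos α) (hb : Pos β) : Pos (α * β) := by
  unfold Pos at *
  rw [Polynomial.leadingCoeff_mul]
  exact mul_pos ha hb

theorem not_pos_zero : ¬ Pos 0 := by simp [Pos]

theorem pos_trichotomy (α : Polynomial ℤ) : Pos α ∨ α = 0 ∨ Pos (-α) := by
  unfold Pos
  rw [Polynomial.leadingCoeff_neg, ← Polynomial.leadingCoeff_eq_zero]
  omega

/-- The order on `ℤ[t]`: `α ≤ β` iff `α = β` or `β - α` is positive. -/
noncomputable instance instLinearOrder : LinearOrder (Polynomial ℤ) where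
  le α β := α = β ∨ Pos (β - α)
  le_refl α := Or.inl rfl
  le_trans := by
    rintro α β γ (rfl | h) (rfl | h')
    · exact Or.inl rfl
    · exact Or.inr h'
    · exact Or.inr h
    · exact Or.inr (by simpa using h'.add h)
  le_antisymm := by
    rintro α β (h | h) (h' | h')
    · exact h
    · exact h
    · exact h'.symm
    · exact absurd (by simpa using h.add h') not_pos_zero
  le_total := by
    intro α β
    rcases pos_trichotomy (β - α) with h | h | h
    · exact Or.inl (Or.inr h)
    · exact Or.inl (Or.inl (sub_eq_zero.mp h).symm)
    · exact Or.inr (Or.inr (by simpa using h))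
  toDecidableLE := Classical.decRel _

theorem le_def {α β : Polynomial ℤ} : α ≤ β ↔ α = β ∨ Pos (β - α) := Iff.rfl

theorem pos_iff {α : Polynomial ℤ} : 0 < α ↔ Pos α := by
  rw [lt_iff_le_and_ne, le_def, sub_zero]
  constructor
  · rintro ⟨h | h, h'⟩
    · exact absurd h h'
    · exact h
  · intro h
    refine ⟨Or.inr h, ?_⟩
    rintro rfl
    exact not_pos_zero h

instance instIsOrderedAddMonoid : IsOrderedAddMonoid (Polynomial ℤ) where
  add_le_add_left := by
    intro α β h γ
    rcases h with rfl | h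
    · exact le_refl _
    · exact Or.inr (by simpa using h)

instance instZeroLEOne : ZeroLEOneClass (Polynomial ℤ) where
  zero_le_one := Or.inr (by simp [Pos])

instance instIsStrictOrderedRing : IsStrictOrderedRing (Polynomial ℤ) :=
  IsStrictOrderedRing.of_mul_pos (fun _ _ ha hb =>
    pos_iff.2 ((pos_iff.1 ha).mul (pos_iff.1 hb)))

/-- `1` is the least positive element. -/
theorem one_le_of_pos {α : Polynomial ℤ} (h : 0 < α) : 1 ≤ α := by
  have hp := pos_iff.1 h
  unfold Pos at hp
  by_cases hd : α.degree ≤ 0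
  · obtain ⟨n, rfl⟩ : ∃ n, α = Polynomial.C n := ⟨_, Polynomial.eq_C_of_degree_le_zero hd⟩
    rw [Polynomial.leadingCoeff_C] at hp
    by_cases h1 : n = 1
    · left
      simp [h1]
    · right
      have : (Polynomial.C n - 1 : Polynomial ℤ) = Polynomial.C (n - 1) := by simp
      rw [this, Pos, Polynomial.leadingCoeff_C]
      omega
  · right
    unfold Pos
    rwa [Polynomial.leadingCoeff_sub_of_degree_lt]
    rw [Polynomial.degree_one]
    exact not_le.1 hd

end ZPoly

/-! ### Closed `A`-words over an alphabet -/

/-- A closed `A`-word over `Γ` for `A = ℤ[t]`, in its standard representation: a partial map from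
`ℤ[t]` to `Γ` whose domain is exactly the closed interval `[1, len]`, where `0 ≤ len`. -/
@[ext]
structure AWord (Γ : Type*) where
  len : Polynomial ℤ
  toFun : Polynomial ℤ → Option Γ
  len_nonneg : 0 ≤ len
  isSome_iff : ∀ γ, (toFun γ).isSome ↔ 1 ≤ γ ∧ γ ≤ len

namespace AWord

variable {Γ : Type*}

theorem eq_none (p : AWord Γ) {γ : Polynomial ℤ} (h : ¬ (1 ≤ γ ∧ γ ≤ p.len)) :
    p.toFun γ = none := by
  rw [← p.isSome_iff, Option.not_isSome_iff_eq_none] at h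
  exact h

/-- The empty word. -/
noncomputable instance : One (AWord Γ) where
  one :=
    { len := 0
      toFun := fun _ => none
      len_nonneg := le_refl _
      isSome_iff := by
        intro γ
        simp only [Option.isSome_none, Bool.false_eq_true, false_iff, not_and, not_le]
        intro h
        linarith }

/-- Concatenation: `q` is shifted so that it starts right after `p`. -/
noncomputable instance : Mul (AWord Γ) where
  mul p q :=
    { len := p.len + q.len
      toFun := fun γ => if γ ≤ p.len then p.toFun γ else q.toFun (γ - p.len)
      len_nonneg := add_nonneg p.len_nonneg q.len_nonneg
      isSome_iff := by
        intro γ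
        have hp := p.len_nonneg
        have hq := q.len_nonneg
        split_ifs with h
        · rw [p.isSome_iff]
          constructor
          · rintro ⟨h1, h2⟩
            exact ⟨h1, by linarith⟩
          · rintro ⟨h1, h2⟩
            exact ⟨h1, h⟩
        · rw [q.isSome_iff]
          have h1 : 1 ≤ γ - p.len := ZPoly.one_le_of_pos (by linarith [not_le.1 h])
          constructor
          · rintro ⟨_, h2⟩
            exact ⟨by linarith, by linarith⟩
          · rintro ⟨_, h2⟩
            exact ⟨h1, by linarith⟩ }

theorem len_one : (1 : AWord Γ).len = 0 := rfl

theorem toFun_one (γ : Polynomial ℤ) : (1 : AWord Γ).toFun γ = none := rfl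

theorem len_mul (p q : AWord Γ) : (p * q).len = p.len + q.len := rfl

theorem toFun_mul (p q : AWord Γ) (γ : Polynomial ℤ) :
    (p * q).toFun γ = if γ ≤ p.len then p.toFun γ else q.toFun (γ - p.len) := rfl

/-- The monoid of closed `A`-words over `Γ`. -/
noncomputable instance : Monoid (AWord Γ) where
  mul_assoc p q r := by
    refine AWord.ext (by simp only [len_mul, add_assoc]) (funext fun γ => ?_)
    have hp := p.len_nonneg
    have hq := q.len_nonneg
    simp only [toFun_mul, len_mul]
    by_cases h1 : γ ≤ p.len
    · rw [if_pos h1, if_pos (by linarith), if_pos h1]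
    · by_cases h2 : γ ≤ p.len + q.len
      · rw [if_pos h2, if_neg h1, if_neg h1, if_pos (by linarith)]
      · rw [if_neg h2, if_neg h1, if_neg (by intro h; apply h2; linarith), sub_sub]
  one_mul p := by
    refine AWord.ext (by simp only [len_mul, len_one, zero_add]) (funext fun γ => ?_)
    simp only [toFun_mul, len_one, toFun_one, sub_zero]
    split_ifs with h
    · rw [p.eq_none]
      intro h'
      linarith [h'.1]
    · rfl
  mul_one p := by
    refine AWord.ext (by simp only [len_mul, len_one, add_zero]) (funext fun γ => ?_)
    simp only [toFun_mul, toFun_one]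
    split_ifs with h
    · rfl
    · rw [p.eq_none]
      exact fun h' => h h'.2

/-- The word of length `1` consisting of the letter `a`. -/
noncomputable def letter (a : Γ) : AWord Γ where
  len := 1
  toFun γ := if γ = 1 then some a else none
  len_nonneg := zero_le_one
  isSome_iff γ := by
    split_ifs with h
    · simp [h]
    · simp only [Option.isSome_none, Bool.false_eq_true, false_iff]
      exact fun h' => h (le_antisymm h'.2 h'.1)

/-- The identification of finite words `a₁ ⋯ aₙ ∈ Γ*` with `A`-words of finite length. -/
noncomputable def ofList (l : List Γ) : AWord Γ := (l.map letter).prod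

/-- For an involution `inv` of the alphabet, the word `p̄`: read `p` from right to left
and apply `inv` to every letter. -/
noncomputable def bar (inv : Γ → Γ) (p : AWord Γ) : AWord Γ where
  len := p.len
  toFun γ := (p.toFun (p.len + 1 - γ)).map inv
  len_nonneg := p.len_nonneg
  isSome_iff γ := by
    rw [Option.isSome_map, p.isSome_iff]
    constructor
    · rintro ⟨h1, h2⟩
      exact ⟨by linarith, by linarith⟩
    · rintro ⟨h1, h2⟩
      exact ⟨by linarith, by linarith⟩

theorem bar_mul (inv : Γ → Γ) (p q : AWord Γ) :
    (p * q).bar inv = q.bar inv * p.bar inv := by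
  refine AWord.ext (by simp only [len_mul, bar, add_comm]) (funext fun γ => ?_)
  simp only [toFun_mul, len_mul, bar]
  by_cases h : γ ≤ q.len
  · have h' : ¬ (p.len + q.len + 1 - γ ≤ p.len) := by
      intro h'
      linarith
    rw [if_pos h, if_neg h']
    congr 2
    ring
  · have h0 : 1 ≤ γ - q.len := ZPoly.one_le_of_pos (by linarith [not_le.1 h])
    rw [if_neg h, if_pos (by linarith)]
    congr 2
    ring

theorem bar_one (inv : Γ → Γ) : (1 : AWord Γ).bar inv = 1 := rfl

theorem bar_bar {inv : Γ → Γ} (hinv : Function.Involutive inv) (p : AWord Γ) :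
    (p.bar inv).bar inv = p := by
  refine AWord.ext rfl (funext fun γ => ?_)
  simp only [bar, Option.map_map, hinv.comp_self, Option.map_id, id]
  congr 1
  ring

theorem bar_letter (inv : Γ → Γ) (a : Γ) : (letter a).bar inv = letter (inv a) := by
  refine AWord.ext rfl (funext fun γ => ?_)
  have : (1 + 1 - γ = 1) ↔ γ = 1 := by
    constructor
    · intro h
      linear_combination -h
    · rintro rfl
      ring
  simp only [bar, letter, this]
  split_ifs <;> rfl

theorem ofList_append (l m : List Γ) : ofList (l ++ m) = ofList l * ofList m := by
  simp [ofList]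

theorem bar_ofList (inv : Γ → Γ) (l : List Γ) :
    (ofList l).bar inv = ofList (l.reverse.map inv) := by
  induction l with
  | nil => rfl
  | cons a l ih =>
    have : ofList (a :: l) = letter a * ofList l := by simp [ofList]
    rw [this, bar_mul, ih, bar_letter, List.reverse_cons, List.map_append, ofList_append]
    simp [ofList]

end AWord

/-! ### Words over a group and the group `Ext(A, G)` for `A = ℤ[t]` -/

namespace GroupExt

variable {G : Type*} [Group G]

/-- The alphabet `Γ = Σ ∪ Σ⁻¹`, as a subset of `G`. -/
abbrev Alphabet (S : Set G) : Type _ := ↥(S ∪ S⁻¹)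

/-- The involution `a ↦ a⁻¹` on `Γ`. -/
def letterInv (S : Set G) (a : Alphabet S) : Alphabet S :=
  ⟨(a : G)⁻¹, by
    rcases a.2 with h | h
    · exact Or.inr (by simpa using h)
    · exact Or.inl h⟩

theorem letterInv_involutive (S : Set G) : Function.Involutive (letterInv S) :=
  fun a => Subtype.ext (inv_inv (a : G))

/-- The evaluation `π : Γ* → G` of finite words. -/
def eval (S : Set G) (l : List (Alphabet S)) : G := (l.map Subtype.val).prod

theorem eval_reverse_inv (S : Set G) (l : List (Alphabet S)) :
    eval S (l.reverse.map (letterInv S)) = (eval S l)⁻¹ := by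
  induction l with
  | nil => simp [eval]
  | cons a l ih =>
    have h : eval S (a :: l) = (a : G) * eval S l := by simp only [eval, List.map_cons, List.prod_cons]
    rw [h, mul_inv_rev, ← ih]
    simp only [eval, List.reverse_cons, List.map_append, List.prod_append, List.map_cons,
      List.map_nil, List.prod_cons, List.prod_nil, mul_one, letterInv]

/-- A word is `G`-reduced if no non-empty finite factor of it is the identity in `G`. -/
def IsGReduced (S : Set G) (x : AWord (Alphabet S)) : Prop :=
  ∀ (p q : AWord (Alphabet S)) (f : List (Alphabet S)),
    x = p * AWord.ofList f * q → f ≠ [] → eval S f ≠ 1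

/-- A word is a local geodesic if it has no finite factor `f` for which there is a finite word `g`
with `f = g` in `G` and `|g| < |f|`. -/
def IsLocalGeodesic (S : Set G) (x : AWord (Alphabet S)) : Prop :=
  ∀ (p q : AWord (Alphabet S)) (f : List (Alphabet S)), x = p * AWord.ofList f * q →
    ¬ ∃ g : List (Alphabet S), eval S f = eval S g ∧ g.length < f.length

/-- The defining relations of `M(A, G)`: `u ℓ r̄ ū = 1` for `u` a `G`-reduced word and finite words
`ℓ, r` with `π ℓ = π r`. -/
inductive DefRel (S : Set G) : AWord (Alphabet S) → AWord (Alphabet S) → Prop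
  | mk (u : AWord (Alphabet S)) (l r : List (Alphabet S)) (hu : IsGReduced S u)
      (hlr : eval S l = eval S r) :
      DefRel S
        (u * AWord.ofList l * (AWord.ofList r).bar (letterInv S) * u.bar (letterInv S)) 1

/-- The monoid `M(A, G)`: the quotient of the monoid of all closed `A`-words by the defining
relations. -/
abbrev ExtMonoid (S : Set G) : Type _ := (conGen (DefRel S)).Quotient

/-- The canonical epimorphism from the monoid of closed `A`-words onto `M(A, G)`. -/
noncomputable def toExtMonoid (S : Set G) : AWord (Alphabet S) →* ExtMonoid S :=
  (conGen (DefRel S)).mk'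

/-- `R*(A, G)`: the submonoid of the monoid of closed `A`-words generated by the `G`-reduced
words. -/
noncomputable def reducedSubmonoid (S : Set G) : Submonoid (AWord (Alphabet S)) :=
  Submonoid.closure {u | IsGReduced S u}

/-- `Ext(A, G)`: the image of `R*(A, G)` in `M(A, G)`. -/
noncomputable def Ext (S : Set G) : Submonoid (ExtMonoid S) :=
  (reducedSubmonoid S).map (toExtMonoid S)

theorem IsGReduced.bar {S : Set G} {u : AWord (Alphabet S)} (hu : IsGReduced S u) :
    IsGReduced S (u.bar (letterInv S)) := by
  intro p q f h hf h1
  have h2 := congrArg (AWord.bar (letterInv S)) h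
  rw [AWord.bar_bar (letterInv_involutive S), AWord.bar_mul, AWord.bar_mul, AWord.bar_ofList,
    ← mul_assoc] at h2
  refine hu _ _ _ h2 (by simpa using hf) ?_
  rw [eval_reverse_inv, h1, inv_one]

theorem toExtMonoid_mul_bar {S : Set G} {u : AWord (Alphabet S)} (hu : IsGReduced S u) :
    toExtMonoid S u * toExtMonoid S (u.bar (letterInv S)) = 1 := by
  have h : conGen (DefRel S) _ _ := ConGen.Rel.of _ _ (DefRel.mk u [] [] hu rfl)
  have h' := ((conGen (DefRel S)).eq).2 h
  have e : (AWord.ofList ([] : List (Alphabet S))) = 1 := by simp [AWord.ofList]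
  rw [e, AWord.bar_one, mul_one, mul_one] at h'
  rw [← map_mul]
  exact h'

theorem isUnit_ext {S : Set G} (x : Ext S) : IsUnit x := by
  obtain ⟨x, w, hw, rfl⟩ := x
  induction hw using Submonoid.closure_induction with
  | mem u hu =>
    have hmem : ∀ {v}, IsGReduced S v → toExtMonoid S v ∈ Ext S := fun hv =>
      ⟨_, Submonoid.subset_closure hv, rfl⟩
    have hb : IsGReduced S (u.bar (letterInv S)) := IsGReduced.bar hu
    refine ⟨⟨⟨_, hmem hu⟩, ⟨_, hmem hb⟩, Subtype.ext (toExtMonoid_mul_bar hu), Subtype.ext ?_⟩, rfl⟩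
    have := toExtMonoid_mul_bar hb
    rwa [AWord.bar_bar (letterInv_involutive S)] at this
  | one =>
    convert isUnit_one
    exact Subtype.ext (map_one _)
  | mul a b ha hb iha ihb =>
    convert iha.mul ihb
    exact Subtype.ext (map_mul _ _ _)

/-- `Ext(A, G)` is a group under the multiplication of `M(A, G)`. -/
noncomputable instance (S : Set G) : Group (Ext S) := groupOfIsUnit isUnit_ext

theorem IsLocalGeodesic.isGReduced {S : Set G} {x : AWord (Alphabet S)}
    (hx : IsLocalGeodesic S x) : IsGReduced S x := by
  intro p q f h hf h1
  exact hx p q f h ⟨[], by simpa [eval] using h1, by simpa [List.length_pos_iff] using hf⟩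

/-- The element of `Ext(A, G)` represented by a word in `R*(A, G)`. -/
noncomputable def toExt (S : Set G) : reducedSubmonoid S →* Ext S :=
  (toExtMonoid S).submonoidMap (reducedSubmonoid S)

/-- The product `δ i₁ ⋯ δ iₖ` in `R*(A, G)` of a sequence of members of a family `δ` of local
geodesics, given by the sequence `w = [i₁, …, iₖ]` of their indices. -/
noncomputable def geodesicProd (S : Set G) {n : ℕ} (δ : Fin n → AWord (Alphabet S))
    (hδ : ∀ i, IsLocalGeodesic S (δ i)) (w : List (Fin n)) : reducedSubmonoid S :=
  (w.map fun i => ⟨δ i, Submonoid.subset_closure (hδ i).isGReduced⟩).prod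

/-- The group `G` is generated by finitely many elements, and there is an algorithm that decides,
given a word in these generators and their inverses, whether it is the identity in `G`. -/
def DecidableWordProblem (G : Type*) [Group G] : Prop :=
  ∃ (n : ℕ) (g : Fin n → G), Subgroup.closure (Set.range g) = ⊤ ∧
    ComputablePred fun w : List (Fin n × Bool) => FreeGroup.lift g (FreeGroup.mk w) = 1

end GroupExt

/-! The `G`-reduced words of degree at most `d` are realized in a group `E_d` (`Level`, `tower`),
built by recursion on `d` from `E_0 = G`. A cell is a `G`-reduced word whose length has leading term
`t ^ (d + 1)`. The group `E_(d+1)` is generated by `E_d` and the cells, subject to moving words of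
degree at most `d` across the ends of a cell: `g y = y' h` holds when `y` and `y'` have a common
core that still has the leading term, and `g`, `h` account for the different prefixes and suffixes
(`Carry`).

This is a construction of HNN type. The formal products `g y h` form a biset on which `E_d` acts
freely, and normal forms yield a Britton lemma (`IsReduced.length_eq`). Hence `E_d` embeds into
`E_(d+1)`. Cutting a `G`-reduced word into cells never creates a cancellation
(`cls_ne_of_isGReduced`), so the number of cells in its normal form is the top coefficient of its
length (`length_nextφ`).

A product of local geodesics of degree at most `d` is trivial in `Ext(A, G)` iff it is trivial in
`E_d` (`toExt_geodesicProd_eq_one_iff`). One direction uses the homomorphism from `E_d` to `Ext(A,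
G)`; for the other, having the same values in all high levels is a congruence that contains the
defining relations. As letters are local geodesics and `G` embeds into every level, (ii) implies
(i).

For the converse, two statements are proved together by induction on `d`: the word problem for
finite families in the subgroup generated by local geodesics, and membership in every subgroup of
the group of periods of a local geodesic cell. A word over `E_(d+1)` is evaluated on a stack by
Britton reductions. Each reduction asks whether an element carries one of finitely many cells to
another; after division by one fixed solution this is membership in a group of periods
(`exists_transfer`, `exists_reduction`).

A period is determined by its shift, a polynomial of degree at most `d`, so groups of periods are
finitely generated. The top coefficient of the shift is bounded linearly in the length of the input
word, because the length function of the level measures the top coefficient of local geodesics.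
Finitely many corrections by powers of one period therefore reduce membership to shifts of lower
degree (`decidableMem_of_lowPer`). Such periods, conjugated by a long prefix of the cell, are
periods of a cell one level below (`exists_conj`); at level `0` they are trivial. -/

/-! ### Groups generated by a group and a free biset with involution -/

/-- A set with a free left action of `H` and an involution, such that the right action obtained by
conjugating the left action with the involution commutes with the left action. -/
class InvBiset (H Y : Type*) [Group H] extends MulAction H Y where
  inv : Y → Y
  inv_inv : ∀ y, inv (inv y) = y
  smul_comm' : ∀ (g h : H) (y : Y), g • inv (h • inv y) = inv (h • inv (g • y))
  free : ∀ (g : H) (y : Y), g • y = y → g = 1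

namespace InvBiset

variable {H Y : Type*} [Group H] [InvBiset H Y]

/-- The right action of `H`. -/
def rsmul (y : Y) (h : H) : Y := inv H (h⁻¹ • inv H y)

theorem inv_inv_self (y : Y) : inv H (inv H y) = y := inv_inv y

theorem smul_rsmul (g h : H) (y : Y) : g • rsmul y h = rsmul (g • y) h := smul_comm' _ _ _

theorem rsmul_one (y : Y) : rsmul y (1 : H) = y := by simp [rsmul, inv_inv_self]

theorem rsmul_mul (y : Y) (h k : H) : rsmul y (h * k) = rsmul (rsmul y h) k := by
  simp [rsmul, inv_inv_self, mul_smul]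

theorem inv_smul (g : H) (y : Y) : inv H (g • y) = rsmul (inv H y) g⁻¹ := by
  simp [rsmul, inv_inv_self]

theorem inv_rsmul (h : H) (y : Y) : inv H (rsmul y h) = h⁻¹ • inv H y := by
  simp [rsmul, inv_inv_self]

/-- The involution turns freeness of the left action into freeness of the right action; this is what
makes `dec` unique. -/
theorem rsmul_injective (y : Y) {h k : H} (e : rsmul y h = rsmul y k) : h = k := by
  have e' := congrArg (inv H) e
  rw [inv_rsmul, inv_rsmul] at e'
  have := free (k * h⁻¹) (inv H y) (by rw [mul_smul, e', smul_inv_smul])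
  exact (mul_inv_eq_one.1 this).symm

variable (H Y) in
/-- The equivalence relation whose classes are the orbits of the right action. -/
def rightSetoid : Setoid Y where
  r y z := ∃ h : H, z = rsmul y h
  iseqv :=
    { refl := fun y => ⟨1, (rsmul_one y).symm⟩
      symm := by
        rintro y z ⟨h, rfl⟩
        exact ⟨h⁻¹, by rw [← rsmul_mul, mul_inv_cancel, rsmul_one]⟩
      trans := by
        rintro y z w ⟨h, rfl⟩ ⟨k, rfl⟩
        exact ⟨h * k, (rsmul_mul _ _ _).symm⟩ }

variable (H Y) in
/-- The right orbits. -/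
abbrev RightOrbit := Quotient (rightSetoid H Y)

variable (H) in
/-- The right orbit of an element. -/
def cls (y : Y) : RightOrbit H Y := Quotient.mk _ y

theorem cls_eq {y z : Y} : cls H y = cls H z ↔ ∃ h : H, z = rsmul y h := by
  unfold cls
  rw [Quotient.eq]
  rfl

theorem cls_rsmul (y : Y) (h : H) : cls H (rsmul y h) = cls H y := (cls_eq.2 ⟨h, rfl⟩).symm

/-- A representative of a right orbit. -/
noncomputable def rep (r : RightOrbit H Y) : Y := Quotient.out r

theorem cls_rep (r : RightOrbit H Y) : cls H (rep r) = r := Quotient.out_eq r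

theorem exists_dec (y : Y) : ∃ h : H, y = rsmul (rep (cls H y)) h := cls_eq.1 (cls_rep _)

variable (H) in
/-- The element `h` with `y = r h`, where `r` is the chosen representative of the orbit of `y`. -/
noncomputable def dec (y : Y) : H := (exists_dec (H := H) y).choose

theorem rsmul_dec (y : Y) : rsmul (rep (cls H y)) (dec H y) = y :=
  (exists_dec (H := H) y).choose_spec.symm

theorem rep_cls (y : Y) : rep (cls H y) = rsmul y (dec H y)⁻¹ := by
  have h := congrArg (fun z => rsmul z (dec H y)⁻¹) (rsmul_dec (H := H) y)
  simpa only [← rsmul_mul, mul_inv_cancel, rsmul_one] using h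

theorem dec_rsmul (y : Y) (h : H) : dec H (rsmul y h) = dec H y * h := by
  apply rsmul_injective (rep (cls H y))
  have := rsmul_dec (H := H) (rsmul y h)
  rw [cls_rsmul] at this
  rw [this, rsmul_mul, rsmul_dec]

theorem dec_rep (r : RightOrbit H Y) : dec H (rep r) = 1 := by
  apply rsmul_injective (rep (cls H (rep r)))
  rw [rsmul_dec, rsmul_one, cls_rep]

theorem cls_smul {y z : Y} (g : H) : cls H (g • y) = cls H (g • z) ↔ cls H y = cls H z := by
  rw [cls_eq, cls_eq]
  constructor
  · rintro ⟨h, e⟩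
    refine ⟨h, ?_⟩
    rwa [← smul_rsmul, smul_left_cancel_iff] at e
  · rintro ⟨h, rfl⟩
    exact ⟨h, smul_rsmul _ _ _⟩

/-- The pairs of right orbits which are consecutive in a normal form. -/
def Adj (r s : RightOrbit H Y) : Prop := s ≠ cls H (inv H (rep r))

/-- Left multiplication by `g` rewrites `g r` as `r' h` with a representative `r'` and continues
with `h`. The list records the new orbits; `actRes` is the element of `H` that leaves at the right
end. -/
noncomputable def actList (g : H) : List (RightOrbit H Y) → List (RightOrbit H Y)
  | [] => []
  | r :: L => cls H (g • rep r) :: actList (dec H (g • rep r)) L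

noncomputable def actRes (g : H) : List (RightOrbit H Y) → H
  | [] => g
  | r :: L => actRes (dec H (g • rep r)) L

/-- The cocycle identity for pushing `g'` and then `g` through one representative. With
`cls_mul_smul` it makes the rewriting of lists an action. -/
theorem dec_mul_smul (g g' : H) (r : RightOrbit H Y) :
    dec H ((g * g') • rep r) = dec H (g • rep (cls H (g' • rep r))) * dec H (g' • rep r) := by
  rw [← dec_rsmul, ← smul_rsmul, rsmul_dec, mul_smul]

theorem cls_mul_smul (g g' : H) (r : RightOrbit H Y) :
    cls H ((g * g') • rep r) = cls H (g • rep (cls H (g' • rep r))) := by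
  rw [mul_smul, cls_smul, cls_rep]

theorem actList_one (L : List (RightOrbit H Y)) : actList (1 : H) L = L := by
  induction L with
  | nil => rfl
  | cons r L ih => simp [actList, one_smul, cls_rep, dec_rep, ih]

theorem actRes_one (L : List (RightOrbit H Y)) : actRes (1 : H) L = 1 := by
  induction L with
  | nil => rfl
  | cons r L ih => simp [actRes, one_smul, dec_rep, ih]

theorem actList_mul (g g' : H) (L : List (RightOrbit H Y)) :
    actList (g * g') L = actList g (actList g' L) := by
  induction L generalizing g g' with
  | nil => rfl
  | cons r L ih => simp only [actList, cls_mul_smul, dec_mul_smul, ih]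

theorem actRes_mul (g g' : H) (L : List (RightOrbit H Y)) :
    actRes (g * g') L = actRes g (actList g' L) * actRes g' L := by
  induction L generalizing g g' with
  | nil => rfl
  | cons r L ih => simp only [actList, actRes, dec_mul_smul, ih]

theorem actList_length (g : H) (L : List (RightOrbit H Y)) :
    (actList g L).length = L.length := by
  induction L generalizing g with
  | nil => rfl
  | cons r L ih => simp [actList, ih]

/-- Moving an element of `H` from the left factor to the right factor does not affect `Adj`. -/
theorem adj_iff (y z : Y) : Adj (cls H y) (cls H (dec H y • z)) ↔ cls H z ≠ cls H (inv H y) := by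
  have h : inv H (rep (cls H y)) = dec H y • inv H y := by
    rw [rep_cls, inv_rsmul, _root_.inv_inv]
  rw [Adj, h, Ne, cls_smul]

theorem actList_isChain (g : H) {L : List (RightOrbit H Y)} (hL : L.IsChain Adj) :
    (actList g L).IsChain Adj := by
  induction L generalizing g with
  | nil => exact List.IsChain.nil
  | cons r L ih =>
    cases L with
    | nil => exact List.isChain_singleton _
    | cons s L =>
      rw [List.isChain_cons_cons] at hL
      have := ih (dec H (g • rep r)) hL.2
      simp only [actList] at this ⊢
      rw [List.isChain_cons_cons]
      refine ⟨?_, this⟩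
      rw [adj_iff, cls_rep, inv_smul, cls_rsmul]
      exact hL.1

theorem isChain_tail {s : RightOrbit H Y} {L : List (RightOrbit H Y)} (c : (s :: L).IsChain Adj) :
    L.IsChain Adj := c.tail

variable (H Y) in
/-- Normal forms `r₁ ⋯ rₖ h`. -/
@[ext]
structure NormalForm where
  list : List (RightOrbit H Y)
  res : H
  isChain : list.IsChain Adj

/-! ### The actions of `H` and of the biset on normal forms. -/

namespace NormalForm

noncomputable instance : MulAction H (NormalForm H Y) where
  smul g x := ⟨actList g x.list, actRes g x.list * x.res, actList_isChain g x.isChain⟩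
  one_smul x := NormalForm.ext (actList_one _) (by
    change actRes 1 x.list * x.res = _
    rw [actRes_one, one_mul])
  mul_smul g g' x := NormalForm.ext (actList_mul _ _ _) (by
    change actRes (g * g') x.list * x.res = actRes g (actList g' x.list) * (actRes g' x.list * x.res)
    rw [actRes_mul, mul_assoc])

theorem smul_list (g : H) (x : NormalForm H Y) : (g • x).list = actList g x.list := rfl

theorem smul_res (g : H) (x : NormalForm H Y) : (g • x).res = actRes g x.list * x.res := rfl

/-- Left multiplication of a normal form by the representative of `r`. -/
noncomputable def push (r : RightOrbit H Y) : NormalForm H Y → NormalForm H Y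
  | ⟨[], h, _⟩ => ⟨[r], h, List.isChain_singleton _⟩
  | ⟨s :: L, h, c⟩ =>
    open Classical in
    if e : Adj r s then ⟨r :: s :: L, h, List.isChain_cons_cons.2 ⟨e, c⟩⟩
    else (dec H (inv H (rep r)))⁻¹ • ⟨L, h, isChain_tail c⟩

/-- `x` is the product of the representative of `r` and `z`. -/
def IsCons (r : RightOrbit H Y) (z x : NormalForm H Y) : Prop :=
  x.list = r :: z.list ∧ x.res = z.res

theorem IsCons.unique {r : RightOrbit H Y} {z x x' : NormalForm H Y} (h : IsCons r z x)
    (h' : IsCons r z x') : x = x' :=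
  NormalForm.ext (h.1.trans h'.1.symm) (h.2.trans h'.2.symm)

theorem IsCons.smul {r : RightOrbit H Y} {z x : NormalForm H Y} (h : IsCons r z x) (g : H) :
    IsCons (cls H (g • rep r)) (dec H (g • rep r) • z) (g • x) := by
  refine ⟨?_, ?_⟩
  · rw [smul_list, h.1]
    rfl
  · rw [smul_res, h.1, h.2]
    rfl

theorem IsCons.head_adj {r : RightOrbit H Y} {z x : NormalForm H Y} (h : IsCons r z x) :
    ∀ s ∈ z.list.head?, Adj r s := by
  have hc := x.isChain
  rw [h.1] at hc
  exact (List.isChain_cons.1 hc).1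

theorem exists_isCons (x : NormalForm H Y) {s : RightOrbit H Y} (h : s ∈ x.list.head?) :
    ∃ z, IsCons s z x := by
  obtain ⟨_ | ⟨t, L⟩, h', c⟩ := x
  · simp at h
  · obtain rfl : t = s := by simpa using h
    exact ⟨⟨L, h', isChain_tail c⟩, rfl, rfl⟩

theorem push_of_adj (r : RightOrbit H Y) (x : NormalForm H Y)
    (hx : ∀ s ∈ x.list.head?, Adj r s) : IsCons r x (push r x) := by
  obtain ⟨_ | ⟨s, L⟩, h, c⟩ := x
  · exact ⟨rfl, rfl⟩
  · simp only [List.head?_cons, Option.mem_def, Option.some.injEq, forall_eq'] at hx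
    simp [push, hx, IsCons]

/-- Let `s` be the orbit of the inverse of the representative `r`. Then `r⁻¹ = s k` with `k` given
by `dec`, whence `r s = k⁻¹`, and this is what remains after the cancellation. -/
theorem push_of_isCons (r : RightOrbit H Y) {x z : NormalForm H Y}
    (h : IsCons (cls H (inv H (rep r))) z x) :
    push r x = (dec H (inv H (rep r)))⁻¹ • z := by
  obtain ⟨L, h', c⟩ := x
  obtain ⟨h1, h2⟩ := h
  dsimp only at h1 h2
  subst h1 h2
  simp [push, Adj]

theorem smul_push (g : H) (r : RightOrbit H Y) (x : NormalForm H Y) :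
    g • push r x = push (cls H (g • rep r)) (dec H (g • rep r) • x) := by
  by_cases hx : ∀ s ∈ x.list.head?, Adj r s
  · refine ((push_of_adj r x hx).smul g).unique (push_of_adj _ _ ?_)
    rw [smul_list]
    cases hl : x.list with
    | nil => simp [actList]
    | cons s L =>
      simp only [actList, List.head?_cons, Option.mem_def, Option.some.injEq, forall_eq']
      rw [adj_iff, cls_rep, inv_smul, cls_rsmul]
      exact hx s (by simp [hl])
  · push Not at hx
    obtain ⟨s, hs, hn⟩ := hx
    obtain ⟨z, hz⟩ := exists_isCons x hs
    obtain rfl : s = cls H (inv H (rep r)) := by simpa [Adj] using hn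
    rw [push_of_isCons r hz]
    set k : H := dec H (g • rep r) with hk
    have e := hz.smul k
    -- Moving `k` through the head that cancels `r` gives the head that cancels the new first orbit,
    -- so both sides of the claim cancel simultaneously.
    have e' : cls H (k • rep (cls H (inv H (rep r)))) =
        cls H (inv H (rep (cls H (g • rep r)))) := by
      rw [rep_cls (g • rep r), inv_rsmul, inv_smul, rep_cls (inv H (rep r)), ← hk,
        smul_rsmul, smul_rsmul, cls_rsmul, cls_rsmul, _root_.inv_inv]
    rw [e'] at e
    rw [push_of_isCons _ e, rep_cls (g • rep r), inv_rsmul, inv_smul, rep_cls (inv H (rep r)),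
      smul_rsmul, smul_rsmul, dec_rsmul, dec_rsmul, ← hk, _root_.inv_inv, smul_smul, smul_smul]
    congr 1
    group

/-- Either the inner push lengthens the list and the outer one cancels the new head, or the inner
push cancels the head. In the second case `x` began with `r`, and the outer push restores it. -/
theorem push_push_inv (r : RightOrbit H Y) (x : NormalForm H Y) :
    push r (push (cls H (inv H (rep r))) (dec H (inv H (rep r)) • x)) = x := by
  set s := cls H (inv H (rep r)) with hs
  set m := dec H (inv H (rep r)) with hm
  by_cases hx : ∀ t ∈ (m • x).list.head?, Adj s t
  · rw [push_of_isCons r (push_of_adj s _ hx), ← hm, inv_smul_smul]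
  · push Not at hx
    obtain ⟨t, ht, hn⟩ := hx
    obtain ⟨z, hz⟩ := exists_isCons _ ht
    obtain rfl : t = cls H (inv H (rep s)) := by simpa [Adj] using hn
    rw [push_of_isCons s hz]
    have hrs : inv H (rep s) = m • rep r := by
      rw [rep_cls, inv_rsmul, inv_inv_self, _root_.inv_inv]
    have h := hz.smul m⁻¹
    rw [inv_smul_smul, hrs, rep_cls, smul_rsmul, inv_smul_smul, cls_rsmul, cls_rep, dec_rsmul,
      dec_rep, one_mul] at h
    rw [hrs]
    exact (push_of_adj r _ h.head_adj).unique h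

/-- Left multiplication of a normal form by an element of the biset. -/
noncomputable def act (y : Y) (x : NormalForm H Y) : NormalForm H Y :=
  push (cls H y) (dec H y • x)

theorem act_smul (g : H) (y : Y) (x : NormalForm H Y) : act (g • y) x = g • act y x := by
  rw [act, act, smul_push, smul_smul]
  conv_lhs => rw [← rsmul_dec (H := H) y, smul_rsmul, cls_rsmul, dec_rsmul]

theorem act_act_inv (y : Y) (x : NormalForm H Y) : act y (act (inv H y) x) = x := by
  have h : inv H y = (dec H y)⁻¹ • inv H (rep (cls H y)) := by
    conv_lhs => rw [← rsmul_dec (H := H) y, inv_rsmul]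
  rw [h, act_smul, act, smul_inv_smul, act, push_push_inv]

noncomputable def smulPerm : H →* Equiv.Perm (NormalForm H Y) := MulAction.toPermHom _ _

noncomputable def actPerm (y : Y) : Equiv.Perm (NormalForm H Y) where
  toFun := act y
  invFun := act (inv H y)
  left_inv x := by
    have h := act_act_inv (inv H y) x
    rwa [inv_inv_self] at h
  right_inv x := act_act_inv y x

end NormalForm

/-! ### The group of a biset and its Britton lemma. -/

inductive Rel (H Y : Type*) [Group H] [InvBiset H Y] : FreeGroup (H ⊕ Y) → Prop
  | mul (g h : H) : Rel H Y (.of (.inl g) * .of (.inl h) * (.of (.inl (g * h)))⁻¹)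
  | smul (g : H) (y : Y) : Rel H Y (.of (.inl g) * .of (.inr y) * (.of (.inr (g • y)))⁻¹)
  | inv (y : Y) : Rel H Y (.of (.inr y) * .of (.inr (inv H y)))

variable (H Y) in
/-- The group generated by `H` and the biset `Y`, where the involution becomes inversion. -/
abbrev BisetGroup := PresentedGroup {w | Rel H Y w}

namespace BisetGroup

/-- The canonical map from `H`. -/
def base : H →* BisetGroup H Y :=
  MonoidHom.mk' (fun h => PresentedGroup.of (.inl h)) fun g h =>
    (mul_inv_eq_one.1 (PresentedGroup.one_of_mem (rels := {w | Rel H Y w}) (.mul g h))).symm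

variable (H) in
/-- The canonical map from `Y`. -/
def elt (y : Y) : BisetGroup H Y := PresentedGroup.of (.inr y)

theorem base_mul_elt (g : H) (y : Y) : base g * elt H y = elt H (g • y) :=
  mul_inv_eq_one.1 (PresentedGroup.one_of_mem (rels := {w | Rel H Y w}) (.smul g y))

theorem elt_mul_elt_inv (y : Y) : elt H y * elt H (inv H y) = 1 :=
  PresentedGroup.one_of_mem (rels := {w | Rel H Y w}) (.inv y)

theorem elt_inv (y : Y) : elt H (inv H y) = (elt H y)⁻¹ :=
  eq_inv_of_mul_eq_one_right (elt_mul_elt_inv y)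

/-- The relation for the right action need not be imposed: it is the left one, conjugated by
inversion. -/
theorem elt_mul_base (y : Y) (h : H) : elt H y * base h = elt H (rsmul y h) := by
  rw [rsmul, elt_inv, ← base_mul_elt, elt_inv, map_inv]
  group

theorem induction_on {p : BisetGroup H Y → Prop} (x : BisetGroup H Y) (one : p 1)
    (base_mul : ∀ h x, p x → p (base h * x)) (elt_mul : ∀ y x, p x → p (elt H y * x)) : p x := by
  have hx : x ∈ Subgroup.closure (Set.range (PresentedGroup.of (rels := {w | Rel H Y w}))) := by
    rw [PresentedGroup.closure_range_of]
    trivial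
  induction hx using Subgroup.closure_induction_left with
  | one => exact one
  | mul_left a ha b hb ih =>
    obtain ⟨h | y, rfl⟩ := ha
    · exact base_mul h b ih
    · exact elt_mul y b ih
  | inv_mul_cancel a ha b hb ih =>
    obtain ⟨h | y, rfl⟩ := ha
    · have := base_mul h⁻¹ b ih
      rwa [map_inv] at this
    · have := elt_mul (inv H y) b ih
      rwa [elt_inv] at this

section lift

variable {K : Type*} [Group K] (f : H →* K) (F : Y → K) (hF : ∀ g y, F (g • y) = f g * F y)
  (hinv : ∀ y, F y * F (inv H y) = 1)

/-- The universal property. -/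
def lift : BisetGroup H Y →* K :=
  PresentedGroup.toGroup (f := Sum.elim f F) (by
    rintro _ (⟨g, h⟩ | ⟨g, y⟩ | y)
    · simp
    · simp [hF]
    · simp [hinv])

theorem lift_base (h : H) : lift f F hF hinv (base h) = f h := PresentedGroup.toGroup.of _

theorem lift_elt (y : Y) : lift f F hF hinv (elt H y) = F y := PresentedGroup.toGroup.of _

end lift

/-- The action on normal forms. -/
noncomputable def toPerm : BisetGroup H Y →* Equiv.Perm (NormalForm H Y) :=
  lift NormalForm.smulPerm NormalForm.actPerm
    (fun g y => Equiv.ext fun x => NormalForm.act_smul g y x)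
    (fun y => Equiv.ext fun x => NormalForm.act_act_inv y x)

/-- The number of biset elements in the normal form. -/
noncomputable def length (u : BisetGroup H Y) : ℕ :=
  (toPerm u ⟨[], 1, List.IsChain.nil⟩).list.length

theorem toPerm_base (h : H) (x : NormalForm H Y) : toPerm (base h) x = h • x := by
  rw [toPerm, lift_base]
  rfl

theorem toPerm_elt (y : Y) (x : NormalForm H Y) : toPerm (elt H y) x = NormalForm.act y x := by
  rw [toPerm, lift_elt]
  rfl

/-- The image of `g` sends the empty normal form to the one with residue `g`. -/
theorem base_injective : Function.Injective (base (H := H) (Y := Y)) := by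
  intro g h e
  have := congrArg (fun u => (toPerm u (⟨[], 1, List.IsChain.nil⟩ : NormalForm H Y)).res) e
  simpa [toPerm_base, NormalForm.smul_res, actRes] using this

theorem length_base_mul (h : H) (u : BisetGroup H Y) : length (base h * u) = length u := by
  rw [length, map_mul, Equiv.Perm.mul_apply, toPerm_base, NormalForm.smul_list, actList_length]
  rfl

theorem length_base (h : H) : length (base h : BisetGroup H Y) = 0 := by
  simp [length, toPerm_base, NormalForm.smul_list, actList]

theorem length_elt_mul_le (y : Y) (u : BisetGroup H Y) : length (elt H y * u) ≤ length u + 1 := by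
  rw [length, map_mul, Equiv.Perm.mul_apply, toPerm_elt, length]
  set x := toPerm u ⟨[], 1, List.IsChain.nil⟩
  have hl : (dec H y • x).list.length = x.list.length := actList_length _ _
  rw [NormalForm.act, ← hl]
  by_cases hx : ∀ s ∈ (dec H y • x).list.head?, Adj (cls H y) s
  · rw [(NormalForm.push_of_adj _ _ hx).1, List.length_cons]
  · push Not at hx
    obtain ⟨t, ht, hn⟩ := hx
    obtain ⟨z, hz⟩ := NormalForm.exists_isCons _ ht
    obtain rfl : t = cls H (inv H (rep (cls H y))) := by simpa [Adj] using hn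
    rw [NormalForm.push_of_isCons _ hz, NormalForm.smul_list, actList_length, hz.1,
      List.length_cons]
    omega

theorem exists_length_mul_le (g : BisetGroup H Y) :
    ∃ C, ∀ u, length (g * u) ≤ length u + C := by
  induction g using induction_on with
  | one => exact ⟨0, fun u => by simp⟩
  | base_mul h x ih =>
    obtain ⟨C, hC⟩ := ih
    exact ⟨C, fun u => by rw [mul_assoc, length_base_mul]; exact hC u⟩
  | elt_mul y x ih =>
    obtain ⟨C, hC⟩ := ih
    refine ⟨C + 1, fun u => ?_⟩
    have h1 := length_elt_mul_le y (x * u)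
    have h2 := hC u
    rw [mul_assoc]
    omega

/-- The product `y₁ h₁ ⋯ yₖ hₖ`. -/
def stackEval : List (Y × H) → BisetGroup H Y
  | [] => 1
  | p :: s => elt H p.1 * base p.2 * stackEval s

/-- No subword `y h y'` of the product `y₁ h₁ ⋯ yₖ hₖ` lies in `H`. -/
def IsReduced (s : List (Y × H)) : Prop :=
  s.IsChain fun p q => cls H (p.2 • q.1) ≠ cls H (inv H p.1)

/-- Britton's lemma: applied from right to left to the empty normal form, a reduced product only
lengthens the list. The head is part of the claim because the next push has to be compared with it.
-/
theorem IsReduced.toPerm_list {s : List (Y × H)} (hs : IsReduced s) :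
    (toPerm (stackEval s) (⟨[], 1, List.IsChain.nil⟩ : NormalForm H Y)).list.length = s.length ∧
    (toPerm (stackEval s) (⟨[], 1, List.IsChain.nil⟩ : NormalForm H Y)).list.head? =
      s.head?.map fun p => cls H p.1 := by
  induction s with
  | nil => simp [stackEval]
  | cons p s ih =>
    obtain ⟨h1, h2⟩ := ih hs.tail
    set x := toPerm (stackEval s) (⟨[], 1, List.IsChain.nil⟩ : NormalForm H Y)
    have e : toPerm (stackEval (p :: s)) (⟨[], 1, List.IsChain.nil⟩ : NormalForm H Y) =
        NormalForm.push (cls H p.1) (dec H p.1 • p.2 • x) := by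
      simp only [stackEval, map_mul, Equiv.Perm.mul_apply, toPerm_base, toPerm_elt, NormalForm.act]
      rfl
    have hx : ∀ r ∈ (dec H p.1 • p.2 • x).list.head?, Adj (cls H p.1) r := by
      intro r hr
      cases s with
      | nil =>
        have : x.list = [] := by simpa using h1
        rw [NormalForm.smul_list, NormalForm.smul_list, this] at hr
        simp [actList] at hr
      | cons q s =>
        obtain ⟨z, hz⟩ := NormalForm.exists_isCons x (s := cls H q.1) (by simp [h2])
        rw [← mul_smul, (hz.smul _).1] at hr
        have hq := (List.isChain_cons_cons.1 hs).1
        obtain rfl : _ = r := by simpa using hr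
        rw [mul_smul, adj_iff]
        rw [rep_cls, smul_rsmul, cls_rsmul]
        exact hq
    have h3 := (NormalForm.push_of_adj _ _ hx).1
    rw [e, h3]
    refine ⟨?_, by simp⟩
    rw [List.length_cons, NormalForm.smul_list, NormalForm.smul_list, actList_length,
      actList_length, h1, List.length_cons]

theorem IsReduced.length_eq {s : List (Y × H)} (hs : IsReduced s) :
    length (stackEval s) = s.length := hs.toPerm_list.1

end BisetGroup
end InvBiset

/-! ### The convex subgroups of polynomials of bounded degree -/

namespace ZPoly

open Polynomial

/-- Convexity of the polynomials of degree less than `d`; hence factors of words of low degree have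
low degree. -/
theorem low_of_le {d : ℕ} {α β : ℤ[X]} (h0 : 0 ≤ α) (h : α ≤ β) (hβ : β ∈ degreeLT ℤ d) :
    α ∈ degreeLT ℤ d := by
  rw [mem_degreeLT] at *
  by_contra hα
  rcases le_def.1 h with rfl | h
  · exact hα hβ
  rcases le_def.1 h0 with rfl | h0
  · rw [degree_zero] at hα
    exact hα (WithBot.bot_lt_coe d)
  · have hlt : β.degree < α.degree := lt_of_lt_of_le hβ (not_lt.1 hα)
    unfold Pos at *
    rw [sub_zero] at h0
    rw [← neg_sub, leadingCoeff_neg, leadingCoeff_sub_of_degree_lt hlt] at h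
    omega

theorem low_mono {d e : ℕ} (h : d ≤ e) {α : ℤ[X]} (hα : α ∈ degreeLT ℤ d) : α ∈ degreeLT ℤ e :=
  degreeLT_mono h hα

theorem low_left {d : ℕ} {α β : ℤ[X]} (h0 : 0 ≤ α) (h : 0 ≤ β) (hβ : α + β ∈ degreeLT ℤ d) :
    α ∈ degreeLT ℤ d := low_of_le h0 (by linarith) hβ

theorem low_right {d : ℕ} {α β : ℤ[X]} (h0 : 0 ≤ α) (h : 0 ≤ β) (hβ : α + β ∈ degreeLT ℤ d) :
    β ∈ degreeLT ℤ d := low_of_le h (by linarith) hβ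

theorem coeff_of_low {d : ℕ} {α : ℤ[X]} (hα : α ∈ degreeLT ℤ d) : α.coeff d = 0 :=
  coeff_eq_zero_of_degree_lt (mem_degreeLT.1 hα)

theorem low_of_coeff {d : ℕ} {α : ℤ[X]} (hα : α ∈ degreeLT ℤ (d + 1)) (h : α.coeff d = 0) :
    α ∈ degreeLT ℤ d := by
  rw [mem_degreeLT, degree_lt_iff_coeff_zero] at *
  intro m hm
  rcases hm.eq_or_lt with rfl | hm
  · exact h
  · exact hα m hm

theorem pos_of_coeff_pos {d : ℕ} {α : ℤ[X]} (hα : α ∈ degreeLT ℤ (d + 1)) (h : 0 < α.coeff d) :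
    0 < α := by
  rw [pos_iff, Pos]
  have hd : α.natDegree = d := by
    apply le_antisymm
    · rw [natDegree_le_iff_coeff_eq_zero]
      rw [mem_degreeLT, degree_lt_iff_coeff_zero] at hα
      intro N hN
      exact hα N hN
    · exact le_natDegree_of_ne_zero h.ne'
  rwa [leadingCoeff, hd]

theorem coeff_nonneg {d : ℕ} {α : ℤ[X]} (hα : α ∈ degreeLT ℤ (d + 1)) (h : 0 ≤ α) :
    0 ≤ α.coeff d := by
  by_contra hn
  have := pos_of_coeff_pos (α := -α) (neg_mem hα) (by rw [coeff_neg]; omega)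
  linarith

theorem lt_of_coeff_lt {d : ℕ} {α β : ℤ[X]} (hα : α ∈ degreeLT ℤ (d + 1))
    (hβ : β ∈ degreeLT ℤ (d + 1)) (h : α.coeff d < β.coeff d) : α < β := by
  have := pos_of_coeff_pos (sub_mem hβ hα) (by rw [coeff_sub]; omega)
  linarith

theorem X_pow_low (d : ℕ) : (X ^ d : ℤ[X]) ∈ degreeLT ℤ (d + 1) := by
  rw [mem_degreeLT, degree_X_pow]
  exact_mod_cast Nat.lt_succ_self d

theorem X_pow_pos (d : ℕ) : (0 : ℤ[X]) < X ^ d :=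
  pos_of_coeff_pos (X_pow_low d) (by simp)

theorem low_succ {d : ℕ} {α : ℤ[X]} (hα : α ∈ degreeLT ℤ d) : α ∈ degreeLT ℤ (d + 1) :=
  low_mono (Nat.le_succ d) hα

theorem exists_low (α : ℤ[X]) : ∃ d, ∀ e, d ≤ e → α ∈ degreeLT ℤ e :=
  ⟨α.natDegree + 1, fun _ h => low_mono h (mem_degreeLT.2
    (lt_of_le_of_lt degree_le_natDegree (by exact_mod_cast Nat.lt_succ_self _)))⟩

end ZPoly

/-! ### Factors of words -/

namespace AWord

open Polynomial

variable {Γ : Type*}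

theorem eq_one_of_len {w : AWord Γ} (h : w.len = 0) : w = 1 := by
  refine AWord.ext (h.trans len_one.symm) (funext fun γ => ?_)
  rw [toFun_one, w.eq_none]
  rintro ⟨h1, h2⟩
  rw [h] at h2
  linarith

theorem exists_split (w : AWord Γ) {β : ℤ[X]} (h0 : 0 ≤ β) (h : β ≤ w.len) :
    ∃ p q, w = p * q ∧ p.len = β := by
  refine ⟨⟨β, fun γ => if γ ≤ β then w.toFun γ else none, h0, ?_⟩,
    ⟨w.len - β, fun γ => if 1 ≤ γ then w.toFun (γ + β) else none, by linarith, ?_⟩, ?_, rfl⟩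
  · intro γ
    split_ifs with hγ
    · rw [w.isSome_iff]
      exact ⟨fun h' => ⟨h'.1, hγ⟩, fun h' => ⟨h'.1, by linarith⟩⟩
    · simp [hγ]
  · intro γ
    split_ifs with hγ
    · rw [w.isSome_iff]
      exact ⟨fun h' => ⟨hγ, by linarith⟩, fun h' => ⟨by linarith, by linarith⟩⟩
    · simp [hγ]
  · refine AWord.ext ?_ (funext fun γ => ?_)
    · rw [len_mul]
      ring
    · rw [toFun_mul]
      dsimp only
      split_ifs with h1 h2
      · rfl
      · rw [sub_add_cancel]
      · exact absurd (ZPoly.one_le_of_pos (by linarith [not_le.1 h1])) h2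

theorem eq_of_mul_eq {p q p' q' : AWord Γ} (h : p * q = p' * q') (hl : p.len = p'.len) :
    p = p' ∧ q = q' := by
  have hf : ∀ γ, (p * q).toFun γ = (p' * q').toFun γ := fun γ => by rw [h]
  have hlen := congrArg AWord.len h
  rw [len_mul, len_mul, hl] at hlen
  refine ⟨AWord.ext hl (funext fun γ => ?_), AWord.ext (add_left_cancel hlen) (funext fun γ => ?_)⟩
  · by_cases hγ : γ ≤ p.len
    · have := hf γ
      rwa [toFun_mul, toFun_mul, if_pos hγ, if_pos (hl ▸ hγ)] at this
    · rw [p.eq_none (fun h => hγ h.2), p'.eq_none (fun h => hγ (hl ▸ h.2))]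
  · by_cases hγ : 1 ≤ γ
    · have := hf (γ + p.len)
      rwa [toFun_mul, toFun_mul, if_neg (by linarith), if_neg (by rw [← hl]; linarith), ← hl,
        add_sub_cancel_right] at this
    · rw [q.eq_none (fun h => hγ h.1), q'.eq_none (fun h => hγ h.1)]

theorem mul_left_cancel_word {p q q' : AWord Γ} (h : p * q = p * q') : q = q' :=
  (eq_of_mul_eq h rfl).2

/-- Levi's lemma: of two prefixes of the same word, the longer one extends the shorter one. -/
theorem levi {p q p' q' : AWord Γ} (h : p * q = p' * q') (hl : p.len ≤ p'.len) :
    ∃ k, p' = p * k ∧ q = k * q' := by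
  obtain ⟨a, k, rfl, ha⟩ := exists_split p' p.len_nonneg hl
  rw [mul_assoc] at h
  obtain ⟨rfl, rfl⟩ := eq_of_mul_eq h ha.symm
  exact ⟨k, rfl, rfl⟩

theorem ofList_nil : ofList ([] : List Γ) = 1 := rfl

theorem ofList_cons (a : Γ) (l : List Γ) : ofList (a :: l) = letter a * ofList l := by
  simp [ofList]

theorem ofList_singleton (a : Γ) : ofList [a] = letter a := by simp [ofList]

theorem len_letter (a : Γ) : (letter a).len = 1 := rfl

theorem len_ofList (l : List Γ) : (ofList l).len = (l.length : ℤ[X]) := by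
  induction l with
  | nil => simp [ofList_nil, len_one]
  | cons a l ih => simp [ofList_cons, len_mul, ih, len_letter, add_comm]

theorem eq_letter {w : AWord Γ} (h : w.len = 1) : ∃ a, w = letter a := by
  have h1 : (w.toFun 1).isSome := by
    rw [w.isSome_iff, h]
    exact ⟨le_rfl, le_rfl⟩
  obtain ⟨a, ha⟩ := Option.isSome_iff_exists.1 h1
  refine ⟨a, AWord.ext h (funext fun γ => ?_)⟩
  by_cases hγ : γ = 1
  · simp [letter, hγ, ha]
  · rw [w.eq_none]
    · simp [letter, hγ]
    · rintro ⟨h2, h3⟩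
      rw [h] at h3
      exact hγ (le_antisymm h3 h2)

theorem eq_ofList_of_len {n : ℕ} {w : AWord Γ} (h : w.len = n) :
    ∃ l, w = ofList l ∧ l.length = n := by
  induction n generalizing w with
  | zero => exact ⟨[], eq_one_of_len (by simpa using h), rfl⟩
  | succ n ih =>
    push_cast at h
    have hn : (0 : ℤ[X]) ≤ n := Nat.cast_nonneg n
    obtain ⟨p, q, rfl, hp⟩ := w.exists_split zero_le_one (by linarith)
    obtain ⟨a, rfl⟩ := eq_letter hp
    rw [len_mul, hp] at h
    obtain ⟨l, rfl, hl⟩ := ih (w := q) (by linear_combination h)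
    exact ⟨a :: l, (ofList_cons a l).symm, by simp [hl]⟩

theorem exists_ofList {w : AWord Γ} (h : w.len ∈ degreeLT ℤ 1) : ∃ l, w = ofList l := by
  have h0 := ZPoly.coeff_nonneg (d := 0) h w.len_nonneg
  rw [mem_degreeLT] at h
  have hc : w.len = C (w.len.coeff 0) := by
    apply eq_C_of_degree_le_zero
    rw [degree_le_iff_coeff_zero]
    intro m hm
    exact (degree_lt_iff_coeff_zero _ _).1 h m (Nat.cast_pos.1 hm)
  obtain ⟨n, hn⟩ := Int.eq_ofNat_of_zero_le h0
  obtain ⟨l, hl, -⟩ := eq_ofList_of_len (n := n) (w := w) (by rw [hc, hn]; simp)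
  exact ⟨l, hl⟩

theorem len_ofList_low (l : List Γ) : (ofList l).len ∈ degreeLT ℤ 1 := by
  rw [len_ofList, mem_degreeLT]
  exact lt_of_le_of_lt (degree_natCast_le _) (by norm_num)

theorem length_eq_of_ofList_eq {l m : List Γ} (h : ofList l = ofList m) :
    l.length = m.length := by
  have h := congrArg AWord.len h
  rw [len_ofList, len_ofList] at h
  exact_mod_cast h

theorem letter_injective : Function.Injective (letter : Γ → AWord Γ) := by
  intro a b h
  have := congrArg (fun w => w.toFun 1) h
  simpa [letter] using this

theorem ofList_injective : Function.Injective (ofList : List Γ → AWord Γ) := by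
  intro l
  induction l with
  | nil =>
    intro m h
    exact (List.length_eq_zero_iff.1 (length_eq_of_ofList_eq h).symm).symm
  | cons a l ih =>
    rintro (_ | ⟨b, m⟩) h
    · exact absurd (length_eq_of_ofList_eq h) (by simp)
    · rw [ofList_cons, ofList_cons] at h
      obtain ⟨h1, h2⟩ := eq_of_mul_eq h rfl
      rw [letter_injective h1, ih h2]

theorem low_of_mul_left {d : ℕ} {p q : AWord Γ} (h : (p * q).len ∈ degreeLT ℤ d) :
    p.len ∈ degreeLT ℤ d := ZPoly.low_left p.len_nonneg q.len_nonneg h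

theorem low_of_mul_right {d : ℕ} {p q : AWord Γ} (h : (p * q).len ∈ degreeLT ℤ d) :
    q.len ∈ degreeLT ℤ d := ZPoly.low_right p.len_nonneg q.len_nonneg h

end AWord

/-! ### Evaluation of finite words, and factors of reduced and geodesic words. -/

namespace GroupExt

variable {G : Type*} [Group G] {S : Set G}

theorem eval_append (l m : List (Alphabet S)) : eval S (l ++ m) = eval S l * eval S m := by
  simp [eval]

theorem eval_nil : eval S ([] : List (Alphabet S)) = 1 := rfl

theorem eval_singleton (a : Alphabet S) : eval S [a] = a := by simp [eval]

theorem eval_surjective (hgen : Subgroup.closure S = ⊤) (g : G) :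
    ∃ l : List (Alphabet S), eval S l = g := by
  have hg : g ∈ Subgroup.closure S := hgen ▸ Subgroup.mem_top g
  induction hg using Subgroup.closure_induction with
  | mem x hx => exact ⟨[⟨x, Or.inl hx⟩], by simp [eval]⟩
  | one => exact ⟨[], rfl⟩
  | mul x y _ _ hx hy =>
    obtain ⟨l, rfl⟩ := hx
    obtain ⟨m, rfl⟩ := hy
    exact ⟨l ++ m, eval_append l m⟩
  | inv x _ hx =>
    obtain ⟨l, rfl⟩ := hx
    exact ⟨_, eval_reverse_inv S l⟩

theorem alphabet_ne_one (hone : (1 : G) ∉ S) (a : Alphabet S) : (a : G) ≠ 1 := by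
  rintro h
  rcases a.2 with h' | h'
  · exact hone (h ▸ h')
  · rw [h, Set.mem_inv, inv_one] at h'
    exact hone h'

theorem IsGReduced.factor {p x q : AWord (Alphabet S)} (h : IsGReduced S (p * x * q)) :
    IsGReduced S x := by
  rintro a b f rfl
  exact h (p * a) (b * q) f (by simp only [mul_assoc])

theorem IsGReduced.left {x q : AWord (Alphabet S)} (h : IsGReduced S (x * q)) :
    IsGReduced S x := IsGReduced.factor (p := 1) (q := q) (by rwa [one_mul])

theorem IsGReduced.right {p x : AWord (Alphabet S)} (h : IsGReduced S (p * x)) :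
    IsGReduced S x := IsGReduced.factor (p := p) (q := 1) (by rwa [mul_one])

theorem IsLocalGeodesic.factor {p x q : AWord (Alphabet S)} (h : IsLocalGeodesic S (p * x * q)) :
    IsLocalGeodesic S x := by
  rintro a b f rfl
  exact h (p * a) (b * q) f (by simp only [mul_assoc])

theorem IsLocalGeodesic.left {x q : AWord (Alphabet S)} (h : IsLocalGeodesic S (x * q)) :
    IsLocalGeodesic S x := IsLocalGeodesic.factor (p := 1) (q := q) (by rwa [one_mul])

theorem IsLocalGeodesic.right {p x : AWord (Alphabet S)} (h : IsLocalGeodesic S (p * x)) :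
    IsLocalGeodesic S x := IsLocalGeodesic.factor (p := p) (q := 1) (by rwa [mul_one])

theorem IsLocalGeodesic.bar {u : AWord (Alphabet S)} (hu : IsLocalGeodesic S u) :
    IsLocalGeodesic S (u.bar (letterInv S)) := by
  rintro p q f h ⟨g, hg, hl⟩
  have h2 := congrArg (AWord.bar (letterInv S)) h
  rw [AWord.bar_bar (letterInv_involutive S), AWord.bar_mul, AWord.bar_mul, AWord.bar_ofList,
    ← mul_assoc] at h2
  refine hu _ _ _ h2 ⟨g.reverse.map (letterInv S), ?_, by simpa using hl⟩
  rw [eval_reverse_inv, hg, eval_reverse_inv]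

theorem IsLocalGeodesic.length_le {l g : List (Alphabet S)}
    (h : IsLocalGeodesic S (AWord.ofList l)) (hg : eval S l = eval S g) :
    l.length ≤ g.length := by
  by_contra hn
  exact h 1 1 l (by simp) ⟨g, hg, not_le.1 hn⟩

theorem isLocalGeodesic_letter (hone : (1 : G) ∉ S) (a : Alphabet S) :
    IsLocalGeodesic S (AWord.letter a) := by
  rintro p q f h ⟨g, hg, hl⟩
  have hlen := congrArg AWord.len h
  simp only [AWord.len_mul, AWord.len_ofList, AWord.len_letter] at hlen
  have hf1 : f.length ≤ 1 := by
    have : (f.length : Polynomial ℤ) ≤ 1 := by linarith [p.len_nonneg, q.len_nonneg]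
    exact_mod_cast this
  have hf : f.length = 1 := by omega
  have hg0 : g = [] := List.length_eq_zero_iff.1 (by omega)
  obtain ⟨b, rfl⟩ := List.length_eq_one_iff.1 hf
  rw [hg0, eval_nil, eval_singleton] at hg
  exact alphabet_ne_one hone b hg

theorem isGReduced_one : IsGReduced S 1 := by
  intro p q f h hf
  have hlen := congrArg AWord.len h
  simp only [AWord.len_mul, AWord.len_ofList, AWord.len_one] at hlen
  have : (f.length : Polynomial ℤ) ≤ 0 := by linarith [p.len_nonneg, q.len_nonneg]
  have : f.length ≤ 0 := by exact_mod_cast this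
  exact absurd (List.length_eq_zero_iff.1 (by omega)) hf

/-- If `u` begins with a letter `a`, then the factor `a⁻¹ a` appears where the two words meet. -/
theorem not_isGReduced_bar_mul {u : AWord (Alphabet S)} (h : IsGReduced S (u.bar (letterInv S) * u)) :
    u = 1 := by
  by_contra hu
  have h0 : 0 < u.len := lt_of_le_of_ne u.len_nonneg fun h => hu (AWord.eq_one_of_len h.symm)
  obtain ⟨p, q, rfl, hp⟩ := u.exists_split zero_le_one (ZPoly.one_le_of_pos h0)
  obtain ⟨a, rfl⟩ := AWord.eq_letter hp
  refine h (q.bar (letterInv S)) q [letterInv S a, a] ?_ (by simp) ?_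
  · rw [AWord.bar_mul, AWord.bar_letter, AWord.ofList_cons, AWord.ofList_singleton]
    simp only [mul_assoc]
  · simp [eval, letterInv]

end GroupExt

/-! ### Levels, cells, and the biset of cells. -/

namespace GroupExt

open Polynomial

universe u

variable {G : Type u} [Group G] {S : Set G}

/-- The element of `Ext(A, G)` represented by a `G`-reduced word. -/
noncomputable def extOf (w : AWord (Alphabet S)) (hw : IsGReduced S w) : Ext S :=
  toExt S ⟨w, Submonoid.subset_closure hw⟩

theorem extOf_mul (v w : AWord (Alphabet S)) (hv : IsGReduced S v) (hw : IsGReduced S w)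
    (h : IsGReduced S (v * w)) : extOf (v * w) h = extOf v hv * extOf w hw := by
  rw [extOf, extOf, extOf, ← map_mul]
  rfl

theorem extOf_mul_bar (w : AWord (Alphabet S)) (hw : IsGReduced S w) :
    extOf w hw * extOf (w.bar (letterInv S)) hw.bar = 1 :=
  Subtype.ext (toExtMonoid_mul_bar hw)

/-- The `G`-reduced words of degree at most `d`. -/
def Small (S : Set G) (d : ℕ) (w : AWord (Alphabet S)) : Prop :=
  IsGReduced S w ∧ w.len ∈ degreeLT ℤ (d + 1)

theorem Small.left {d : ℕ} {v w : AWord (Alphabet S)} (h : Small S d (v * w)) : Small S d v :=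
  ⟨h.1.left, AWord.low_of_mul_left h.2⟩

theorem Small.right {d : ℕ} {v w : AWord (Alphabet S)} (h : Small S d (v * w)) : Small S d w :=
  ⟨h.1.right, AWord.low_of_mul_right h.2⟩

theorem Small.bar {d : ℕ} {w : AWord (Alphabet S)} (h : Small S d w) :
    Small S d (w.bar (letterInv S)) := ⟨h.1.bar, h.2⟩

theorem small_one {d : ℕ} : Small S d 1 := ⟨isGReduced_one, zero_mem _⟩

/-- A group that realizes the `G`-reduced words of degree at most `d`. -/
structure Level (S : Set G) (d : ℕ) : Type (u + 1) where
  E : Type u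
  [group : Group E]
  φ : AWord (Alphabet S) → E
  γ : G →* E
  ψ : E →* Ext S
  len : E → ℕ
  φ_mul : ∀ v w, Small S d (v * w) → φ (v * w) = φ v * φ w
  φ_bar : ∀ w, Small S d w → φ (w.bar (letterInv S)) = (φ w)⁻¹
  eq_one : ∀ w, Small S d w → φ w = 1 → w = 1
  φ_ofList : ∀ l, φ (AWord.ofList l) = γ (eval S l)
  γ_injective : Function.Injective γ
  ψ_φ : ∀ w (hw : Small S d w), ψ (φ w) = extOf w hw.1
  exists_len_mul_le : ∀ g, ∃ C, ∀ x, len (g * x) ≤ len x + C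
  len_φ : ∀ w, IsLocalGeodesic S w → w.len ∈ degreeLT ℤ (d + 1) →
    len (φ w) = (w.len.coeff d).toNat

attribute [instance] Level.group

/-- A word whose length has the leading term `t ^ d`. -/
def IsCell (d : ℕ) (w : AWord (Alphabet S)) : Prop :=
  w.len ∈ degreeLT ℤ (d + 1) ∧ w.len.coeff d = 1

theorem IsCell.lt {d : ℕ} {c w : AWord (Alphabet S)} (hc : IsCell d c)
    (hw : w.len ∈ degreeLT ℤ d) : w.len < c.len :=
  ZPoly.lt_of_coeff_lt (ZPoly.low_succ hw) hc.1 (by rw [ZPoly.coeff_of_low hw, hc.2]; norm_num)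

theorem IsCell.bar {d : ℕ} {c : AWord (Alphabet S)} (hc : IsCell d c) :
    IsCell d (c.bar (letterInv S)) := hc

theorem IsCell.of_mul_left {d : ℕ} {a c : AWord (Alphabet S)} (hc : IsCell d (a * c))
    (ha : a.len ∈ degreeLT ℤ d) : IsCell d c := by
  refine ⟨AWord.low_of_mul_right hc.1, ?_⟩
  have := hc.2
  rwa [AWord.len_mul, coeff_add, ZPoly.coeff_of_low ha, zero_add] at this

theorem IsCell.mul_left {d : ℕ} {a c : AWord (Alphabet S)} (hc : IsCell d c)
    (ha : a.len ∈ degreeLT ℤ d) : IsCell d (a * c) :=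
  ⟨add_mem (ZPoly.low_succ ha) hc.1, by
    rw [AWord.len_mul, coeff_add, ZPoly.coeff_of_low ha, hc.2, zero_add]⟩

theorem IsCell.mul_right {d : ℕ} {a c : AWord (Alphabet S)} (hc : IsCell d c)
    (ha : a.len ∈ degreeLT ℤ d) : IsCell d (c * a) :=
  ⟨add_mem hc.1 (ZPoly.low_succ ha), by
    rw [AWord.len_mul, coeff_add, ZPoly.coeff_of_low ha, hc.2, add_zero]⟩

theorem IsCell.ne_one {d : ℕ} {c : AWord (Alphabet S)} (hc : IsCell d c) : c ≠ 1 := by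
  rintro rfl
  have := hc.2
  simp [AWord.len_one] at this

/-- Both cells omit from the common word only margins of degree less than `d`, so they overlap in a
factor `k` that keeps the leading term; `a`, `b`, `f`, `j` are the parts of the cells outside the
overlap. -/
theorem exists_common_core_aux {d : ℕ} {p c q r e s : AWord (Alphabet S)}
    (h : p * c * q = r * e * s) (hc : IsCell d c) (he : IsCell d e)
    (hq : q.len ∈ degreeLT ℤ d) (hr : r.len ∈ degreeLT ℤ d) (hs : s.len ∈ degreeLT ℤ d)
    (hpr : p.len ≤ r.len) :
    ∃ a b k f j, p * a = r * b ∧ c = a * k * f ∧ e = b * k * j ∧ f * q = j * s ∧ IsCell d k ∧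
      a.len ∈ degreeLT ℤ d ∧ b.len ∈ degreeLT ℤ d ∧ f.len ∈ degreeLT ℤ d ∧
        j.len ∈ degreeLT ℤ d := by
  rw [mul_assoc, mul_assoc] at h
  obtain ⟨a, rfl, h2⟩ := AWord.levi h hpr
  have ha := AWord.low_of_mul_right hr
  obtain ⟨c', rfl, h3⟩ := AWord.levi h2.symm (hc.lt ha).le
  have hc' := hc.of_mul_left ha
  rcases le_total c'.len e.len with hl | hl
  · obtain ⟨j, rfl, rfl⟩ := AWord.levi h3.symm hl
    exact ⟨a, 1, c', 1, j, by simp, by simp, by simp, by simp, hc', ha, zero_mem _, zero_mem _,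
      AWord.low_of_mul_left hq⟩
  · obtain ⟨f, rfl, rfl⟩ := AWord.levi h3 hl
    exact ⟨a, 1, e, f, 1, by simp, by simp [mul_assoc], by simp, by simp, he, ha, zero_mem _,
      AWord.low_of_mul_left hs, zero_mem _⟩

theorem exists_common_core {d : ℕ} {p c q r e s : AWord (Alphabet S)}
    (h : p * c * q = r * e * s) (hc : IsCell d c) (he : IsCell d e)
    (hp : p.len ∈ degreeLT ℤ d) (hq : q.len ∈ degreeLT ℤ d)
    (hr : r.len ∈ degreeLT ℤ d) (hs : s.len ∈ degreeLT ℤ d) :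
    ∃ a b k f j, p * a = r * b ∧ c = a * k * f ∧ e = b * k * j ∧ f * q = j * s ∧ IsCell d k ∧
      a.len ∈ degreeLT ℤ d ∧ b.len ∈ degreeLT ℤ d ∧ f.len ∈ degreeLT ℤ d ∧
        j.len ∈ degreeLT ℤ d := by
  rcases le_total p.len r.len with hl | hl
  · exact exists_common_core_aux h hc he hq hr hs hl
  · obtain ⟨a, b, k, f, j, h1, h2, h3, h4, hk, ha, hb, hf, hj⟩ :=
      exists_common_core_aux h.symm he hc hs hp hq hl
    exact ⟨b, a, k, j, f, h1.symm, h3, h2, h4.symm, hk, hb, ha, hj, hf⟩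

namespace Level

variable {d : ℕ} (Λ : Level S d)

theorem φ_one : Λ.φ 1 = 1 := by
  have := Λ.φ_mul 1 1 (by rw [mul_one]; exact small_one)
  rwa [mul_one, left_eq_mul] at this

/-- `g y = y' h`, where the common part of `y` and `y'` is shifted by `a`. -/
def Carry (g : Λ.E) (y y' : AWord (Alphabet S)) (h : Λ.E) (a : ℤ[X]) : Prop :=
  ∃ p c q p' q', y = p * c * q ∧ y' = p' * c * q' ∧ IsCell (d + 1) c ∧ Small S d p ∧ Small S d q ∧
    Small S d p' ∧ Small S d q' ∧ g * Λ.φ p = Λ.φ p' ∧ Λ.φ q = Λ.φ q' * h ∧ a = p'.len - p.len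

variable {Λ}

theorem Carry.refl {y : AWord (Alphabet S)} (hy : IsCell (d + 1) y) : Λ.Carry 1 y y 1 0 :=
  ⟨1, y, 1, 1, 1, by simp, by simp, hy, small_one, small_one, small_one, small_one, by simp,
    by simp, by simp⟩

theorem Carry.symm {g h : Λ.E} {y y' : AWord (Alphabet S)} {a : ℤ[X]} (H : Λ.Carry g y y' h a) :
    Λ.Carry g⁻¹ y' y h⁻¹ (-a) := by
  obtain ⟨p, c, q, p', q', e1, e2, hc, hp, hq, hp', hq', e3, e4, rfl⟩ := H
  exact ⟨p', c, q', p, q, e2, e1, hc, hp', hq', hp, hq, by rw [← e3, inv_mul_cancel_left],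
    by rw [e4, mul_inv_cancel_right], by ring⟩

/-- The two carries use different cores of `y'`. Their overlap is still a cell and serves as core
for the composite. -/
theorem Carry.trans {g h g' h' : Λ.E} {y y' y'' : AWord (Alphabet S)} {a a' : ℤ[X]}
    (hy : IsGReduced S y) (hy' : IsGReduced S y') (hy'' : IsGReduced S y'')
    (H : Λ.Carry g y y' h a) (H' : Λ.Carry g' y' y'' h' a') :
    Λ.Carry (g' * g) y y'' (h' * h) (a + a') := by
  obtain ⟨p, c, q, p', q', rfl, rfl, hc, hp, hq, hp', hq', e3, e4, rfl⟩ := H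
  obtain ⟨r, e, s, r', s', e1, rfl, he, hr, hs, hr', hs', e5, e6, rfl⟩ := H'
  obtain ⟨a, b, k, f, j, h1, rfl, rfl, h4, hk, ha, hb, hf, hj⟩ :=
    exists_common_core e1 hc he hp'.2 hq'.2 hr.2 hs.2
  have w1 : p * (a * k * f) * q = p * a * k * (f * q) := by simp only [mul_assoc]
  have w2 : p' * (a * k * f) * q' = p' * a * k * (f * q') := by simp only [mul_assoc]
  have w3 : r' * (b * k * j) * s' = r' * b * k * (j * s') := by simp only [mul_assoc]
  rw [w1] at hy ⊢
  rw [w2] at hy'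
  rw [w3] at hy'' ⊢
  have s1 : Small S d (p * a) := ⟨hy.left.left, add_mem hp.2 ha⟩
  have s2 : Small S d (f * q) := ⟨hy.right, add_mem hf hq.2⟩
  have s3 : Small S d (r' * b) := ⟨hy''.left.left, add_mem hr'.2 hb⟩
  have s4 : Small S d (j * s') := ⟨hy''.right, add_mem hj hs'.2⟩
  have s5 : Small S d (p' * a) := ⟨hy'.left.left, add_mem hp'.2 ha⟩
  have s6 : Small S d (f * q') := ⟨hy'.right, add_mem hf hq'.2⟩
  refine ⟨p * a, k, f * q, r' * b, j * s', rfl, rfl, hk, s1, s2, s3, s4, ?_, ?_, ?_⟩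
  · have s5' := s5
    rw [h1] at s5'
    rw [Λ.φ_mul _ _ s1, Λ.φ_mul _ _ s3, ← e5, mul_assoc, ← mul_assoc g, e3, ← Λ.φ_mul _ _ s5, h1,
      Λ.φ_mul _ _ s5', mul_assoc]
  · have s6' := s6
    rw [h4] at s6'
    rw [Λ.φ_mul _ _ s2, Λ.φ_mul _ _ s4, e4, ← mul_assoc, ← Λ.φ_mul _ _ s6, h4, Λ.φ_mul _ _ s6', e6]
    simp only [mul_assoc]
  · have := congrArg AWord.len h1
    simp only [AWord.len_mul] at this ⊢
    linear_combination this

theorem Carry.bar {g h : Λ.E} {y y' : AWord (Alphabet S)} {a : ℤ[X]} (H : Λ.Carry g y y' h a) :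
    ∃ b, Λ.Carry h (y.bar (letterInv S)) (y'.bar (letterInv S)) g b := by
  obtain ⟨p, c, q, p', q', rfl, rfl, hc, hp, hq, hp', hq', e3, e4, rfl⟩ := H
  refine ⟨_, q.bar _, c.bar _, p.bar _, q'.bar _, p'.bar _, ?_, ?_, hc.bar, hq.bar, hp.bar, hq'.bar,
    hp'.bar, ?_, ?_, rfl⟩
  · simp only [AWord.bar_mul, mul_assoc]
  · simp only [AWord.bar_mul, mul_assoc]
  · rw [Λ.φ_bar _ hq, Λ.φ_bar _ hq', e4]
    group
  · rw [Λ.φ_bar _ hp, Λ.φ_bar _ hp', ← e3]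
    group

/-- The longer prefix extends the shorter one by a `G`-reduced word of trivial value, which is empty
by `eq_one`. -/
theorem eq_of_φ_eq_left {p x p' x' : AWord (Alphabet S)} (h : p * x = p' * x') (hp : Small S d p)
    (hp' : Small S d p') (e : Λ.φ p = Λ.φ p') : p = p' := by
  rcases le_total p.len p'.len with hl | hl
  · obtain ⟨k, rfl, -⟩ := AWord.levi h hl
    rw [Λ.φ_mul _ _ hp', left_eq_mul] at e
    rw [Λ.eq_one k hp'.right e, mul_one]
  · obtain ⟨k, rfl, -⟩ := AWord.levi h.symm hl
    rw [Λ.φ_mul _ _ hp, mul_eq_left] at e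
    rw [Λ.eq_one k hp.right e, mul_one]

/-- Composing one carry with the inverse of the other gives a carry of `y` to itself, where either
the values or the lengths of the two prefixes agree, so that the prefixes coincide. Consequently the
shift determines the element, and the element determines everything else. -/
theorem Carry.unique {g g' h h' : Λ.E} {y y' : AWord (Alphabet S)} {a a' : ℤ[X]}
    (hy : IsGReduced S y) (hy' : IsGReduced S y') (H : Λ.Carry g y y' h a)
    (H' : Λ.Carry g' y y' h' a') : (g = g' → h = h' ∧ a = a') ∧ (a = a' → g = g') := by
  have H := H.trans hy hy' hy H'.symm
  obtain ⟨p, c, q, p', q', rfl, e2, hc, hp, hq, hp', hq', e3, e4, e5⟩ := H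
  constructor
  · rintro rfl
    rw [inv_mul_cancel, one_mul] at e3
    rw [mul_assoc, mul_assoc] at e2
    obtain rfl := eq_of_φ_eq_left e2 hp hp' e3
    obtain ⟨-, rfl⟩ := AWord.eq_of_mul_eq (AWord.mul_left_cancel_word e2) rfl
    rw [left_eq_mul, inv_mul_eq_one] at e4
    exact ⟨e4.symm, by linear_combination e5⟩
  · rintro rfl
    rw [mul_assoc, mul_assoc] at e2
    obtain ⟨rfl, -⟩ := AWord.eq_of_mul_eq e2 (by linear_combination e5)
    rw [mul_eq_right, inv_mul_eq_one] at e3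
    exact e3.symm

variable (Λ) in
/-- The `G`-reduced words whose length has the leading term `t ^ (d + 1)`. -/
abbrev Cell (_ : Level S d) := {y : AWord (Alphabet S) // IsGReduced S y ∧ IsCell (d + 1) y}

noncomputable def cellBar (y : Λ.Cell) : Λ.Cell := ⟨y.1.bar (letterInv S), y.2.1.bar, y.2.2.bar⟩

theorem cellBar_cellBar (y : Λ.Cell) : cellBar (cellBar y) = y :=
  Subtype.ext (AWord.bar_bar (letterInv_involutive S) _)

variable (Λ) in
/-- Formal products `g y h` up to the moving of small words across the boundaries. -/
def bisetSetoid : Setoid (Λ.E × Λ.Cell × Λ.E) where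
  r x z := ∃ a, Λ.Carry (z.1⁻¹ * x.1) x.2.1.1 z.2.1.1 (z.2.2 * x.2.2⁻¹) a
  iseqv :=
    { refl := fun x => ⟨0, by simpa using Carry.refl x.2.1.2.2⟩
      symm := by
        rintro x z ⟨a, h⟩
        exact ⟨_, by simpa using h.symm⟩
      trans := by
        rintro x z w ⟨a, h⟩ ⟨b, h'⟩
        have := h.trans x.2.1.2.1 z.2.1.2.1 w.2.1.2.1 h'
        exact ⟨_, by simpa [mul_assoc] using this⟩ }

variable (Λ) in
/-- The biset generated by the cells. -/
def CellBiset := Quotient Λ.bisetSetoid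

def bisetMk (g : Λ.E) (y : Λ.Cell) (h : Λ.E) : Λ.CellBiset := Quotient.mk _ (g, y, h)

theorem bisetMk_eq {g h g' h' : Λ.E} {y y' : Λ.Cell} : bisetMk g y h = bisetMk g' y' h' ↔
    ∃ a, Λ.Carry (g'⁻¹ * g) y.1 y'.1 (h' * h⁻¹) a := Quotient.eq (r := Λ.bisetSetoid)

theorem bisetMk_ind {p : Λ.CellBiset → Prop} (h : ∀ g y h, p (bisetMk g y h)) (x) : p x := by
  obtain ⟨g, y, k⟩ := x
  exact h g y k

def bisetSMul (k : Λ.E) : Λ.CellBiset → Λ.CellBiset :=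
  Quotient.lift (fun x => bisetMk (k * x.1) x.2.1 x.2.2) fun x z h => by
    obtain ⟨a, h⟩ := h
    exact bisetMk_eq.2 ⟨a, by simpa [mul_assoc] using h⟩

noncomputable def bisetInv : Λ.CellBiset → Λ.CellBiset :=
  Quotient.lift (fun x => bisetMk x.2.2⁻¹ (cellBar x.2.1) x.1⁻¹) fun x z h => by
    obtain ⟨a, h⟩ := h
    obtain ⟨b, h⟩ := h.bar
    exact bisetMk_eq.2 ⟨b, by simpa [cellBar] using h⟩

theorem bisetSMul_mk (k g : Λ.E) (y : Λ.Cell) (h : Λ.E) :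
    bisetSMul k (bisetMk g y h) = bisetMk (k * g) y h := rfl

theorem bisetInv_mk (g : Λ.E) (y : Λ.Cell) (h : Λ.E) :
    bisetInv (bisetMk g y h) = bisetMk h⁻¹ (cellBar y) g⁻¹ := rfl

noncomputable instance : InvBiset Λ.E Λ.CellBiset where
  smul := bisetSMul
  one_smul x := by
    induction x using bisetMk_ind with
    | h g y h => exact (bisetSMul_mk _ _ _ _).trans (by rw [one_mul])
  mul_smul k l x := by
    induction x using bisetMk_ind with
    | h g y h => exact (bisetSMul_mk _ _ _ _).trans (by rw [mul_assoc]; rfl)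
  inv := bisetInv
  inv_inv x := by
    induction x using bisetMk_ind with
    | h g y h => rw [bisetInv_mk, bisetInv_mk, cellBar_cellBar, inv_inv, inv_inv]
  smul_comm' k l x := by
    induction x using bisetMk_ind with
    | h g y h =>
      change bisetSMul k (bisetInv (bisetSMul l (bisetInv _))) =
        bisetInv (bisetSMul l (bisetInv (bisetSMul k _)))
      simp only [bisetSMul_mk, bisetInv_mk, cellBar_cellBar, mul_inv_rev, inv_inv]
  free k x := by
    induction x using bisetMk_ind with
    | h g y h =>
      intro e
      change bisetSMul k _ = _ at e
      rw [bisetSMul_mk, bisetMk_eq] at e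
      obtain ⟨a, e⟩ := e
      rw [mul_inv_cancel] at e
      -- Here the element on the right is known to be trivial, whereas uniqueness starts from the
      -- element on the left; reversal exchanges the two.
      obtain ⟨b, e⟩ := e.bar
      have := ((e.unique y.2.1.bar y.2.1.bar (Carry.refl y.2.2.bar)).1 rfl).1
      rw [inv_mul_eq_one] at this
      rwa [right_eq_mul] at this

theorem smul_mk (k g : Λ.E) (y : Λ.Cell) (h : Λ.E) :
    k • bisetMk g y h = bisetMk (k * g) y h := rfl

theorem inv_mk (g : Λ.E) (y : Λ.Cell) (h : Λ.E) :
    InvBiset.inv Λ.E (bisetMk g y h) = bisetMk h⁻¹ (cellBar y) g⁻¹ := rfl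

theorem rsmul_mk (g : Λ.E) (y : Λ.Cell) (h k : Λ.E) :
    InvBiset.rsmul (bisetMk g y h) k = bisetMk g y (h * k) := by
  simp only [InvBiset.rsmul, smul_mk, inv_mk, cellBar_cellBar, mul_inv_rev, inv_inv]

/-- Links the orbit condition of Britton's lemma with carries: two neighbouring cells cancel exactly
if the element between them carries the second to the reversal of the first. -/
theorem cls_mk_eq {g : Λ.E} {y y' : Λ.Cell} :
    InvBiset.cls Λ.E (g • bisetMk 1 y 1) = InvBiset.cls Λ.E (bisetMk 1 y' 1) ↔
      ∃ h a, Λ.Carry g y.1 y'.1 h a := by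
  rw [smul_mk, eq_comm, InvBiset.cls_eq]
  simp only [rsmul_mk, bisetMk_eq]
  constructor
  · rintro ⟨h, a, e⟩
    exact ⟨_, _, by simpa using e⟩
  · rintro ⟨h, a, e⟩
    exact ⟨h, a, by simpa using e⟩

end Level
end GroupExt

/-! ### Construction of the next level. -/

namespace GroupExt

open Polynomial

universe u

variable {G : Type u} [Group G] {S : Set G}

/-- A word whose length has the coefficient `n` at `t ^ d` and degree at most `d`. -/
def HasTop (d n : ℕ) (w : AWord (Alphabet S)) : Prop :=
  w.len ∈ degreeLT ℤ (d + 1) ∧ w.len.coeff d = n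

theorem isCell_iff_hasTop {d : ℕ} {w : AWord (Alphabet S)} : IsCell d w ↔ HasTop d 1 w := by
  simp [IsCell, HasTop]

theorem hasTop_zero {d : ℕ} {w : AWord (Alphabet S)} : HasTop d 0 w ↔ w.len ∈ degreeLT ℤ d :=
  ⟨fun h => ZPoly.low_of_coeff h.1 (by simpa using h.2),
    fun h => ⟨ZPoly.low_succ h, by simpa using ZPoly.coeff_of_low h⟩⟩

theorem exists_hasTop {d : ℕ} {w : AWord (Alphabet S)} (h : w.len ∈ degreeLT ℤ (d + 1)) :
    ∃ n, HasTop d n w :=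
  ⟨(w.len.coeff d).toNat, h, (Int.toNat_of_nonneg (ZPoly.coeff_nonneg h w.len_nonneg)).symm⟩

theorem HasTop.mul {d m n : ℕ} {v w : AWord (Alphabet S)} (hv : HasTop d m v)
    (hw : HasTop d n w) : HasTop d (m + n) (v * w) :=
  ⟨add_mem hv.1 hw.1, by rw [AWord.len_mul, coeff_add, hv.2, hw.2, Nat.cast_add]⟩

theorem HasTop.of_mul {d m n : ℕ} {v w : AWord (Alphabet S)} (hv : HasTop d m v)
    (h : HasTop d (m + n) (v * w)) : HasTop d n w := by
  refine ⟨AWord.low_of_mul_right h.1, ?_⟩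
  have := h.2
  rw [AWord.len_mul, coeff_add, hv.2] at this
  push_cast at this
  linarith

/-- A cell is split off only while the top coefficient is at least `2`; a word with top coefficient
`1` is a cell as a whole, including its terms of lower degree. -/
theorem HasTop.exists_cell {d n : ℕ} {w : AWord (Alphabet S)} (h : HasTop d (n + 2) w) :
    ∃ c v, w = c * v ∧ c.len = X ^ d ∧ IsCell d c ∧ HasTop d (n + 1) v := by
  have hlt : (X ^ d : ℤ[X]) < w.len := ZPoly.lt_of_coeff_lt (ZPoly.X_pow_low d) h.1 (by
    rw [h.2]
    simp
    omega)
  obtain ⟨c, v, rfl, hc⟩ := w.exists_split (ZPoly.X_pow_pos d).le hlt.le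
  have hc' : IsCell d c := by
    rw [IsCell, hc]
    exact ⟨ZPoly.X_pow_low d, by simp⟩
  refine ⟨c, v, rfl, hc, hc', (isCell_iff_hasTop.1 hc').of_mul ?_⟩
  rwa [show 1 + (n + 1) = n + 2 by ring]

namespace Level

variable {d : ℕ} (Λ : Level S d)

/-- The group of the next level. -/
abbrev Next := InvBiset.BisetGroup Λ.E Λ.CellBiset

noncomputable abbrev toNext : Λ.E →* Λ.Next := InvBiset.BisetGroup.base

/-- The element represented by a cell. -/
noncomputable def cell (y : Λ.Cell) : Λ.Next := InvBiset.BisetGroup.elt Λ.E (bisetMk 1 y 1)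

variable {Λ}

theorem cell_carry {g h : Λ.E} {y y' : Λ.Cell} {a : ℤ[X]} (H : Λ.Carry g y.1 y'.1 h a) :
    Λ.toNext g * Λ.cell y = Λ.cell y' * Λ.toNext h := by
  rw [cell, cell, InvBiset.BisetGroup.base_mul_elt, InvBiset.BisetGroup.elt_mul_base, smul_mk,
    rsmul_mk, bisetMk_eq.2]
  exact ⟨a, by simpa using H⟩

theorem cell_cellBar (y : Λ.Cell) : Λ.cell (cellBar y) = (Λ.cell y)⁻¹ := by
  rw [cell, cell, ← InvBiset.BisetGroup.elt_inv, inv_mk, inv_one]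

variable (Λ) in
open Classical in
/-- The element represented by a word, provided that the word is a cell. -/
noncomputable def cellElt (w : AWord (Alphabet S)) : Λ.Next :=
  if h : IsGReduced S w ∧ IsCell (d + 1) w then Λ.cell ⟨w, h⟩ else 1

theorem cellElt_eq {w : AWord (Alphabet S)} (h : IsGReduced S w) (h' : IsCell (d + 1) w) :
    Λ.cellElt w = Λ.cell ⟨w, h, h'⟩ := dif_pos ⟨h, h'⟩

/-- The cells `c q` and `c` have the core `c`, and the carry between them moves `q` across the right
end. -/
theorem cellElt_mul {c q : AWord (Alphabet S)} (h : IsGReduced S (c * q)) (hc : IsCell (d + 1) c)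
    (hq : q.len ∈ degreeLT ℤ (d + 1)) : Λ.cellElt (c * q) = Λ.cellElt c * Λ.toNext (Λ.φ q) := by
  rw [cellElt_eq h (hc.mul_right hq), cellElt_eq h.left hc, ← cell_carry (g := 1) (a := 0)]
  · rw [map_one, one_mul]
  · refine ⟨1, c, q, 1, 1, by simp, by simp, hc, small_one, ⟨h.right, hq⟩, small_one, small_one,
      by simp, by simp [φ_one], by simp⟩

theorem mul_cellElt {c p : AWord (Alphabet S)} (h : IsGReduced S (p * c)) (hc : IsCell (d + 1) c)
    (hp : p.len ∈ degreeLT ℤ (d + 1)) : Λ.cellElt (p * c) = Λ.toNext (Λ.φ p) * Λ.cellElt c := by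
  rw [cellElt_eq h (hc.mul_left hp), cellElt_eq h.right hc, cell_carry (h := 1) (a := p.len)]
  · rw [map_one, mul_one]
  · refine ⟨1, c, 1, p, 1, by simp, by simp, hc, small_one, small_one, ⟨h.left, hp⟩, small_one,
      by simp [φ_one], by simp, by simp [AWord.len_one]⟩

theorem cellElt_bar {w : AWord (Alphabet S)} (h : IsGReduced S w) (h' : IsCell (d + 1) w) :
    Λ.cellElt (w.bar (letterInv S)) = (Λ.cellElt w)⁻¹ := by
  rw [cellElt_eq h h', ← cell_cellBar, cellElt_eq h.bar h'.bar]
  rfl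

open Classical in
/-- Cut off the factor of length `t ^ d` at the left end. -/
noncomputable def cut (d : ℕ) (w : AWord (Alphabet S)) :
    AWord (Alphabet S) × AWord (Alphabet S) :=
  if h : ∃ p : AWord (Alphabet S) × AWord (Alphabet S), w = p.1 * p.2 ∧ p.1.len = X ^ d then
    h.choose else 1

theorem cut_mul {d : ℕ} {c v : AWord (Alphabet S)} (hc : c.len = X ^ d) :
    cut d (c * v) = (c, v) := by
  have h : ∃ p : AWord (Alphabet S) × AWord (Alphabet S), c * v = p.1 * p.2 ∧ p.1.len = X ^ d :=
    ⟨(c, v), rfl, hc⟩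
  rw [cut, dif_pos h]
  obtain ⟨h1, h2⟩ := AWord.eq_of_mul_eq h.choose_spec.1 (hc.trans h.choose_spec.2.symm)
  exact Prod.ext h1.symm h2.symm

-- The recursion parameter is the top coefficient. All cells are cut to the length `t ^ (d + 1)`
-- except the last, which takes the remainder.
variable (Λ) in
noncomputable def nextAux : ℕ → AWord (Alphabet S) → Λ.Next
  | 0, w => Λ.toNext (Λ.φ w)
  | 1, w => Λ.cellElt w
  | n + 2, w => Λ.cellElt (cut (d + 1) w).1 * nextAux (n + 1) (cut (d + 1) w).2

variable (Λ) in
/-- The element of the next level which is represented by a word. -/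
noncomputable def nextφ (w : AWord (Alphabet S)) : Λ.Next :=
  Λ.nextAux (w.len.coeff (d + 1)).toNat w

theorem nextφ_eq {n : ℕ} {w : AWord (Alphabet S)} (h : HasTop (d + 1) n w) :
    Λ.nextφ w = Λ.nextAux n w := by rw [nextφ, h.2, Int.toNat_natCast]

theorem nextφ_low {w : AWord (Alphabet S)} (h : w.len ∈ degreeLT ℤ (d + 1)) :
    Λ.nextφ w = Λ.toNext (Λ.φ w) := nextφ_eq (hasTop_zero.2 h)

theorem nextφ_cell {w : AWord (Alphabet S)} (h : IsCell (d + 1) w) :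
    Λ.nextφ w = Λ.cellElt w := nextφ_eq (isCell_iff_hasTop.1 h)

theorem nextφ_cons {n : ℕ} {c v : AWord (Alphabet S)} (hc : c.len = X ^ (d + 1))
    (hc' : IsCell (d + 1) c) (h : HasTop (d + 1) (n + 1) v) :
    Λ.nextφ (c * v) = Λ.cellElt c * Λ.nextφ v := by
  have := (isCell_iff_hasTop.1 hc').mul h
  rw [show 1 + (n + 1) = n + 2 by ring] at this
  rw [nextφ_eq this, nextφ_eq h, nextAux, cut_mul hc]

/-- Independence of the cut: two factorizations into two cells differ by a word `k` of lower degree,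
which can be moved from one cell to the other. -/
theorem nextφ_cell_mul_cell {v w : AWord (Alphabet S)} (hv : IsCell (d + 1) v)
    (hw : IsCell (d + 1) w) (h : IsGReduced S (v * w)) :
    Λ.nextφ (v * w) = Λ.cellElt v * Λ.cellElt w := by
  have ht := (isCell_iff_hasTop.1 hv).mul (isCell_iff_hasTop.1 hw)
  obtain ⟨c, c', e, hc, hc', ht'⟩ := ht.exists_cell
  have hc2 : IsCell (d + 1) c' := isCell_iff_hasTop.2 ht'
  have hr := h
  rw [e] at hr
  rw [e, nextφ_cons hc hc' ht', nextφ_cell hc2]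
  rcases le_total v.len c.len with hl | hl
  · obtain ⟨k, rfl, rfl⟩ := AWord.levi e hl
    have hk : k.len ∈ degreeLT ℤ (d + 1) :=
      hasTop_zero.1 ((isCell_iff_hasTop.1 hv).of_mul (isCell_iff_hasTop.1 hc'))
    rw [cellElt_mul hr.left hv hk, mul_cellElt h.right hc2 hk, mul_assoc]
  · obtain ⟨k, rfl, rfl⟩ := AWord.levi e.symm hl
    have hk : k.len ∈ degreeLT ℤ (d + 1) :=
      hasTop_zero.1 ((isCell_iff_hasTop.1 hc').of_mul (isCell_iff_hasTop.1 hv))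
    rw [cellElt_mul h.left hc' hk, mul_cellElt hr.right hw hk, mul_assoc]

theorem nextφ_cell_mul {m : ℕ} {v w : AWord (Alphabet S)} (hv : IsCell (d + 1) v)
    (hw : HasTop (d + 1) m w) (h : IsGReduced S (v * w)) :
    Λ.nextφ (v * w) = Λ.cellElt v * Λ.nextφ w := by
  induction m using Nat.strong_induction_on generalizing v w with
  | _ m ih =>
    match m with
    | 0 =>
      have hw := hasTop_zero.1 hw
      rw [nextφ_cell (hv.mul_right hw), nextφ_low hw, cellElt_mul h hv hw]
    | 1 =>
      have hw := isCell_iff_hasTop.2 hw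
      rw [nextφ_cell_mul_cell hv hw h, nextφ_cell hw]
    | n + 2 =>
      obtain ⟨c, w, rfl, hc, hc', hw'⟩ := hw.exists_cell
      rw [← mul_assoc] at h ⊢
      have ht := (isCell_iff_hasTop.1 hv).mul (isCell_iff_hasTop.1 hc')
      -- The pair `v c` is recut so that its first cell has the length prescribed by `cut`; the
      -- induction hypothesis absorbs the second cell `f`.
      obtain ⟨e, f, he, he1, he2, he3⟩ := ht.exists_cell
      have h1 := nextφ_cell_mul_cell (Λ := Λ) hv hc' h.left
      rw [nextφ_cons hc hc' hw', ← mul_assoc, ← h1, he, nextφ_cons he1 he2 he3, mul_assoc,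
        nextφ_cons he1 he2 (he3.mul hw' : HasTop (d + 1) (1 + n + 1) _)]
      rw [he, mul_assoc] at h
      have he3' := isCell_iff_hasTop.2 he3
      rw [ih (n + 1) (by omega) he3' hw' h.right, nextφ_cell he3', mul_assoc]

theorem nextφ_low_mul {m : ℕ} {v w : AWord (Alphabet S)} (hv : v.len ∈ degreeLT ℤ (d + 1))
    (hw : HasTop (d + 1) m w) (h : IsGReduced S (v * w)) :
    Λ.nextφ (v * w) = Λ.toNext (Λ.φ v) * Λ.nextφ w := by
  match m with
  | 0 =>
    have hw := hasTop_zero.1 hw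
    rw [nextφ_low (add_mem hv hw), nextφ_low hw, Λ.φ_mul _ _ ⟨h, add_mem hv hw⟩, map_mul]
  | 1 =>
    have hw := isCell_iff_hasTop.2 hw
    rw [nextφ_cell (hw.mul_left hv), nextφ_cell hw, mul_cellElt h hw hv]
  | n + 2 =>
    obtain ⟨c, w, rfl, hc, hc', hw'⟩ := hw.exists_cell
    rw [← mul_assoc] at h ⊢
    rw [nextφ_cell_mul (hc'.mul_left hv) hw' h, nextφ_cons hc hc' hw', mul_cellElt h.left hc' hv,
      mul_assoc]

theorem nextφ_mul {v w : AWord (Alphabet S)} (h : Small S (d + 1) (v * w)) :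
    Λ.nextφ (v * w) = Λ.nextφ v * Λ.nextφ w := by
  obtain ⟨m, hw⟩ := exists_hasTop h.right.2
  obtain ⟨n, hv⟩ := exists_hasTop h.left.2
  replace h := h.1
  induction n using Nat.strong_induction_on generalizing v with
  | _ n ih =>
    match n with
    | 0 =>
      have hv := hasTop_zero.1 hv
      rw [nextφ_low hv, nextφ_low_mul hv hw h]
    | 1 =>
      have hv := isCell_iff_hasTop.2 hv
      rw [nextφ_cell hv, nextφ_cell_mul hv hw h]
    | n + 2 =>
      obtain ⟨c, v, rfl, hc, hc', hv'⟩ := hv.exists_cell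
      have ht := hv'.mul hw
      rw [show n + 1 + m = (n + m) + 1 by ring] at ht
      rw [mul_assoc] at h ⊢
      rw [nextφ_cons hc hc' hv', nextφ_cons hc hc' ht, ih (n + 1) (by omega) hv' h.right,
        mul_assoc]

theorem nextφ_bar {w : AWord (Alphabet S)} (h : Small S (d + 1) w) :
    Λ.nextφ (w.bar (letterInv S)) = (Λ.nextφ w)⁻¹ := by
  obtain ⟨n, hw⟩ := exists_hasTop h.2
  induction n using Nat.strong_induction_on generalizing w with
  | _ n ih =>
    match n with
    | 0 =>
      have hw := hasTop_zero.1 hw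
      rw [nextφ_low hw, nextφ_low (by exact hw), Λ.φ_bar _ ⟨h.1, hw⟩, map_inv]
    | 1 =>
      have hw := isCell_iff_hasTop.2 hw
      rw [nextφ_cell hw, nextφ_cell hw.bar, cellElt_bar h.1 hw]
    | n + 2 =>
      obtain ⟨c, v, rfl, hc, hc', hv'⟩ := hw.exists_cell
      have hb := h.bar
      rw [AWord.bar_mul] at hb ⊢
      rw [nextφ_mul hb, nextφ_mul h, ih (n + 1) (by omega) h.right hv', nextφ_cell hc',
        nextφ_cell hc'.bar, cellElt_bar h.1.left hc', mul_inv_rev]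

/-- A cancellation would give `y = p e q` and `c⁻¹ = p' e q'` with `p`, `p'` of equal value. Then
`p'⁻¹ p` is a `G`-reduced factor of trivial value, hence empty, and `c y` contains `e⁻¹ e`. -/
theorem cls_ne_of_isGReduced {c y z : AWord (Alphabet S)} (h : IsGReduced S (c * (y * z)))
    (hc : IsCell (d + 1) c) (hy : IsCell (d + 1) y) :
    InvBiset.cls Λ.E ((1 : Λ.E) • bisetMk 1 ⟨y, h.right.left, hy⟩ 1) ≠
      InvBiset.cls Λ.E (InvBiset.inv Λ.E (bisetMk (Λ := Λ) 1 ⟨c, h.left, hc⟩ 1)) := by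
  rw [inv_mk, inv_one]
  intro e
  obtain ⟨k, a, p, e, q, p', q', e1, e2, he, hp, hq, hp', hq', e3, -, -⟩ := cls_mk_eq.1 e
  dsimp only [cellBar] at e1 e2
  have e2' := congrArg (AWord.bar (letterInv S)) e2
  rw [AWord.bar_bar (letterInv_involutive S)] at e2'
  rw [e2', e1] at h
  simp only [AWord.bar_mul] at h
  have h1 : IsGReduced S (p'.bar (letterInv S) * p) := by
    refine IsGReduced.factor (p := q'.bar (letterInv S) * e.bar (letterInv S)) (q := e * q * z) ?_
    simpa only [mul_assoc] using h
  have h2 : Small S d (p'.bar (letterInv S) * p) := ⟨h1, add_mem hp'.2 hp.2⟩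
  have h3 := Λ.eq_one _ h2 (by rw [Λ.φ_mul _ _ h2, Λ.φ_bar _ hp', ← e3]; group)
  have h4 : IsGReduced S (e.bar (letterInv S) * (p'.bar (letterInv S) * p) * e) := by
    refine IsGReduced.factor (p := q'.bar (letterInv S)) (q := q * z) ?_
    simpa only [mul_assoc] using h
  rw [h3, mul_one] at h4
  exact he.ne_one (not_isGReduced_bar_mul h4)

/-- The first cell is exposed as a prefix of `w`, so that the absence of cancellation with a
preceding cell can be read off from the reducedness of the whole word. -/
theorem exists_stack {n : ℕ} {w : AWord (Alphabet S)} (h : IsGReduced S w)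
    (hw : HasTop (d + 1) (n + 1) w) :
    ∃ (y z : AWord (Alphabet S)) (hy : IsGReduced S y ∧ IsCell (d + 1) y)
      (s : List (Λ.CellBiset × Λ.E)), w = y * z ∧
        InvBiset.BisetGroup.IsReduced ((bisetMk 1 ⟨y, hy⟩ 1, 1) :: s) ∧
        InvBiset.BisetGroup.stackEval ((bisetMk 1 ⟨y, hy⟩ 1, 1) :: s) = Λ.nextφ w ∧
        s.length = n := by
  induction n generalizing w with
  | zero =>
    have hw := isCell_iff_hasTop.2 hw
    refine ⟨w, 1, ⟨h, hw⟩, [], by simp, List.isChain_singleton _, ?_, rfl⟩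
    simp [InvBiset.BisetGroup.stackEval, nextφ_cell hw, cellElt_eq h hw, cell]
  | succ n ih =>
    obtain ⟨c, v, rfl, hc, hc', hv'⟩ := hw.exists_cell
    obtain ⟨y, z, hy, s, rfl, hs, he, hl⟩ := ih h.right hv'
    refine ⟨c, y * z, ⟨h.left, hc'⟩, _ :: s, rfl, List.isChain_cons_cons.2 ⟨?_, hs⟩, ?_, by
      simpa using hl⟩
    · exact cls_ne_of_isGReduced h hc' hy.2
    · rw [InvBiset.BisetGroup.stackEval, he, nextφ_cons hc hc' hv', cellElt_eq h.left hc', map_one,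
        mul_one, cell]

theorem length_nextφ {w : AWord (Alphabet S)} (h : Small S (d + 1) w) :
    InvBiset.BisetGroup.length (Λ.nextφ w) = (w.len.coeff (d + 1)).toNat := by
  obtain ⟨n, hw⟩ := exists_hasTop h.2
  rw [hw.2, Int.toNat_natCast]
  rcases n with _ | n
  · rw [nextφ_low (hasTop_zero.1 hw), InvBiset.BisetGroup.length_base]
  · obtain ⟨y, z, hy, s, -, hs, he, hl⟩ := exists_stack (Λ := Λ) h.1 hw
    rw [← he, hs.length_eq, List.length_cons, hl]

/-- Trivial value forces the number of cells to be `0`; the word then has lower degree and the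
previous level applies. -/
theorem eq_one_of_nextφ {w : AWord (Alphabet S)} (h : Small S (d + 1) w) (e : Λ.nextφ w = 1) :
    w = 1 := by
  have h1 := length_nextφ (Λ := Λ) h
  rw [e, ← map_one Λ.toNext, InvBiset.BisetGroup.length_base] at h1
  obtain ⟨n, hw⟩ := exists_hasTop h.2
  rw [hw.2, Int.toNat_natCast] at h1
  subst h1
  have hw := hasTop_zero.1 hw
  rw [nextφ_low hw, ← map_one Λ.toNext] at e
  exact Λ.eq_one _ ⟨h.1, hw⟩ (InvBiset.BisetGroup.base_injective e)

theorem extOf_carry {g h : Λ.E} {y y' : Λ.Cell} {a : ℤ[X]} (H : Λ.Carry g y.1 y'.1 h a) :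
    Λ.ψ g * extOf y.1 y.2.1 = extOf y'.1 y'.2.1 * Λ.ψ h := by
  obtain ⟨y, hy⟩ := y
  obtain ⟨y', hy'⟩ := y'
  obtain ⟨p, c, q, p', q', e1, e2, hc, hp, hq, hp', hq', e3, e4, -⟩ := H
  dsimp only at e1 e2 ⊢
  subst e1 e2
  rw [extOf_mul _ _ hy.1.left hq.1, extOf_mul _ _ hp.1 hy.1.left.right,
    extOf_mul _ _ hy'.1.left hq'.1, extOf_mul _ _ hp'.1 hy.1.left.right, ← Λ.ψ_φ p hp,
    ← Λ.ψ_φ p' hp', ← Λ.ψ_φ q hq, ← Λ.ψ_φ q' hq', ← e3, e4, map_mul, map_mul]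
  simp only [mul_assoc]

variable (Λ) in
/-- The map from the biset of cells to `Ext(A, G)`. -/
noncomputable def bisetExt : Λ.CellBiset → Ext S :=
  Quotient.lift (fun x => Λ.ψ x.1 * extOf x.2.1.1 x.2.1.2.1 * Λ.ψ x.2.2) fun x z h => by
    obtain ⟨a, h⟩ := h
    have := extOf_carry h
    simp only [map_mul, map_inv] at this
    have h2 : extOf x.2.1.1 x.2.1.2.1 = (Λ.ψ x.1)⁻¹ * Λ.ψ z.1 *
        (extOf z.2.1.1 z.2.1.2.1 * (Λ.ψ z.2.2 * (Λ.ψ x.2.2)⁻¹)) := by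
      rw [← this]
      group
    rw [h2]
    group

theorem bisetExt_mk (g : Λ.E) (y : Λ.Cell) (h : Λ.E) :
    Λ.bisetExt (bisetMk g y h) = Λ.ψ g * extOf y.1 y.2.1 * Λ.ψ h := rfl

variable (Λ) in
noncomputable def nextψ : Λ.Next →* Ext S :=
  InvBiset.BisetGroup.lift Λ.ψ Λ.bisetExt
    (fun g x => by
      induction x using bisetMk_ind with
      | h k y h => rw [smul_mk, bisetExt_mk, bisetExt_mk, map_mul, mul_assoc, mul_assoc, mul_assoc])
    (fun x => by
      induction x using bisetMk_ind with
      | h k y h =>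
        have := extOf_mul_bar y.1 y.2.1
        rw [inv_mk, bisetExt_mk, bisetExt_mk, map_inv, map_inv]
        rw [mul_eq_one_iff_eq_inv'] at this
        simp only [cellBar, this]
        group)

theorem nextψ_toNext (g : Λ.E) : Λ.nextψ (Λ.toNext g) = Λ.ψ g :=
  InvBiset.BisetGroup.lift_base _ _ _ _ _

theorem nextψ_cell (y : Λ.Cell) : Λ.nextψ (Λ.cell y) = extOf y.1 y.2.1 := by
  rw [nextψ, cell, InvBiset.BisetGroup.lift_elt, bisetExt_mk, map_one, one_mul, mul_one]

theorem nextψ_nextφ {w : AWord (Alphabet S)} (h : Small S (d + 1) w) :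
    Λ.nextψ (Λ.nextφ w) = extOf w h.1 := by
  obtain ⟨n, hw⟩ := exists_hasTop h.2
  induction n using Nat.strong_induction_on generalizing w with
  | _ n ih =>
    match n with
    | 0 =>
      have hw := hasTop_zero.1 hw
      rw [nextφ_low hw, nextψ_toNext, Λ.ψ_φ _ ⟨h.1, hw⟩]
    | 1 =>
      have hw := isCell_iff_hasTop.2 hw
      rw [nextφ_cell hw, cellElt_eq h.1 hw, nextψ_cell]
    | n + 2 =>
      obtain ⟨c, v, rfl, hc, hc', hv'⟩ := hw.exists_cell
      rw [nextφ_cons hc hc' hv', map_mul, ih (n + 1) (by omega) h.right hv', cellElt_eq h.1.left hc',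
        nextψ_cell, ← extOf_mul]

variable (Λ) in
/-- The next level. -/
noncomputable abbrev next : Level S (d + 1) where
  E := Λ.Next
  φ := Λ.nextφ
  γ := Λ.toNext.comp Λ.γ
  ψ := Λ.nextψ
  len := InvBiset.BisetGroup.length
  φ_mul _ _ h := nextφ_mul h
  φ_bar _ h := nextφ_bar h
  eq_one _ h e := eq_one_of_nextφ h e
  φ_ofList l := by
    rw [nextφ_low (ZPoly.low_mono (by omega) (AWord.len_ofList_low l)), Λ.φ_ofList]
    rfl
  γ_injective := InvBiset.BisetGroup.base_injective.comp Λ.γ_injective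
  ψ_φ _ h := nextψ_nextφ h
  exists_len_mul_le := InvBiset.BisetGroup.exists_length_mul_le
  len_φ _ h h' := length_nextφ ⟨h.isGReduced, h'⟩

end Level
end GroupExt

/-! ### The level of finite words and the tower of levels. -/

namespace GroupExt

open Polynomial

universe u

variable {G : Type u} [Group G] {S : Set G}

theorem isGReduced_letter (hone : (1 : G) ∉ S) (a : Alphabet S) : IsGReduced S (AWord.letter a) :=
  (isLocalGeodesic_letter hone a).isGReduced

theorem ofList_mem (hone : (1 : G) ∉ S) (l : List (Alphabet S)) :
    AWord.ofList l ∈ reducedSubmonoid S := by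
  induction l with
  | nil => exact one_mem _
  | cons a l ih =>
    rw [AWord.ofList_cons]
    exact mul_mem (Submonoid.subset_closure (isGReduced_letter hone a)) ih

/-- The element of `Ext(A, G)` represented by a finite word. -/
noncomputable def extList (hone : (1 : G) ∉ S) (l : List (Alphabet S)) : Ext S :=
  toExt S ⟨AWord.ofList l, ofList_mem hone l⟩

theorem extList_append (hone : (1 : G) ∉ S) (l m : List (Alphabet S)) :
    extList hone (l ++ m) = extList hone l * extList hone m := by
  rw [extList, extList, extList, ← map_mul]
  congr 1
  exact Subtype.ext (AWord.ofList_append l m)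

theorem extList_eq (hone : (1 : G) ∉ S) {l m : List (Alphabet S)} (h : eval S l = eval S m) :
    extList hone l = extList hone m := by
  -- These are the defining relations with `u = 1`. Applied to `l` and to `m` itself, they give two
  -- left inverses of the same element.
  have key : ∀ l, eval S l = eval S m →
      extList hone l * extList hone (m.reverse.map (letterInv S)) = 1 := by
    intro l h
    rw [← extList_append]
    refine Subtype.ext (((conGen (DefRel S)).eq).2 ?_)
    have := ConGen.Rel.of _ _ (DefRel.mk 1 l m isGReduced_one h)
    rw [AWord.bar_one, one_mul, mul_one, AWord.bar_ofList, ← AWord.ofList_append] at this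
    exact this
  exact mul_right_cancel ((key l h).trans (key m rfl).symm)

section Base

variable (hgen : Subgroup.closure S = ⊤) (hone : (1 : G) ∉ S)

open Classical in
/-- The value of a finite word. -/
noncomputable def baseφ (S : Set G) (w : AWord (Alphabet S)) : G :=
  if h : ∃ l, w = AWord.ofList l then eval S h.choose else 1

theorem baseφ_ofList (l : List (Alphabet S)) : baseφ S (AWord.ofList l) = eval S l := by
  have h : ∃ m, AWord.ofList l = AWord.ofList m := ⟨l, rfl⟩
  rw [baseφ, dif_pos h, ← AWord.ofList_injective h.choose_spec]

theorem exists_wordLength (hgen : Subgroup.closure S = ⊤) (g : G) :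
    ∃ n, ∃ l : List (Alphabet S), eval S l = g ∧ l.length = n := by
  obtain ⟨l, hl⟩ := eval_surjective hgen g
  exact ⟨_, l, hl, rfl⟩

open Classical in
/-- The word length in `G`. -/
noncomputable def wordLength (g : G) : ℕ := Nat.find (exists_wordLength hgen g)

open Classical in
theorem exists_eval_eq (g : G) :
    ∃ l : List (Alphabet S), eval S l = g ∧ l.length = wordLength hgen g :=
  Nat.find_spec (exists_wordLength hgen g)

open Classical in
theorem wordLength_le (l : List (Alphabet S)) : wordLength hgen (eval S l) ≤ l.length :=
  Nat.find_le ⟨l, rfl, rfl⟩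

/-- The group `G` as the level of the finite words. -/
noncomputable def baseLevel : Level S 0 where
  E := G
  φ := baseφ S
  γ := MonoidHom.id G
  ψ := MonoidHom.mk' (fun g => extList hone (eval_surjective hgen g).choose) fun g h => by
    rw [← extList_append]
    apply extList_eq
    rw [eval_append, (eval_surjective hgen g).choose_spec, (eval_surjective hgen h).choose_spec,
      (eval_surjective hgen (g * h)).choose_spec]
  len := wordLength hgen
  φ_mul v w h := by
    obtain ⟨l, rfl⟩ := AWord.exists_ofList h.left.2
    obtain ⟨m, rfl⟩ := AWord.exists_ofList h.right.2
    rw [← AWord.ofList_append, baseφ_ofList, baseφ_ofList, baseφ_ofList, eval_append]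
  φ_bar w h := by
    obtain ⟨l, rfl⟩ := AWord.exists_ofList h.2
    rw [AWord.bar_ofList, baseφ_ofList, baseφ_ofList, eval_reverse_inv]
  eq_one w h e := by
    obtain ⟨l, rfl⟩ := AWord.exists_ofList h.2
    rw [baseφ_ofList] at e
    by_contra hl
    refine h.1 1 1 l (by simp) ?_ e
    rintro rfl
    exact hl rfl
  φ_ofList l := baseφ_ofList l
  γ_injective := Function.injective_id
  ψ_φ w h := by
    obtain ⟨l, rfl⟩ := AWord.exists_ofList h.2
    change extList hone (eval_surjective hgen (baseφ S (AWord.ofList l))).choose = extList hone l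
    apply extList_eq
    rw [(eval_surjective hgen _).choose_spec, baseφ_ofList]
  exists_len_mul_le g := by
    refine ⟨wordLength hgen g, fun x => ?_⟩
    obtain ⟨l, hl, hl'⟩ := exists_eval_eq hgen g
    obtain ⟨m, hm, hm'⟩ := exists_eval_eq hgen x
    rw [← hl', ← hm', ← hl, ← hm, ← eval_append]
    exact (wordLength_le hgen _).trans (by rw [List.length_append, add_comm])
  len_φ w h h' := by
    obtain ⟨l, rfl⟩ := AWord.exists_ofList h'
    obtain ⟨m, hm, hm'⟩ := exists_eval_eq hgen (eval S l)
    rw [baseφ_ofList, AWord.len_ofList, coeff_natCast_ite, if_pos rfl]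
    refine le_antisymm (wordLength_le hgen l) ?_
    rw [← hm']
    -- Reducedness would not suffice here: a finite local geodesic is a shortest word for its value,
    -- so its length is the word length in `G`.
    exact h.length_le hm.symm

/-- The tower of levels. -/
noncomputable def tower : (d : ℕ) → Level S d
  | 0 => baseLevel hgen hone
  | d + 1 => (tower d).next

theorem exists_tower_embedding {d e : ℕ} (h : d ≤ e) :
    ∃ j : (tower hgen hone d).E →* (tower hgen hone e).E, Function.Injective j ∧
      ∀ w, w.len ∈ degreeLT ℤ (d + 1) → j ((tower hgen hone d).φ w) = (tower hgen hone e).φ w := by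
  induction e, h using Nat.le_induction with
  | base => exact ⟨MonoidHom.id _, Function.injective_id, fun _ _ => rfl⟩
  | succ e he ih =>
    obtain ⟨j, hj, hj'⟩ := ih
    refine ⟨(tower hgen hone e).toNext.comp j, InvBiset.BisetGroup.base_injective.comp hj, ?_⟩
    intro w hw
    change (tower hgen hone e).toNext (j _) = _
    rw [hj' w hw]
    exact (Level.nextφ_low (ZPoly.low_mono (by omega) hw)).symm

end Base

/-! ### Values of arbitrary words in a level. -/

namespace Level

variable {d : ℕ} (Λ : Level S d)

/-- `e` is the value of a factorization of `w` into small `G`-reduced words. -/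
def Rep (w : AWord (Alphabet S)) (e : Λ.E) : Prop :=
  ∃ L : List (AWord (Alphabet S)), (∀ v ∈ L, Small S d v) ∧ L.prod = w ∧ (L.map Λ.φ).prod = e

variable {Λ}

theorem Rep.mul {v w : AWord (Alphabet S)} {e f : Λ.E} (h : Λ.Rep v e) (h' : Λ.Rep w f) :
    Λ.Rep (v * w) (e * f) := by
  obtain ⟨L, hL, rfl, rfl⟩ := h
  obtain ⟨M, hM, rfl, rfl⟩ := h'
  refine ⟨L ++ M, ?_, by simp, by simp⟩
  intro x hx
  rcases List.mem_append.1 hx with hx | hx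
  · exact hL x hx
  · exact hM x hx

theorem Rep.of_small {w : AWord (Alphabet S)} (h : Small S d w) : Λ.Rep w (Λ.φ w) :=
  ⟨[w], by simpa using h, by simp, by simp⟩

theorem Rep.one : Λ.Rep 1 1 := ⟨[], by simp, rfl, rfl⟩

/-- The cut between `v` and `w` falls into one small factor, which is divided there by `φ_mul`. This
makes the set of values multiplicative in the word. -/
theorem Rep.split {v w : AWord (Alphabet S)} {e : Λ.E} (h : Λ.Rep (v * w) e) :
    ∃ f g, Λ.Rep v f ∧ Λ.Rep w g ∧ e = f * g := by
  obtain ⟨L, hL, hw, rfl⟩ := h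
  induction L generalizing v with
  | nil =>
    have hlen := congrArg AWord.len hw
    rw [List.prod_nil, AWord.len_one, AWord.len_mul] at hlen
    have h1 := v.len_nonneg
    have h2 := w.len_nonneg
    rw [AWord.eq_one_of_len (w := v) (by linarith), AWord.eq_one_of_len (w := w) (by linarith)]
    exact ⟨1, 1, Rep.one, Rep.one, by simp⟩
  | cons x L ih =>
    rw [List.prod_cons] at hw
    have hx := hL x (by simp)
    have hL' : ∀ v ∈ L, Small S d v := fun v hv => hL v (by simp [hv])
    rcases le_total x.len v.len with hl | hl
    · obtain ⟨k, rfl, hk⟩ := AWord.levi hw hl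
      obtain ⟨f, g, hf, hg, e⟩ := ih hL' hk
      exact ⟨Λ.φ x * f, g, (Rep.of_small hx).mul hf, hg, by
        rw [List.map_cons, List.prod_cons, e, mul_assoc]⟩
    · obtain ⟨k, rfl, rfl⟩ := AWord.levi hw.symm hl
      refine ⟨Λ.φ v, Λ.φ k * (L.map Λ.φ).prod, Rep.of_small hx.left,
        (Rep.of_small hx.right).mul ⟨L, hL', rfl, rfl⟩, ?_⟩
      rw [List.map_cons, List.prod_cons, Λ.φ_mul _ _ hx, mul_assoc]

theorem rep_mul_iff {v w : AWord (Alphabet S)} {e : Λ.E} :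
    Λ.Rep (v * w) e ↔ ∃ f g, Λ.Rep v f ∧ Λ.Rep w g ∧ e = f * g :=
  ⟨Rep.split, by
    rintro ⟨f, g, hf, hg, rfl⟩
    exact hf.mul hg⟩

theorem Rep.eq_φ {w : AWord (Alphabet S)} {e : Λ.E} (hw : Small S d w) (h : Λ.Rep w e) :
    e = Λ.φ w := by
  obtain ⟨L, -, rfl, rfl⟩ := h
  induction L with
  | nil => simp [φ_one]
  | cons x L ih =>
    rw [List.prod_cons] at hw
    rw [List.map_cons, List.prod_cons, ih hw.right, ← Λ.φ_mul _ _ hw, List.prod_cons]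

theorem rep_one_iff {e : Λ.E} : Λ.Rep 1 e ↔ e = 1 :=
  ⟨fun h => by rw [h.eq_φ small_one, φ_one], by
    rintro rfl
    exact Rep.one⟩

/-- A finite word factors into letters, so it has a value even if it is not `G`-reduced, and no
other value is possible. -/
theorem rep_ofList_iff (hone : (1 : G) ∉ S) (l : List (Alphabet S)) {e : Λ.E} :
    Λ.Rep (AWord.ofList l) e ↔ e = Λ.γ (eval S l) := by
  induction l generalizing e with
  | nil => rw [AWord.ofList_nil, rep_one_iff, eval_nil, map_one]
  | cons a l ih =>
    have ha : Small S d (AWord.letter a) :=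
      ⟨isGReduced_letter hone a, by
        rw [← AWord.ofList_singleton]
        exact ZPoly.low_mono (by omega) (AWord.len_ofList_low _)⟩
    have hφ : Λ.φ (AWord.letter a) = Λ.γ a := by
      rw [← AWord.ofList_singleton, Λ.φ_ofList, eval_singleton]
    have he : eval S (a :: l) = a * eval S l := by
      simp only [eval, List.map_cons, List.prod_cons]
    rw [AWord.ofList_cons, rep_mul_iff, he, map_mul, ← hφ]
    constructor
    · rintro ⟨f, g, hf, hg, rfl⟩
      rw [hf.eq_φ ha, ih.1 hg]
    · rintro rfl
      exact ⟨_, _, Rep.of_small ha, ih.2 rfl, rfl⟩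

end Level

/-! ### Comparison of the tower with `Ext(A, G)`. -/

section Soundness

variable (hgen : Subgroup.closure S = ⊤) (hone : (1 : G) ∉ S)

/-- Two words are related if they have the same values in all sufficiently high levels. -/
def repCon : Con (AWord (Alphabet S)) where
  r v w := ∃ D, ∀ d, D ≤ d → ∀ e, (tower hgen hone d).Rep v e ↔ (tower hgen hone d).Rep w e
  iseqv :=
    { refl := fun _ => ⟨0, fun _ _ _ => Iff.rfl⟩
      symm := by
        rintro v w ⟨D, h⟩
        exact ⟨D, fun d hd e => (h d hd e).symm⟩
      trans := by
        rintro v w x ⟨D, h⟩ ⟨D', h'⟩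
        exact ⟨max D D', fun d hd e => (h d (le_of_max_le_left hd) e).trans
          (h' d (le_of_max_le_right hd) e)⟩ }
  mul' := by
    rintro v w x y ⟨D, h⟩ ⟨D', h'⟩
    refine ⟨max D D', fun d hd e => ?_⟩
    rw [Level.rep_mul_iff, Level.rep_mul_iff]
    simp only [h d (le_of_max_le_left hd), h' d (le_of_max_le_right hd)]

/-- A defining relation holds in every level at which its word `u` is small, which excludes only
finitely many levels. -/
theorem conGen_le_repCon : conGen (DefRel S) ≤ repCon hgen hone := by
  rw [Con.conGen_le]
  rintro _ _ ⟨w, l, r, hw, hlr⟩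
  obtain ⟨D, hD⟩ := ZPoly.exists_low w.len
  refine ⟨D, fun d hd e => ?_⟩
  have hs : Small S d w := ⟨hw, hD _ (by omega)⟩
  rw [Level.rep_one_iff, AWord.bar_ofList, mul_assoc w, ← AWord.ofList_append]
  simp only [Level.rep_mul_iff, Level.rep_ofList_iff hone]
  have h1 : eval S (l ++ r.reverse.map (letterInv S)) = 1 := by
    rw [eval_append, eval_reverse_inv, hlr, mul_inv_cancel]
  rw [h1, map_one]
  constructor
  · rintro ⟨f, g, ⟨f', g', hf, rfl, rfl⟩, hg, rfl⟩
    rw [hf.eq_φ hs, hg.eq_φ hs.bar, Level.φ_bar _ _ hs, mul_one, mul_inv_cancel]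
  · rintro rfl
    refine ⟨_, _, ⟨_, _, Level.Rep.of_small hs, rfl, rfl⟩, Level.Rep.of_small hs.bar, ?_⟩
    rw [Level.φ_bar _ _ hs, mul_one, mul_inv_cancel]

theorem toExt_geodesicProd {n : ℕ} (δ : Fin n → AWord (Alphabet S))
    (hδ : ∀ i, IsLocalGeodesic S (δ i)) (w : List (Fin n)) :
    toExt S (geodesicProd S δ hδ w) = (w.map fun i => extOf (δ i) (hδ i).isGReduced).prod := by
  rw [geodesicProd, map_list_prod, List.map_map]
  rfl

theorem geodesicProd_coe {n : ℕ} (δ : Fin n → AWord (Alphabet S))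
    (hδ : ∀ i, IsLocalGeodesic S (δ i)) (w : List (Fin n)) :
    (geodesicProd S δ hδ w : AWord (Alphabet S)) = (w.map δ).prod := by
  induction w with
  | nil => rfl
  | cons i w ih =>
    rw [List.map_cons, List.prod_cons, ← ih]
    rfl

/-- An equation in the quotient holds in some high level by `conGen_le_repCon` and descends to level
`d` along an injective map. Conversely, `ψ` maps an equation in level `d` to `Ext(A, G)`. -/
theorem toExt_geodesicProd_eq_one_iff {n d : ℕ} (δ : Fin n → AWord (Alphabet S))
    (hδ : ∀ i, IsLocalGeodesic S (δ i)) (hd : ∀ i, (δ i).len ∈ degreeLT ℤ (d + 1))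
    (w : List (Fin n)) :
    toExt S (geodesicProd S δ hδ w) = 1 ↔
      (w.map fun i => (tower hgen hone d).φ (δ i)).prod = 1 := by
  constructor
  · intro h
    have h1 : toExtMonoid S (geodesicProd S δ hδ w : AWord (Alphabet S)) = toExtMonoid S 1 :=
      (congrArg Subtype.val h).trans (map_one _).symm
    obtain ⟨D, hD⟩ := conGen_le_repCon hgen hone (((conGen (DefRel S)).eq).1 h1)
    obtain ⟨j, hj, hj'⟩ := exists_tower_embedding hgen hone (le_max_left d D)
    apply hj
    rw [map_list_prod, List.map_map, map_one]
    have hc : (j ∘ fun i => (tower hgen hone d).φ (δ i)) =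
        fun i => (tower hgen hone (max d D)).φ (δ i) := funext fun i => hj' _ (hd i)
    rw [hc, ← Level.rep_one_iff, ← hD _ (le_max_right d D), geodesicProd_coe]
    refine ⟨w.map δ, ?_, rfl, by rw [List.map_map]; rfl⟩
    intro v hv
    obtain ⟨i, -, rfl⟩ := List.mem_map.1 hv
    exact ⟨(hδ i).isGReduced, ZPoly.low_mono (by omega) (hd i)⟩
  · intro h
    have := congrArg (tower hgen hone d).ψ h
    rw [map_list_prod, List.map_map, map_one] at this
    rw [toExt_geodesicProd, ← this]
    congr 2
    exact funext fun i => ((tower hgen hone d).ψ_φ _ ⟨(hδ i).isGReduced, hd i⟩).symm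

theorem tower_φ_letter (d : ℕ) (w : List (Alphabet S)) :
    (w.map fun a => (tower hgen hone d).φ (AWord.letter a)).prod = 1 ↔ eval S w = 1 := by
  rw [← (tower hgen hone d).γ_injective.eq_iff, map_one, eval, map_list_prod, List.map_map]
  have : (fun a => (tower hgen hone d).φ (AWord.letter a)) =
      (tower hgen hone d).γ ∘ Subtype.val := funext fun a => by
    rw [← AWord.ofList_singleton, Level.φ_ofList, eval_singleton]
    rfl
  rw [this]

end Soundness
end GroupExt

/-! ### Closure properties of computable functions and predicates -/

section Computability

variable {α β σ : Type*} [Primcodable α] [Primcodable β] [Primcodable σ]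

theorem Computable.list_foldl' {h : σ × β → σ} (hh : Computable h) (s : σ) :
    Computable fun l : List β => l.foldl (fun x b => h (x, b)) s := by
  have h2 : Computable₂ fun (l : List β) (p : ℕ × σ) =>
      (Option.casesOn (l[p.1]?) p.2 (fun b => h (p.2, b)) : σ) := by
    refine Computable.option_casesOn
      (Computable.list_getElem?.comp Computable.fst (Computable.fst.comp Computable.snd))
      (Computable.snd.comp Computable.snd) ?_
    exact (hh.comp
      ((Computable.snd.comp (Computable.snd.comp Computable.fst)).pair Computable.snd)).to₂
  have h1 := Computable.nat_rec (Computable.list_length (α := β)) (Computable.const s) h2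
  refine h1.of_eq fun l => ?_
  have key : ∀ k, (Nat.rec s (fun k x => (Option.casesOn (l[k]?) x (fun b => h (x, b)) : σ)) k : σ) =
      (l.take k).foldl (fun x b => h (x, b)) s := by
    intro k
    induction k with
    | zero => rfl
    | succ k ih =>
      rw [List.take_add_one, List.foldl_append, ← ih]
      cases hk : l[k]? <;> simp [hk]
  rw [key, List.take_length]

theorem Computable.list_foldr' {h : β × σ → σ} (hh : Computable h) (s : σ) :
    Computable fun l : List β => l.foldr (fun b x => h (b, x)) s := by
  have h1 : Computable fun p : σ × β => h (p.2, p.1) := hh.comp (Computable.snd.pair Computable.fst)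
  refine ((Computable.list_foldl' h1 s).comp Computable.list_reverse).of_eq fun l => ?_
  rw [List.foldl_reverse]

theorem Computable.fin_uncurry {n : ℕ} {f : Fin n → α → σ} (hf : ∀ i, Computable (f i)) :
    Computable fun p : Fin n × α => f p.1 p.2 :=
  (Computable.vector_get.comp ((Computable.vector_ofFn hf).comp Computable.snd)
    Computable.fst).of_eq fun p => by simp

theorem Computable.flatMap_finite [Finite β] (f : β → List σ) :
    Computable fun l : List β => l.flatMap f :=
  (Primrec.list_flatMap Primrec.id ((Primrec.dom_finite f).comp Primrec.snd).to₂).to_comp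

theorem Computable.map_finite [Finite β] (f : β → σ) : Computable fun l : List β => l.map f :=
  (Primrec.list_map Primrec.id ((Primrec.dom_finite f).comp Primrec.snd).to₂).to_comp

theorem Computable.replicate (b : β) : Computable fun n : ℕ => List.replicate n b := by
  have h : Computable fun n : ℕ => (Nat.rec [] (fun _ l => b :: l) n : List β) :=
    Computable.nat_rec Computable.id (Computable.const [])
      (Computable.list_cons.comp (Computable.const b) (Computable.snd.comp Computable.snd)).to₂
  refine h.of_eq fun n => ?_
  induction n with
  | zero => rfl
  | succ n ih => simp only [List.replicate_succ, ← ih]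

namespace ComputablePred

theorem comp {p : β → Prop} (hp : ComputablePred p) {f : α → β} (hf : Computable f) :
    ComputablePred fun a => p (f a) := by
  obtain ⟨g, hg, rfl⟩ := computable_iff.1 hp
  exact computable_iff.2 ⟨fun a => g (f a), hg.comp hf, rfl⟩

theorem or {p q : α → Prop} (hp : ComputablePred p) (hq : ComputablePred q) :
    ComputablePred fun a => p a ∨ q a := by
  obtain ⟨f, hf, rfl⟩ := computable_iff.1 hp
  obtain ⟨g, hg, rfl⟩ := computable_iff.1 hq
  exact computable_iff.2 ⟨fun a => f a || g a, Primrec.or.to_comp.comp hf hg, by simp⟩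

theorem exists_le {p : α → ℕ → Prop} (hp : ComputablePred fun x : α × ℕ => p x.1 x.2) {b : α → ℕ}
    (hb : Computable b) : ComputablePred fun a => ∃ n ≤ b a, p a n := by
  obtain ⟨f, hf, e⟩ := computable_iff.1 hp
  have h0 : Computable₂ fun (a : α) (x : ℕ × Bool) => x.2 || f (a, x.1 + 1) :=
    (Primrec.or.to_comp.comp (Computable.snd.comp Computable.snd) (hf.comp
      (Computable.fst.pair (Computable.succ.comp (Computable.fst.comp Computable.snd))))).to₂
  have h := Computable.nat_rec hb (hf.comp (Computable.id.pair (Computable.const 0))) h0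
  refine computable_iff.2 ⟨_, h, ?_⟩
  funext a
  have key : ∀ n, ((Nat.rec (f (a, 0)) (fun k x => x || f (a, k + 1)) n : Bool) = true) =
      ∃ k ≤ n, p a k := by
    intro n
    have e' : ∀ k, p a k = (f (a, k) = true) := fun k => congrFun e (a, k)
    induction n with
    | zero => simp [e']
    | succ n ih =>
      simp only [Bool.or_eq_true]
      rw [ih]
      simp only [e', Nat.le_succ_iff, or_and_right, exists_or, exists_eq_left]
  exact (key _).symm

theorem exists_option {p : β → Prop} (hp : ComputablePred p) {f : α → Option β}
    (hf : Computable f) : ComputablePred fun a => ∃ b, f a = some b ∧ p b := by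
  obtain ⟨g, hg, rfl⟩ := computable_iff.1 hp
  refine computable_iff.2 ⟨fun a => ((f a).map g).getD false, Computable.option_getD
    (Computable.option_map hf (hg.comp Computable.snd).to₂) (Computable.const false), ?_⟩
  funext a
  cases h : f a <;> simp [h]

/-- A witness of a decidable existential statement can be found by search. -/
theorem exists_choose {p : α → β → Prop} (hp : ComputablePred fun x : α × β => p x.1 x.2)
    (hq : ComputablePred fun a => ∃ b, p a b) :
    ∃ f : α → Option β, Computable f ∧ ∀ a, (∀ b, f a = some b → p a b) ∧
      (f a = none → ¬ ∃ b, p a b) := by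
  obtain ⟨g, hg, eg⟩ := computable_iff.1 hp
  obtain ⟨q, hq, eq⟩ := computable_iff.1 hq
  have eg' : ∀ a b, p a b ↔ g (a, b) = true := fun a b => iff_of_eq (congrFun eg (a, b))
  have eq' : ∀ a, (∃ b, p a b) ↔ q a = true := fun a => iff_of_eq (congrFun eq a)
  -- Search over the codes `n`: the outer `none` means that the search goes on, and `some none`
  -- reports at once that `q` excludes a witness.
  let t : α → ℕ → Option (Option β) := fun a n =>
    cond (q a) ((Encodable.decode (α := β) n).bind fun b =>
      cond (g (a, b)) (some (some b)) none) (some none)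
  have ht : Computable₂ t := by
    refine Computable.cond (hq.comp Computable.fst) ?_ (Computable.const _)
    refine Computable.option_bind (Computable.decode.comp Computable.snd) ?_
    refine Computable.cond (hg.comp ((Computable.fst.comp Computable.fst).pair Computable.snd))
      (Computable.option_some.comp (Computable.option_some.comp Computable.snd))
      (Computable.const _)
  have hP := Partrec.rfindOpt ht
  have hdom : ∀ a, (Nat.rfindOpt (t a)).Dom := by
    intro a
    rw [Nat.rfindOpt_dom]
    cases hqa : q a with
    | false => exact ⟨0, none, by simp [t, hqa]⟩
    | true =>
      obtain ⟨b, hb⟩ := (eq' a).2 hqa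
      refine ⟨Encodable.encode b, some b, ?_⟩
      simp [t, hqa, (eg' a b).1 hb]
  refine ⟨fun a => (Nat.rfindOpt (t a)).get (hdom a), hP.of_eq_tot fun a => Part.get_mem _, ?_⟩
  intro a
  obtain ⟨n, hn⟩ := Nat.rfindOpt_spec (Part.get_mem (hdom a))
  beta_reduce
  generalize (Nat.rfindOpt (t a)).get (hdom a) = o at hn ⊢
  cases hqa : q a with
  | false =>
    have ho : o = none := by simpa [t, hqa] using hn.symm
    refine ⟨fun b hb => by simp [ho] at hb, fun _ => ?_⟩
    rw [eq', hqa]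
    simp
  | true =>
    simp only [t, hqa, cond_true, Option.mem_def, Option.bind_eq_some_iff] at hn
    obtain ⟨b, -, hb⟩ := hn
    cases hgb : g (a, b) with
    | false => simp [hgb] at hb
    | true =>
      have ho : o = some b := by simpa [hgb] using hb.symm
      refine ⟨fun b' hb' => ?_, fun h => by simp [ho] at h⟩
      obtain rfl : b = b' := by simpa [ho] using hb'
      exact (eg' a b).2 hgb

end ComputablePred

end Computability

/-! ### Words over families of group elements and decidable membership. -/

namespace GroupExt

open Polynomial

universe u

section WordProd

variable {E : Type*} [Group E] {ι κ : Type}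

/-- The value of a word over the index set of a family. -/
def wordProd (f : ι → E) (w : List ι) : E := (w.map f).prod

theorem wordProd_nil (f : ι → E) : wordProd f [] = 1 := rfl

theorem wordProd_cons (f : ι → E) (i : ι) (w : List ι) :
    wordProd f (i :: w) = f i * wordProd f w := by simp [wordProd]

theorem wordProd_append (f : ι → E) (v w : List ι) :
    wordProd f (v ++ w) = wordProd f v * wordProd f w := by simp [wordProd]

theorem wordProd_map (f : κ → E) (g : ι → κ) (w : List ι) :
    wordProd f (w.map g) = wordProd (fun i => f (g i)) w := by
  simp [wordProd, Function.comp_def]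

theorem wordProd_replicate (f : ι → E) (i : ι) (n : ℕ) :
    wordProd f (List.replicate n i) = f i ^ n := by simp [wordProd]

theorem wordProd_flatMap (f : κ → E) (g : ι → List κ) (w : List ι) :
    wordProd f (w.flatMap g) = wordProd (fun i => wordProd f (g i)) w := by
  induction w with
  | nil => rfl
  | cons i w ih => rw [List.flatMap_cons, wordProd_append, ih, wordProd_cons]

theorem wordProd_inv (f : ι → E) (w : List ι) :
    wordProd (fun i => (f i)⁻¹) w.reverse = (wordProd f w)⁻¹ := by
  rw [wordProd, wordProd, List.prod_inv_reverse, List.map_map, List.map_reverse]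
  rfl

theorem exists_word {f : ι → E} {l : List E} (h : ∀ x ∈ l, x ∈ Set.range f) :
    ∃ w, wordProd f w = l.prod := by
  induction l with
  | nil => exact ⟨[], rfl⟩
  | cons x l ih =>
    obtain ⟨w, hw⟩ := ih fun y hy => h y (by simp [hy])
    obtain ⟨i, rfl⟩ := h x (by simp)
    exact ⟨i :: w, by rw [wordProd_cons, hw, List.prod_cons]⟩

/-- Membership in `P` is decidable for the words over a family. -/
def DecidableMem [Primcodable ι] (f : ι → E) (P : Subgroup E) : Prop :=
  ComputablePred fun w : List ι => wordProd f w ∈ P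

/-- The word problem is decidable for the families of elements of `L`. -/
def DecidableWP (L : Subgroup E) : Prop :=
  ∀ (ι : Type) [Primcodable ι] [Finite ι] (f : ι → E), (∀ i, f i ∈ L) → DecidableMem f ⊥

/-- Adjoining the inverses to the family turns an equation into the triviality of one word. -/
theorem DecidableWP.computablePred_eq {L : Subgroup E} (h : DecidableWP L) [Primcodable ι]
    [Finite ι] {f : ι → E} (hf : ∀ i, f i ∈ L) :
    ComputablePred fun p : List ι × List ι => wordProd f p.1 = wordProd f p.2 := by
  have h1 := h (ι ⊕ ι) (Sum.elim f fun i => (f i)⁻¹) (by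
    rintro (i | i)
    · exact hf i
    · exact inv_mem (hf i))
  have h2 : Computable fun p : List ι × List ι => p.1.map Sum.inl ++ p.2.reverse.map Sum.inr :=
    Computable.list_append.comp ((Computable.map_finite (Sum.inl : ι → ι ⊕ ι)).comp Computable.fst)
      ((Computable.map_finite (Sum.inr : ι → ι ⊕ ι)).comp
        (Computable.list_reverse.comp Computable.snd))
  refine (h1.comp h2).of_eq fun p => ?_
  rw [wordProd_append, wordProd_map, wordProd_map, Subgroup.mem_bot]
  simp only [Sum.elim_inl, Sum.elim_inr]
  rw [wordProd_inv, mul_inv_eq_one]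

theorem exists_fin_range {E : Type*} {T : Set E} (hT : T.Finite) :
    ∃ (n : ℕ) (f : Fin n → E), Set.range f = T := by
  have := hT.to_subtype
  obtain ⟨n, ⟨e⟩⟩ := Finite.exists_equiv_fin T
  refine ⟨n, fun i => e.symm i, ?_⟩
  ext x
  constructor
  · rintro ⟨i, rfl⟩
    exact (e.symm i).2
  · intro hx
    exact ⟨e ⟨x, hx⟩, by simp⟩

theorem exists_fin_word {T : Set E} (hT : T.Finite) : ∃ (n : ℕ) (f : Fin n → E),
    (∀ i, f i ∈ Subgroup.closure T) ∧ ∀ x ∈ Subgroup.closure T, ∃ w, wordProd f w = x := by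
  obtain ⟨n, f, hf⟩ := exists_fin_range (hT.union hT.inv)
  refine ⟨n, f, fun i => ?_, fun x hx => ?_⟩
  · have : f i ∈ T ∪ T⁻¹ := hf ▸ Set.mem_range_self i
    rcases this with h | h
    · exact Subgroup.subset_closure h
    · exact inv_mem_iff.1 (Subgroup.subset_closure (Set.mem_inv.1 h))
  · rw [← Subgroup.mem_toSubmonoid, Subgroup.closure_toSubmonoid, ← hf] at hx
    obtain ⟨l, hl, rfl⟩ := Submonoid.exists_list_of_mem_closure hx
    exact exists_word hl

end WordProd

variable {G : Type u} [Group G] {S : Set G}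

/-! ### Groups of periods and the computation of carries. -/

namespace Level

variable {d : ℕ} (Λ : Level S d)

/-- The subgroup generated by the local geodesics. -/
def geo : Subgroup Λ.E :=
  Subgroup.closure {g | ∃ w, IsLocalGeodesic S w ∧ w.len ∈ degreeLT ℤ (d + 1) ∧ Λ.φ w = g}

variable {Λ}

theorem φ_mem_geo {w : AWord (Alphabet S)} (h : IsLocalGeodesic S w)
    (hw : w.len ∈ degreeLT ℤ (d + 1)) : Λ.φ w ∈ Λ.geo :=
  Subgroup.subset_closure ⟨w, h, hw, rfl⟩

theorem Carry.mem_geo {g h : Λ.E} {y y' : AWord (Alphabet S)} {a : ℤ[X]}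
    (H : Λ.Carry g y y' h a) (hy : IsLocalGeodesic S y) (hy' : IsLocalGeodesic S y') :
    g ∈ Λ.geo ∧ h ∈ Λ.geo := by
  obtain ⟨p, c, q, p', q', rfl, rfl, hc, hp, hq, hp', hq', e3, e4, rfl⟩ := H
  constructor
  · rw [eq_mul_inv_of_mul_eq e3]
    exact mul_mem (φ_mem_geo hy'.left.left hp'.2) (inv_mem (φ_mem_geo hy.left.left hp.2))
  · rw [← inv_mul_eq_of_eq_mul e4]
    exact mul_mem (inv_mem (φ_mem_geo hy'.right hq'.2)) (φ_mem_geo hy.right hq.2)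

theorem Carry.low {g h : Λ.E} {y y' : AWord (Alphabet S)} {a : ℤ[X]}
    (H : Λ.Carry g y y' h a) : a ∈ degreeLT ℤ (d + 1) := by
  obtain ⟨p, c, q, p', q', rfl, rfl, hc, hp, hq, hp', hq', e3, e4, rfl⟩ := H
  exact sub_mem hp'.2 hp.2

theorem Carry.mul {g h g' h' : Λ.E} {y : Λ.Cell} {a a' : ℤ[X]} (H : Λ.Carry g y.1 y.1 h a)
    (H' : Λ.Carry g' y.1 y.1 h' a') : Λ.Carry (g * g') y.1 y.1 (h * h') (a + a') := by
  rw [add_comm a]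
  exact H'.trans y.2.1 y.2.1 y.2.1 H

theorem Carry.zpow {g h : Λ.E} {y : Λ.Cell} {a : ℤ[X]} (H : Λ.Carry g y.1 y.1 h a) (k : ℤ) :
    Λ.Carry (g ^ k) y.1 y.1 (h ^ k) (k • a) := by
  induction k using Int.induction_on with
  | zero => simpa using Carry.refl y.2.2
  | succ k ih =>
    rw [zpow_add_one, zpow_add_one, add_smul, one_smul]
    exact ih.mul H
  | pred k ih =>
    rw [zpow_sub_one, zpow_sub_one, sub_smul, one_smul, sub_eq_add_neg]
    exact ih.mul H.symm

/-- The elements which carry a cell to itself up to a shift. -/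
def perSub (y : Λ.Cell) : Subgroup Λ.E where
  carrier := {g | ∃ h a, Λ.Carry g y.1 y.1 h a}
  one_mem' := ⟨1, 0, Carry.refl y.2.2⟩
  mul_mem' := by
    rintro g g' ⟨h, a, H⟩ ⟨h', a', H'⟩
    exact ⟨_, _, H.mul H'⟩
  inv_mem' := by
    rintro g ⟨h, a, H⟩
    exact ⟨_, _, H.symm⟩

theorem perSub_le_geo {y : Λ.Cell} (hy : IsLocalGeodesic S y.1) : perSub y ≤ Λ.geo := by
  rintro g ⟨h, a, H⟩
  exact (H.mem_geo hy hy).1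

/-- The subgroups of `perSub y` are finitely generated. -/
theorem exists_finite_closure {y : Λ.Cell} {P : Subgroup Λ.E} (hP : P ≤ perSub y) :
    ∃ T : Set Λ.E, T.Finite ∧ Subgroup.closure T = P := by
  -- The shifts of the elements of `P`. They lie in a free abelian group of rank `d + 1`, and by
  -- `Carry.unique` generators of `B` lift to generators of `P`.
  let B : Submodule ℤ ℤ[X] := AddSubgroup.toIntSubmodule
    { carrier := {a | ∃ g ∈ P, ∃ h, Λ.Carry g y.1 y.1 h a}
      zero_mem' := ⟨1, one_mem _, 1, Carry.refl y.2.2⟩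
      add_mem' := by
        rintro a a' ⟨g, hg, h, H⟩ ⟨g', hg', h', H'⟩
        exact ⟨g * g', mul_mem hg hg', _, H.mul H'⟩
      neg_mem' := by
        rintro a ⟨g, hg, h, H⟩
        exact ⟨g⁻¹, inv_mem hg, _, H.symm⟩ }
  have hB : ∀ a, a ∈ B ↔ ∃ g ∈ P, ∃ h, Λ.Carry g y.1 y.1 h a := fun a => Iff.rfl
  have hle : B ≤ degreeLT ℤ (d + 1) := by
    intro a ha
    obtain ⟨g, hg, h, H⟩ := (hB a).1 ha
    exact H.low
  have : IsNoetherian ℤ (degreeLT ℤ (d + 1)) :=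
    isNoetherian_of_linearEquiv (degreeLTEquiv ℤ (d + 1)).symm
  have hfg : B.FG := by
    have h := (IsNoetherian.noetherian (B.comap (degreeLT ℤ (d + 1)).subtype)).map
      (degreeLT ℤ (d + 1)).subtype
    rwa [Submodule.map_comap_subtype, inf_eq_right.2 hle] at h
  obtain ⟨T, hT⟩ := hfg
  have hTB : ∀ a : T, ∃ g ∈ P, ∃ h, Λ.Carry g y.1 y.1 h a := fun a =>
    (hB a).1 (hT ▸ Submodule.subset_span a.2)
  choose γ hγ h H using hTB
  refine ⟨Set.range γ, Set.finite_range γ, le_antisymm ?_ ?_⟩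
  · rw [Subgroup.closure_le]
    rintro _ ⟨a, rfl⟩
    exact hγ a
  · have key : ∀ a ∈ Submodule.span ℤ (T : Set ℤ[X]),
        ∃ g ∈ Subgroup.closure (Set.range γ), ∃ h, Λ.Carry g y.1 y.1 h a := by
      intro a ha
      induction ha using Submodule.span_induction with
      | mem a ha => exact ⟨_, Subgroup.subset_closure ⟨⟨a, ha⟩, rfl⟩, _, H ⟨a, ha⟩⟩
      | zero => exact ⟨1, one_mem _, 1, Carry.refl y.2.2⟩
      | add a b _ _ iha ihb =>
        obtain ⟨g, hg, k, K⟩ := iha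
        obtain ⟨g', hg', k', K'⟩ := ihb
        exact ⟨g * g', mul_mem hg hg', _, K.mul K'⟩
      | smul m a _ iha =>
        obtain ⟨g, hg, k, K⟩ := iha
        exact ⟨g ^ m, zpow_mem hg m, _, K.zpow m⟩
    intro g hg
    obtain ⟨k, a, K⟩ := hP hg
    obtain ⟨g', hg', k', K'⟩ := key a (by
      rw [hT]
      exact (hB a).2 ⟨g, hg, k, K⟩)
    rw [(K.unique y.2.1 y.2.1 K').2 rfl]
    exact hg'

variable (Λ) in
/-- Membership is decidable in the subgroups of `perSub y` for all local geodesic cells `y`. -/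
def DecidablePeriods : Prop :=
  ∀ y : Λ.Cell, IsLocalGeodesic S y.1 → ∀ P ≤ perSub y, ∀ (ι : Type) [Primcodable ι] [Finite ι]
    (f : ι → Λ.E), (∀ i, f i ∈ Λ.geo) → DecidableMem f P

theorem Carry.wordProd {ι : Type} {f k : ι → Λ.E} {y : Λ.Cell}
    (h : ∀ i, ∃ a, Λ.Carry (f i) y.1 y.1 (k i) a) (w : List ι) :
    ∃ a, Λ.Carry (wordProd f w) y.1 y.1 (wordProd k w) a := by
  induction w with
  | nil => exact ⟨0, Carry.refl y.2.2⟩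
  | cons i w ih =>
    obtain ⟨a, ha⟩ := h i
    obtain ⟨b, hb⟩ := ih
    rw [wordProd_cons, wordProd_cons]
    exact ⟨_, ha.mul hb⟩

/-- It is decidable whether a word carries `y` to `y'`; and then the element which appears on the
right hand side can be computed. -/
theorem exists_transfer (hW : DecidableWP Λ.geo) (hD : Λ.DecidablePeriods) (y y' : Λ.Cell)
    (hy : IsLocalGeodesic S y.1) (hy' : IsLocalGeodesic S y'.1) :
    ∃ T : Set Λ.E, T.Finite ∧ T ⊆ Λ.geo ∧ ∀ (ι : Type) [Primcodable ι] [Finite ι] (f : ι → Λ.E),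
      (∀ i, f i ∈ Λ.geo) → T ⊆ Set.range f → ∃ t : List ι → Option (List ι), Computable t ∧
        ∀ v, (∀ v', t v = some v' → ∃ a, Λ.Carry (wordProd f v) y.1 y'.1 (wordProd f v') a) ∧
          (t v = none → ¬ ∃ h a, Λ.Carry (wordProd f v) y.1 y'.1 h a) := by
  by_cases hex : ∃ g h a, Λ.Carry g y.1 y'.1 h a
  swap
  · refine ⟨∅, Set.finite_empty, Set.empty_subset _, fun ι _ _ f _ _ =>
      ⟨fun _ => none, Computable.const _, fun v => ⟨fun v' h => by simp at h, fun _ h => ?_⟩⟩⟩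
    exact hex ⟨_, h⟩
  -- All carries from `y` to `y'` arise from this one by multiplication with periods of `y'`. So `T`
  -- has to contain `g₀`, `h₀`, generators `p` of the periods, and the elements `q` that appear
  -- opposite to them.
  obtain ⟨g₀, h₀, a₀, H₀⟩ := hex
  obtain ⟨T₀, hT₀, hcl⟩ := exists_finite_closure (le_refl (perSub y'))
  obtain ⟨r, p, hp, hp'⟩ := exists_fin_word hT₀
  rw [hcl] at hp hp'
  choose q b hq using hp
  refine ⟨{g₀, h₀} ∪ (Set.range p ∪ Set.range q), ?_, ?_, ?_⟩
  · exact (Set.toFinite _).union ((Set.finite_range p).union (Set.finite_range q))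
  · rintro x ((rfl | rfl) | (⟨i, rfl⟩ | ⟨i, rfl⟩))
    · exact (H₀.mem_geo hy hy').1
    · exact (H₀.mem_geo hy hy').2
    · exact ((hq i).mem_geo hy' hy').1
    · exact ((hq i).mem_geo hy' hy').2
  intro ι _ _ f hf hT
  obtain ⟨ig, hig⟩ := hT (Or.inl (Or.inl rfl))
  obtain ⟨ih, hih⟩ := hT (Or.inl (Or.inr rfl))
  have hpi : ∀ i, ∃ k, f k = p i := fun i => hT (Or.inr (Or.inl ⟨i, rfl⟩))
  have hqi : ∀ i, ∃ k, f k = q i := fun i => hT (Or.inr (Or.inr ⟨i, rfl⟩))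
  choose ip hip using hpi
  choose iq hiq using hqi
  have hpw : ∀ u : List (Fin r), wordProd f (u.map ip ++ [ig]) = wordProd p u * g₀ := by
    intro u
    rw [wordProd_append, wordProd_map, wordProd_cons, wordProd_nil, mul_one, hig]
    simp only [hip]
  have hqw : ∀ u : List (Fin r), wordProd f (u.map iq ++ [ih]) = wordProd q u * h₀ := by
    intro u
    rw [wordProd_append, wordProd_map, wordProd_cons, wordProd_nil, mul_one, hih]
    simp only [hiq]
  have hcarry : ∀ u : List (Fin r),
      ∃ a, Λ.Carry (wordProd p u * g₀) y.1 y'.1 (wordProd q u * h₀) a := by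
    intro u
    obtain ⟨a, ha⟩ := Carry.wordProd (fun i => ⟨_, hq i⟩) u
    exact ⟨_, H₀.trans y.2.1 y'.2.1 y'.2.1 ha⟩
  have hiff : ∀ v : List ι, (∃ h a, Λ.Carry (wordProd f v) y.1 y'.1 h a) ↔
      ∃ u : List (Fin r), wordProd f v = wordProd f (u.map ip ++ [ig]) := by
    intro v
    constructor
    · rintro ⟨h, a, H⟩
      have : wordProd f v * g₀⁻¹ ∈ perSub y' := ⟨_, _, H₀.symm.trans y'.2.1 y.2.1 y'.2.1 H⟩
      obtain ⟨u, hu⟩ := hp' _ this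
      exact ⟨u, by rw [hpw, hu, inv_mul_cancel_right]⟩
    · rintro ⟨u, hu⟩
      obtain ⟨a, ha⟩ := hcarry u
      rw [hu, hpw]
      exact ⟨_, _, ha⟩
  have hcomp : ∀ (j : Fin r → ι) (k : ι), Computable fun u : List (Fin r) => u.map j ++ [k] :=
    fun j k => Computable.list_append.comp (Computable.map_finite j) (Computable.const _)
  have hdec : ComputablePred fun v : List ι =>
      ∃ u : List (Fin r), wordProd f v = wordProd f (u.map ip ++ [ig]) := by
    -- Solvability is the membership of `v g₀⁻¹` in the group of periods; the additional letter
    -- stands for `g₀⁻¹`.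
    have h1 := hD y' hy' (perSub y') le_rfl (ι ⊕ Unit) (Sum.elim f fun _ => g₀⁻¹) (by
      rintro (i | i)
      · exact hf i
      · exact inv_mem (H₀.mem_geo hy hy').1)
    have h2 : Computable fun v : List ι => v.map Sum.inl ++ [Sum.inr ()] :=
      Computable.list_append.comp (Computable.map_finite (Sum.inl : ι → ι ⊕ Unit))
        (Computable.const _)
    refine (h1.comp h2).of_eq fun v => ?_
    rw [← hiff, wordProd_append, wordProd_map, wordProd_cons, wordProd_nil, mul_one]
    simp only [Sum.elim_inl, Sum.elim_inr]
    change wordProd f v * _ ∈ _ ↔ _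
    constructor
    · rintro ⟨h, a, H⟩
      exact ⟨_, _, by simpa using H₀.trans y.2.1 y'.2.1 y'.2.1 H⟩
    · rintro ⟨h, a, H⟩
      exact ⟨_, _, H₀.symm.trans y'.2.1 y.2.1 y'.2.1 H⟩
  have hdec2 := (hW.computablePred_eq hf).comp
    (Computable.fst.pair ((hcomp ip ig).comp Computable.snd) :
      Computable fun x : List ι × List (Fin r) => (x.1, x.2.map ip ++ [ig]))
  -- Once solvability is decided, a word `u` in the periods is found by search, and the word in the
  -- `q` with the same indices gives the right-hand side.
  obtain ⟨t, ht, ht'⟩ := ComputablePred.exists_choose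
    (p := fun v (u : List (Fin r)) => wordProd f v = wordProd f (u.map ip ++ [ig])) hdec2 hdec
  refine ⟨fun v => (t v).map fun u => u.map iq ++ [ih],
    Computable.option_map ht ((hcomp iq ih).comp Computable.snd).to₂, fun v => ⟨?_, ?_⟩⟩
  · intro v' hv'
    obtain ⟨u, hu, rfl⟩ := Option.map_eq_some_iff.1 hv'
    rw [(ht' v).1 u hu, hpw, hqw]
    exact hcarry u
  · intro hv
    rw [hiff]
    exact (ht' v).2 (by simpa using hv)

end Level
end GroupExt

/-! ### Britton reduction on a stack. -/

namespace GroupExt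

open Polynomial

universe u

variable {G : Type u} [Group G] {S : Set G}

section StackMachine

variable {κ ν : Type} [Primcodable κ] [Primcodable ν]

/-- One step of the reduction of a word to a stack, where the partial map `t` performs the
cancellations. -/
def stackStep (t : ν × ν × List κ → Option (List κ)) (x : κ ⊕ ν)
    (s : List κ × List (ν × List κ)) : List κ × List (ν × List κ) :=
  Sum.casesOn x (fun k => (k :: s.1, s.2)) fun i =>
    (s.2.head?.bind fun p => (t (i, p.1, s.1)).map fun v => (v ++ p.2, s.2.tail)).getD
      ([], (i, s.1) :: s.2)

theorem computable_stackStep {t : ν × ν × List κ → Option (List κ)} (ht : Computable t) :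
    Computable fun p : (κ ⊕ ν) × (List κ × List (ν × List κ)) => stackStep t p.1 p.2 := by
  have h1 : Computable₂ fun (p : (κ ⊕ ν) × (List κ × List (ν × List κ))) (k : κ) =>
      (k :: p.2.1, p.2.2) :=
    ((Computable.list_cons.comp Computable.snd
      (Computable.fst.comp (Computable.snd.comp Computable.fst))).pair
        (Computable.snd.comp (Computable.snd.comp Computable.fst))).to₂
  have h2 : Computable fun q : ((κ ⊕ ν) × (List κ × List (ν × List κ))) × ν => q.1.2.2.head? :=
    Primrec.list_head?.to_comp.comp (Computable.snd.comp (Computable.snd.comp Computable.fst))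
  have h3 : Computable fun r : (((κ ⊕ ν) × (List κ × List (ν × List κ))) × ν) × (ν × List κ) =>
      t (r.1.2, r.2.1, r.1.1.2.1) :=
    ht.comp ((Computable.snd.comp Computable.fst).pair ((Computable.fst.comp Computable.snd).pair
      (Computable.fst.comp (Computable.snd.comp (Computable.fst.comp Computable.fst)))))
  have h4 : Computable₂ fun
      (r : (((κ ⊕ ν) × (List κ × List (ν × List κ))) × ν) × (ν × List κ)) (v : List κ) =>
      (v ++ r.2.2, r.1.1.2.2.tail) :=
    ((Computable.list_append.comp Computable.snd
      (Computable.snd.comp (Computable.snd.comp Computable.fst))).pair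
        (Primrec.list_tail.to_comp.comp (Computable.snd.comp (Computable.snd.comp
          (Computable.fst.comp (Computable.fst.comp Computable.fst)))))).to₂
  have h5 : Computable fun q : ((κ ⊕ ν) × (List κ × List (ν × List κ))) × ν =>
      (([] : List κ), (q.2, q.1.2.1) :: q.1.2.2) :=
    (Computable.const []).pair (Computable.list_cons.comp
      (Computable.snd.pair (Computable.fst.comp (Computable.snd.comp Computable.fst)))
      (Computable.snd.comp (Computable.snd.comp Computable.fst)))
  exact Computable.sumCasesOn Computable.fst h1
    (Computable.option_getD (Computable.option_bind h2 (Computable.option_map h3 h4).to₂) h5).to₂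

end StackMachine

namespace Level

variable {d : ℕ} {Λ : Level S d}

section Stack

variable {κ ν : Type} (F : κ → Λ.E) (c : ν → Λ.Cell)

/-- The stack of group elements which is described by a stack of words. -/
def stackList (s : List (ν × List κ)) : List (Λ.CellBiset × Λ.E) :=
  s.map fun p => (bisetMk 1 (c p.1) 1, wordProd F p.2)

/-- The value of a stack. -/
noncomputable def stackVal (s : List κ × List (ν × List κ)) : Λ.Next :=
  Λ.toNext (wordProd F s.1) * InvBiset.BisetGroup.stackEval (stackList F c s.2)

variable {F c}

/-- Letters arrive from the left. If `v` carries the top cell `y` to the reversal of the arriving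
cell `x`, then `v y = x⁻¹ v'`, hence `x v y = v'`. If not, pushing keeps the stack reduced. -/
theorem stackStep_spec {t : ν × ν × List κ → Option (List κ)}
    (ht : ∀ i j v, (∀ v', t (i, j, v) = some v' →
      ∃ a, Λ.Carry (wordProd F v) (c j).1 (cellBar (c i)).1 (wordProd F v') a) ∧
        (t (i, j, v) = none → ¬ ∃ h a, Λ.Carry (wordProd F v) (c j).1 (cellBar (c i)).1 h a))
    (x : κ ⊕ ν) (s : List κ × List (ν × List κ))
    (hs : InvBiset.BisetGroup.IsReduced (stackList F c s.2)) :
    stackVal F c (stackStep t x s) =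
        Sum.elim (fun k => Λ.toNext (F k)) (fun i => Λ.cell (c i)) x * stackVal F c s ∧
      InvBiset.BisetGroup.IsReduced (stackList F c (stackStep t x s).2) := by
  obtain ⟨v, s⟩ := s
  rcases x with k | i
  · refine ⟨?_, hs⟩
    simp only [stackStep, stackVal, wordProd_cons, map_mul, Sum.elim_inl, mul_assoc]
  · have hpush : stackVal F c ([], (i, v) :: s) = Λ.cell (c i) * stackVal F c (v, s) := by
      simp only [stackVal, wordProd_nil, map_one, one_mul, stackList, List.map_cons,
        InvBiset.BisetGroup.stackEval, mul_assoc]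
      rfl
    rcases s with _ | ⟨⟨j, v₁⟩, s⟩
    · exact ⟨hpush, List.isChain_singleton _⟩
    · cases e : t (i, j, v) with
      | none =>
        have e' : stackStep t (Sum.inr i) (v, (j, v₁) :: s) = ([], (i, v) :: (j, v₁) :: s) := by
          simp [stackStep, e]
        rw [e']
        refine ⟨hpush, List.isChain_cons_cons.2 ⟨?_, hs⟩⟩
        dsimp only
        rw [inv_mk, inv_one, Ne, cls_mk_eq]
        exact (ht i j v).2 e
      | some v' =>
        have e' : stackStep t (Sum.inr i) (v, (j, v₁) :: s) = (v' ++ v₁, s) := by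
          simp [stackStep, e]
        rw [e']
        refine ⟨?_, hs.tail⟩
        obtain ⟨a, ha⟩ := (ht i j v).1 v' e
        have h1 := cell_carry ha
        rw [cell_cellBar, eq_inv_mul_iff_mul_eq] at h1
        simp only [stackVal, stackList, List.map_cons, InvBiset.BisetGroup.stackEval,
          wordProd_append, map_mul, Sum.elim_inr]
        rw [← h1]
        simp only [mul_assoc]
        rfl

theorem foldr_stackStep_spec {t : ν × ν × List κ → Option (List κ)}
    (ht : ∀ i j v, (∀ v', t (i, j, v) = some v' →
      ∃ a, Λ.Carry (wordProd F v) (c j).1 (cellBar (c i)).1 (wordProd F v') a) ∧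
        (t (i, j, v) = none → ¬ ∃ h a, Λ.Carry (wordProd F v) (c j).1 (cellBar (c i)).1 h a))
    (w : List (κ ⊕ ν)) :
    stackVal F c (w.foldr (stackStep t) ([], [])) =
        wordProd (Sum.elim (fun k => Λ.toNext (F k)) (fun i => Λ.cell (c i))) w ∧
      InvBiset.BisetGroup.IsReduced (stackList F c (w.foldr (stackStep t) ([], [])).2) := by
  induction w with
  | nil =>
    refine ⟨?_, List.IsChain.nil⟩
    simp [stackVal, wordProd_nil, stackList, InvBiset.BisetGroup.stackEval]
  | cons x w ih =>
    have := stackStep_spec ht x _ ih.2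
    rw [List.foldr_cons, wordProd_cons, this.1, ih.1]
    exact ⟨rfl, this.2⟩

end Stack

/-- The letters from which the local geodesics of the next level are composed. -/
def IsGeoLetter : Λ.E ⊕ Λ.Cell → Prop :=
  Sum.elim (fun e => e ∈ Λ.geo) fun y => IsLocalGeodesic S y.1

variable (Λ) in
noncomputable def letterVal : Λ.E ⊕ Λ.Cell → Λ.Next := Sum.elim Λ.toNext Λ.cell

theorem exists_letters_of_isLocalGeodesic {w : AWord (Alphabet S)} (h : IsLocalGeodesic S w)
    (hw : w.len ∈ degreeLT ℤ (d + 2)) :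
    ∃ l : List (Λ.E ⊕ Λ.Cell), (∀ x ∈ l, IsGeoLetter x) ∧
      (l.map Λ.letterVal).prod = Λ.nextφ w := by
  obtain ⟨n, hn⟩ := exists_hasTop hw
  induction n using Nat.strong_induction_on generalizing w with
  | _ n ih =>
    match n with
    | 0 =>
      have hn := hasTop_zero.1 hn
      refine ⟨[Sum.inl (Λ.φ w)], ?_, ?_⟩
      · simpa [IsGeoLetter] using φ_mem_geo h hn
      · simp [letterVal, nextφ_low hn]
    | 1 =>
      have hn := isCell_iff_hasTop.2 hn
      refine ⟨[Sum.inr ⟨w, h.isGReduced, hn⟩], ?_, ?_⟩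
      · simpa [IsGeoLetter] using h
      · simp [letterVal, nextφ_cell hn, cellElt_eq h.isGReduced hn]
    | n + 2 =>
      obtain ⟨c, v, rfl, hc, hc', hv'⟩ := hn.exists_cell
      obtain ⟨l, hl, hl'⟩ := ih (n + 1) (by omega) h.right hv'.1 hv'
      refine ⟨Sum.inr ⟨c, h.left.isGReduced, hc'⟩ :: l, ?_, ?_⟩
      · intro x hx
        rcases List.mem_cons.1 hx with rfl | hx
        · exact h.left
        · exact hl x hx
      · rw [List.map_cons, List.prod_cons, hl', nextφ_cons hc hc' hv',
          cellElt_eq h.left.isGReduced hc']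
        rfl

theorem exists_letters {g : Λ.Next} (hg : g ∈ Λ.next.geo) :
    ∃ l : List (Λ.E ⊕ Λ.Cell), (∀ x ∈ l, IsGeoLetter x) ∧ (l.map Λ.letterVal).prod = g := by
  induction hg using Subgroup.closure_induction with
  | mem g hg =>
    obtain ⟨w, hw, hw', rfl⟩ := hg
    exact exists_letters_of_isLocalGeodesic hw hw'
  | one => exact ⟨[], by simp, rfl⟩
  | mul g g' _ _ h h' =>
    obtain ⟨l, hl, rfl⟩ := h
    obtain ⟨l', hl', rfl⟩ := h'
    refine ⟨l ++ l', ?_, by simp⟩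
    intro x hx
    rcases List.mem_append.1 hx with hx | hx
    · exact hl x hx
    · exact hl' x hx
  | inv g _ h =>
    obtain ⟨l, hl, rfl⟩ := h
    refine ⟨(l.map (Sum.map (fun e => e⁻¹) cellBar)).reverse, ?_, ?_⟩
    · intro x hx
      obtain ⟨z, hz, rfl⟩ := List.mem_map.1 (List.mem_reverse.1 hx)
      have := hl z hz
      rcases z with e | y
      · exact inv_mem this
      · exact IsLocalGeodesic.bar this
    · rw [List.prod_inv_reverse, List.map_reverse, List.map_map, List.map_map]
      congr 3
      funext z
      rcases z with e | y
      · exact map_inv _ _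
      · exact cell_cellBar y

/-- It is decidable whether a word over elements of the next level has its value in the lower level,
and then its value can be computed. -/
theorem exists_reduction (hW : DecidableWP Λ.geo) (hD : Λ.DecidablePeriods) {ι : Type}
    [Primcodable ι] [Finite ι] {f : ι → Λ.Next} (hf : ∀ i, f i ∈ Λ.next.geo) :
    ∃ (m : ℕ) (F : Fin m → Λ.E) (red : List ι → Option (List (Fin m))), (∀ i, F i ∈ Λ.geo) ∧
      Computable red ∧ ∀ w, (∀ v, red w = some v → wordProd f w = Λ.toNext (wordProd F v)) ∧
        (red w = none → ∀ e, wordProd f w ≠ Λ.toNext e) := by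
  choose l hl hlf using fun i => exists_letters (hf i)
  have hC : (⋃ i, {y | Sum.inr y ∈ l i} : Set Λ.Cell).Finite := Set.finite_iUnion fun i =>
    (List.finite_toSet (l i)).preimage Sum.inr_injective.injOn
  have hT₀ : (⋃ i, {e | Sum.inl e ∈ l i} : Set Λ.E).Finite := Set.finite_iUnion fun i =>
    (List.finite_toSet (l i)).preimage Sum.inl_injective.injOn
  obtain ⟨N, c, hc⟩ := exists_fin_range hC
  have hcg : ∀ j, IsLocalGeodesic S (c j).1 := by
    intro j
    have : c j ∈ ⋃ i, {y | Sum.inr y ∈ l i} := hc ▸ Set.mem_range_self j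
    obtain ⟨i, hi⟩ := Set.mem_iUnion.1 this
    exact hl i _ hi
  choose T hT hTg htr using fun i j => exists_transfer hW hD (c j) (cellBar (c i)) (hcg j)
    (hcg i).bar
  -- One alphabet for the lower level: it holds the letters from the factorizations of all `f i` and
  -- the finite sets required by the transfers, so cancellations never leave it.
  obtain ⟨m, F, hF⟩ := exists_fin_range
    (hT₀.union (Set.finite_iUnion fun i => Set.finite_iUnion fun j => hT i j))
  have hFg : ∀ k, F k ∈ Λ.geo := by
    intro k
    have : F k ∈ (⋃ i, {e | Sum.inl e ∈ l i}) ∪ ⋃ i, ⋃ j, T i j := hF ▸ Set.mem_range_self k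
    rcases this with h | h
    · obtain ⟨i, hi⟩ := Set.mem_iUnion.1 h
      exact hl i _ hi
    · obtain ⟨i, hi⟩ := Set.mem_iUnion.1 h
      obtain ⟨j, hj⟩ := Set.mem_iUnion.1 hi
      exact hTg i j hj
  choose t ht ht' using fun i j => htr i j (Fin m) F hFg (by
    rw [hF]
    exact fun x hx => Or.inr (Set.mem_iUnion.2 ⟨i, Set.mem_iUnion.2 ⟨j, hx⟩⟩))
  have htc : Computable fun p : Fin N × Fin N × List (Fin m) => t p.1 p.2.1 p.2.2 :=
    Computable.fin_uncurry (f := fun i (p : Fin N × List (Fin m)) => t i p.1 p.2)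
      fun i => Computable.fin_uncurry (ht i)
  have hwd : ∀ i, ∃ w : List (Fin m ⊕ Fin N), w.map (Sum.map F c) = l i := by
    intro i
    have : l i ∈ Set.range (List.map (Sum.map F c)) := by
      rw [Set.range_list_map]
      rintro (e | y) hx
      · have : e ∈ Set.range F := by
          rw [hF]
          exact Or.inl (Set.mem_iUnion.2 ⟨i, hx⟩)
        obtain ⟨k, rfl⟩ := this
        exact ⟨Sum.inl k, rfl⟩
      · have : y ∈ Set.range c := by
          rw [hc]
          exact Set.mem_iUnion.2 ⟨i, hx⟩
        obtain ⟨k, rfl⟩ := this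
        exact ⟨Sum.inr k, rfl⟩
    exact this
  choose wd hwd using hwd
  let st : List ι → List (Fin m) × List (Fin N × List (Fin m)) := fun w =>
    (w.flatMap wd).foldr (stackStep fun p => t p.1 p.2.1 p.2.2) ([], [])
  have hst : Computable st :=
    (Computable.list_foldr' (computable_stackStep htc) ([], [])).comp
      (Computable.flatMap_finite wd)
  have hval : ∀ w, stackVal F c (st w) = wordProd f w ∧
      InvBiset.BisetGroup.IsReduced (stackList F c (st w).2) := by
    intro w
    have h := foldr_stackStep_spec (F := F) (c := c) (t := fun p => t p.1 p.2.1 p.2.2)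
      (fun i j v => ht' i j v) (w.flatMap wd)
    refine ⟨h.1.trans ?_, h.2⟩
    rw [wordProd_flatMap]
    congr 1
    funext i
    rw [← hlf i, ← hwd i, List.map_map, wordProd]
    congr 2
    funext x
    rcases x with k | k <;> rfl
  refine ⟨m, F, fun w => Option.casesOn (st w).2.head? (some (st w).1) fun _ => none, hFg, ?_, ?_⟩
  · exact Computable.option_casesOn (Primrec.list_head?.to_comp.comp (Computable.snd.comp hst))
      (Computable.option_some.comp (Computable.fst.comp hst)) (Computable.const none).to₂
  · intro w
    obtain ⟨h1, h2⟩ := hval w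
    rcases hs : (st w).2 with _ | ⟨p, s⟩
    · refine ⟨fun v hv => ?_, fun h => by simp [hs] at h⟩
      obtain rfl : (st w).1 = v := by simpa [hs] using hv
      rw [← h1, stackVal, hs]
      simp [stackList, InvBiset.BisetGroup.stackEval]
    · refine ⟨fun v hv => by simp [hs] at hv, fun _ e he => ?_⟩
      -- A reduced nonempty stack has positive length, whereas elements of the lower level have
      -- length `0`.
      have h3 := congrArg InvBiset.BisetGroup.length (h1.trans he)
      rw [stackVal, InvBiset.BisetGroup.length_base_mul, h2.length_eq,
        InvBiset.BisetGroup.length_base, hs] at h3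
      simp [stackList] at h3

end Level
end GroupExt

/-! ### Deciding membership in groups of periods. -/

namespace GroupExt

open Polynomial

universe u

variable {G : Type u} [Group G] {S : Set G}

namespace Level

variable {d : ℕ} {Λ : Level S d}

/-- The elements which carry a cell to itself up to a shift of degree less than `d`. -/
def lowPer (y : Λ.Cell) : Subgroup Λ.E where
  carrier := {g | ∃ h a, Λ.Carry g y.1 y.1 h a ∧ a.coeff d = 0}
  one_mem' := ⟨1, 0, Carry.refl y.2.2, by simp⟩
  mul_mem' := by
    rintro g g' ⟨h, a, H, ha⟩ ⟨h', a', H', ha'⟩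
    exact ⟨_, _, H.mul H', by rw [coeff_add, ha, ha', add_zero]⟩
  inv_mem' := by
    rintro g ⟨h, a, H, ha⟩
    exact ⟨_, _, H.symm, by rw [coeff_neg, ha, neg_zero]⟩

/-- For prefixes of local geodesics `len` is the top coefficient, so `g φ(p) = φ(p')` bounds the
growth from `p` to `p'`. -/
theorem Carry.coeff_le {g h : Λ.E} {y y' : AWord (Alphabet S)} {a : ℤ[X]}
    (H : Λ.Carry g y y' h a) (hy : IsLocalGeodesic S y) (hy' : IsLocalGeodesic S y') {C : ℕ}
    (hC : ∀ x, Λ.len (g * x) ≤ Λ.len x + C) : a.coeff d ≤ C := by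
  obtain ⟨p, c, q, p', q', rfl, rfl, hc, hp, hq, hp', hq', e3, e4, rfl⟩ := H
  have h1 := hC (Λ.φ p)
  rw [e3, Λ.len_φ _ hy'.left.left hp'.2, Λ.len_φ _ hy.left.left hp.2] at h1
  have h2 := ZPoly.coeff_nonneg hp'.2 p'.len_nonneg
  have h3 := ZPoly.coeff_nonneg hp.2 p.len_nonneg
  rw [coeff_sub]
  omega

theorem exists_len_wordProd_le {ι : Type} [Finite ι] (f : ι → Λ.E) :
    ∃ C, ∀ (w : List ι) x, Λ.len (wordProd f w * x) ≤ Λ.len x + C * w.length ∧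
      Λ.len ((wordProd f w)⁻¹ * x) ≤ Λ.len x + C * w.length := by
  choose C hC using fun i => Λ.exists_len_mul_le (f i)
  choose D hD using fun i => Λ.exists_len_mul_le (f i)⁻¹
  obtain ⟨M, hM⟩ := Finite.exists_le fun i => max (C i) (D i)
  refine ⟨M, fun w => ?_⟩
  induction w with
  | nil => intro x; simp [wordProd_nil]
  | cons i w ih =>
    intro x
    have h1 := hC i (wordProd f w * x)
    have h2 := hD i x
    have h3 := (ih x).1
    have h4 := (ih ((f i)⁻¹ * x)).2
    have h5 := hM i
    rw [wordProd_cons, mul_inv_rev, mul_assoc, mul_assoc, List.length_cons, mul_add, mul_one]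
    omega

/-- A subgroup of `perSub y` is generated by its intersection with `lowPer y` and one further
element, whose exponent is bounded by the length of the words. -/
theorem exists_cyclic_part {y : Λ.Cell} (hy : IsLocalGeodesic S y.1) {P : Subgroup Λ.E}
    (hP : P ≤ perSub y) : ∃ g ∈ P, ∀ (ι : Type) [Finite ι] (f : ι → Λ.E), ∃ C : ℕ, ∀ w : List ι,
      wordProd f w ∈ P ↔ ∃ n ≤ C * w.length, wordProd f w * g ^ n ∈ P ⊓ lowPer y ∨
        wordProd f w * g⁻¹ ^ n ∈ P ⊓ lowPer y := by
  -- The top coefficients of the shifts of `P`; `g` is an element whose coefficient generates this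
  -- cyclic group.
  let I : AddSubgroup ℤ :=
    { carrier := {z | ∃ g ∈ P, ∃ h a, Λ.Carry g y.1 y.1 h a ∧ a.coeff d = z}
      zero_mem' := ⟨1, one_mem _, 1, 0, Carry.refl y.2.2, by simp⟩
      add_mem' := by
        rintro z z' ⟨g, hg, h, a, H, rfl⟩ ⟨g', hg', h', a', H', rfl⟩
        exact ⟨g * g', mul_mem hg hg', _, _, H.mul H', coeff_add _ _ _⟩
      neg_mem' := by
        rintro z ⟨g, hg, h, a, H, rfl⟩
        exact ⟨g⁻¹, inv_mem hg, _, _, H.symm, coeff_neg _ _⟩ }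
  have hI : ∀ z, z ∈ I ↔ ∃ g ∈ P, ∃ h a, Λ.Carry g y.1 y.1 h a ∧ a.coeff d = z := fun z => Iff.rfl
  obtain ⟨m, hm⟩ := Int.subgroup_cyclic I
  obtain ⟨g, hg, k, b, K, hb⟩ := (hI m).1 (hm ▸ AddSubgroup.subset_closure rfl)
  refine ⟨g, hg, fun ι _ f => ?_⟩
  obtain ⟨C, hC⟩ := exists_len_wordProd_le f
  refine ⟨C, fun w => ⟨fun hw => ?_, ?_⟩⟩
  · obtain ⟨h, a, H⟩ := hP hw
    have ha : a.coeff d ∈ I := (hI _).2 ⟨_, hw, h, a, H, rfl⟩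
    rw [hm, ← AddSubgroup.zmultiples_eq_closure, AddSubgroup.mem_zmultiples_iff] at ha
    obtain ⟨z, hz⟩ := ha
    -- If `m = 0` the factor `z` is arbitrary and has to be replaced by `0` for the bound.
    obtain ⟨z, hz, hz'⟩ : ∃ z : ℤ, z * m = a.coeff d ∧ |z| ≤ |a.coeff d| := by
      by_cases hm0 : m = 0
      · exact ⟨0, by rw [← hz, hm0]; simp, by simp⟩
      · refine ⟨z, by rw [← hz, smul_eq_mul], ?_⟩
        rw [← hz, smul_eq_mul, abs_mul]
        exact le_mul_of_one_le_right (abs_nonneg z) (Int.one_le_abs hm0)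
    have hmem : wordProd f w * g ^ (-z) ∈ P ⊓ lowPer y := by
      refine ⟨mul_mem hw (zpow_mem hg _), _, _, H.mul (K.zpow (-z)), ?_⟩
      rw [coeff_add, coeff_smul, hb, smul_eq_mul, ← hz]
      ring
    have h1 := H.coeff_le hy hy fun x => (hC w x).1
    have h2 := H.symm.coeff_le hy hy fun x => (hC w x).2
    rw [coeff_neg] at h2
    have h3 : |z| ≤ ((C * w.length : ℕ) : ℤ) := hz'.trans (abs_le.2 ⟨by linarith, h1⟩)
    refine ⟨z.natAbs, by rw [Int.abs_eq_natAbs] at h3; exact_mod_cast h3, ?_⟩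
    rcases Int.natAbs_eq z with e | e
    · right
      rwa [e, zpow_neg, zpow_natCast, ← inv_pow] at hmem
    · left
      rwa [e, neg_neg, zpow_natCast] at hmem
  · rintro ⟨n, -, h | h⟩
    · exact (mul_mem_cancel_right (pow_mem hg n)).1 h.1
    · exact (mul_mem_cancel_right (pow_mem (inv_mem hg) n)).1 h.1

/-- Only linearly many powers of one element of `P` have to be tried as corrections of the word. -/
theorem decidableMem_of_lowPer {y : Λ.Cell} (hy : IsLocalGeodesic S y.1) {P : Subgroup Λ.E}
    (hP : P ≤ perSub y)
    (h : ∀ (ι : Type) [Primcodable ι] [Finite ι] (f : ι → Λ.E), (∀ i, f i ∈ Λ.geo) →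
      DecidableMem f (P ⊓ lowPer y))
    (ι : Type) [Primcodable ι] [Finite ι] (f : ι → Λ.E) (hf : ∀ i, f i ∈ Λ.geo) :
    DecidableMem f P := by
  obtain ⟨g, hg, hgf⟩ := exists_cyclic_part hy hP
  obtain ⟨C, hC⟩ := hgf ι f
  have hg' := perSub_le_geo hy (hP hg)
  have h1 := h (ι ⊕ Bool) (Sum.elim f fun b => cond b g g⁻¹) (by
    rintro (i | (_ | _))
    · exact hf i
    · exact inv_mem hg'
    · exact hg')
  have h2 : ∀ b : Bool, Computable fun p : List ι × ℕ =>
      p.1.map Sum.inl ++ List.replicate p.2 (Sum.inr b : ι ⊕ Bool) := fun b =>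
    Computable.list_append.comp
      ((Computable.map_finite (Sum.inl : ι → ι ⊕ Bool)).comp Computable.fst)
      ((Computable.replicate _).comp Computable.snd)
  have h3 : ∀ (b : Bool) (p : List ι × ℕ), wordProd (Sum.elim f fun b => cond b g g⁻¹)
      (p.1.map Sum.inl ++ List.replicate p.2 (Sum.inr b : ι ⊕ Bool)) =
        wordProd f p.1 * (cond b g g⁻¹) ^ p.2 := by
    intro b p
    rw [wordProd_append, wordProd_map, wordProd_replicate]
    rfl
  have h4 := (h1.comp (h2 true)).or (h1.comp (h2 false))
  simp only [h3, cond_true, cond_false] at h4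
  have h5 : Computable fun w : List ι => C * w.length :=
    Primrec.nat_mul.to_comp.comp (Computable.const C) Computable.list_length
  exact (ComputablePred.exists_le (p := fun w n => wordProd f w * g ^ n ∈ P ⊓ lowPer y ∨
    wordProd f w * g⁻¹ ^ n ∈ P ⊓ lowPer y) h4 h5).of_eq fun w => (hC w).symm

/-- Let `s = p x` end inside the core. Then `p' x` is again a prefix of `y`, longer than `s` by a
word `v` of degree at most `d`, so `g` acts on `s` as right multiplication by `v`. Since `y` repeats
itself with period `v` after `s`, the factor `y'` there has the period `v`. -/
theorem conj_of_carry {y s y' z p c q p' q' : AWord (Alphabet S)}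
    (hy : IsGReduced S y) (hy' : IsCell (d + 1) y') (e : y = s * y' * z)
    (e1 : y = p * c * q) (e2 : y = p' * c * q') (hc : IsCell (d + 2) c)
    (hs : s.len ∈ degreeLT ℤ (d + 2)) (hps : p.len ≤ s.len) (hpp : p.len ≤ p'.len)
    (hp' : p'.len ∈ degreeLT ℤ (d + 2)) (ha : (p'.len - p.len).coeff (d + 1) = 0)
    {g : Λ.Next} (hg : g * Λ.nextφ p = Λ.nextφ p') :
    ∃ k h a, Λ.Carry k y' y' h a ∧ g * Λ.nextφ s = Λ.nextφ s * Λ.toNext k := by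
  rw [mul_assoc] at e e1 e2
  obtain ⟨x, rfl, e3⟩ := AWord.levi (e1.symm.trans e) hps
  have hx := AWord.low_of_mul_right hs
  obtain ⟨c₁, rfl, e4⟩ := AWord.levi e3.symm (hc.lt hx).le
  have hc₁ := hc.of_mul_left hx
  have e5 : (p * x) * (y' * z) = (p' * x) * (c₁ * q') := by
    rw [← e, e2]
    simp only [mul_assoc]
  obtain ⟨v, hv, e6⟩ := AWord.levi e5 (by
    rw [AWord.len_mul, AWord.len_mul]
    linarith)
  have hsp : IsGReduced S (p' * x) := by
    refine IsGReduced.left (q := c₁ * q') ?_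
    rwa [← e5, ← e]
  have hpx : Small S (d + 1) (p * x) := ⟨by rw [e] at hy; exact hy.left, hs⟩
  have hpx' : Small S (d + 1) (p' * x) := ⟨hsp, add_mem hp' hx⟩
  have hvlen : v.len = p'.len - p.len := by
    have := congrArg AWord.len hv
    simp only [AWord.len_mul] at this
    linear_combination -this
  have hvlow : v.len ∈ degreeLT ℤ (d + 1) := by
    rw [hvlen]
    exact ZPoly.low_of_coeff (sub_mem hp' (AWord.low_of_mul_left hs)) ha
  have hy'c : y'.len < c₁.len := hc₁.lt hy'.1
  obtain ⟨r, rfl, e7⟩ := AWord.levi e4 hy'c.le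
  obtain ⟨c₂, rfl, e8⟩ := AWord.levi e6.symm (hy'.lt hvlow).le
  have hc₂ := hy'.of_mul_left hvlow
  simp only [mul_assoc] at e8
  -- Now `y' = v c₂ = c₂ b`, and `c₂` is the core of the carry of `y'` to itself.
  obtain ⟨b, hb, -⟩ := AWord.levi (p := c₂) (q := z) (p' := v * c₂) (q' := r * q')
    (by rw [← e8]; simp only [mul_assoc]) (by
      rw [AWord.len_mul]
      linarith [v.len_nonneg])
  have hred : IsGReduced S (v * c₂) := by
    refine IsGReduced.left (q := z) (IsGReduced.right (p := p * x) ?_)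
    rwa [← e]
  have hbs : Small S d b := by
    refine ⟨by rw [hb] at hred; exact hred.right, ?_⟩
    have := congrArg AWord.len hb
    simp only [AWord.len_mul] at this
    have hbl : b.len = v.len := by linear_combination -this
    rw [hbl]
    exact hvlow
  have hvs : Small S d v := ⟨hred.left, hvlow⟩
  refine ⟨Λ.φ v, Λ.φ b, v.len - 0, ⟨1, c₂, b, v, 1, by rw [one_mul, hb], by simp, hc₂, small_one, hbs,
    hvs, small_one, by simp [φ_one], by simp [φ_one], by simp [AWord.len_one]⟩, ?_⟩
  rw [nextφ_mul hpx, ← mul_assoc, hg, ← nextφ_mul hpx', hv, nextφ_mul (hv ▸ hpx'), nextφ_mul hpx,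
    nextφ_low hvlow]

theorem exists_bound {d : ℕ} {T : Set ℤ[X]} (hT : T.Finite) (h : ∀ a ∈ T, a ∈ degreeLT ℤ d) :
    ∃ M ∈ degreeLT ℤ d, 0 ≤ M ∧ ∀ a ∈ T, a ≤ M := by
  induction T, hT using Set.Finite.induction_on with
  | empty => exact ⟨0, zero_mem _, le_rfl, by simp⟩
  | insert _ _ ih =>
    obtain ⟨M, hM, h0, hM'⟩ := ih fun a ha => h a (Or.inr ha)
    rename_i b T _ _
    refine ⟨max b M, ?_, le_max_of_le_right h0, ?_⟩
    · rcases max_choice b M with e | e <;> rw [e]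
      · exact h b (Or.inl rfl)
      · exact hM
    · rintro a (rfl | ha)
      · exact le_max_left _ _
      · exact le_max_of_le_right (hM' a ha)

/-- After conjugation by a sufficiently long prefix of `y`, the elements of a subgroup of `lowPer y`
lie in the lower level. -/
theorem exists_conj {y : Λ.next.Cell} (hy : IsLocalGeodesic S y.1) {Q : Subgroup Λ.next.E}
    (hQ : Q ≤ lowPer y) : ∃ s : AWord (Alphabet S), IsLocalGeodesic S s ∧
      s.len ∈ degreeLT ℤ (d + 2) ∧ ∃ y' : Λ.Cell, IsLocalGeodesic S y'.1 ∧
        ∀ g ∈ Q, ∃ k ∈ perSub y', g * Λ.next.φ s = Λ.next.φ s * Λ.toNext k := by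
  obtain ⟨T, hT, rfl⟩ := exists_finite_closure (y := y) (P := Q) fun g hg => by
    obtain ⟨h, a, H, -⟩ := hQ hg
    exact ⟨h, a, H⟩
  have hT' : ∀ g : T, ∃ p c q p' q', y.1 = p * c * q ∧ y.1 = p' * c * q' ∧ IsCell (d + 2) c ∧
      Small S (d + 1) p ∧ Small S (d + 1) p' ∧ g.1 * Λ.next.φ p = Λ.next.φ p' ∧
        (p'.len - p.len).coeff (d + 1) = 0 := by
    intro g
    obtain ⟨h, a, ⟨p, c, q, p', q', h1, h2, hc, hp, -, hp', -, h3, -, h4⟩, ha⟩ :=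
      hQ (Subgroup.subset_closure g.2)
    exact ⟨p, c, q, p', q', h1, h2, hc, hp, hp', h3, h4 ▸ ha⟩
  choose p c q p' q' h1 h2 hc hp hp' h3 h4 using hT'
  have := hT.to_subtype
  -- As `Q` is finitely generated, one length `M` of degree at most `d + 1` exceeds all prefixes
  -- involved; a prefix of this length and a further factor of length `t ^ (d + 1)` fit into `y`.
  obtain ⟨M, hM, h0, hM'⟩ := exists_bound (d := d + 2)
    ((Set.finite_range fun g => (p g).len).union (Set.finite_range fun g => (p' g).len)) (by
      rintro a (⟨g, rfl⟩ | ⟨g, rfl⟩)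
      · exact (hp g).2
      · exact (hp' g).2)
  obtain ⟨y, hyr, hyc⟩ := y
  dsimp only at *
  have hMlt : M + X ^ (d + 1) < y.len := by
    refine ZPoly.lt_of_coeff_lt (d := d + 2)
      (ZPoly.low_succ (add_mem hM (ZPoly.X_pow_low (d + 1)))) hyc.1 ?_
    rw [hyc.2, ZPoly.coeff_of_low (add_mem hM (ZPoly.X_pow_low (d + 1)))]
    norm_num
  have hX := ZPoly.X_pow_pos (d + 1)
  obtain ⟨s, v, hsv, hs⟩ := y.exists_split h0 (by linarith)
  have hlen := congrArg AWord.len hsv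
  rw [AWord.len_mul, hs] at hlen
  obtain ⟨y', z, hyz, hy'⟩ := v.exists_split hX.le (by linarith)
  have hyc' : IsCell (d + 1) y' := by
    rw [IsCell, hy']
    exact ⟨ZPoly.X_pow_low (d + 1), by simp⟩
  have e : y = s * y' * z := by rw [hsv, hyz, mul_assoc]
  have hlg : IsLocalGeodesic S s ∧ IsLocalGeodesic S y' := by
    rw [e] at hy
    exact ⟨hy.left.left, hy.left.right⟩
  have hslow : s.len ∈ degreeLT ℤ (d + 2) := by rwa [hs]
  refine ⟨s, hlg.1, hslow, ⟨y', hlg.2.isGReduced, hyc'⟩, hlg.2, ?_⟩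
  intro g hg
  induction hg using Subgroup.closure_induction with
  | mem g hg =>
    -- `conj_of_carry` needs a nonnegative shift; otherwise it is applied to the inverse.
    rcases le_total (p ⟨g, hg⟩).len (p' ⟨g, hg⟩).len with hl | hl
    · obtain ⟨k, h, a, H, e'⟩ := conj_of_carry hyr hyc' e (h1 ⟨g, hg⟩) (h2 ⟨g, hg⟩) (hc ⟨g, hg⟩) hslow
        (by rw [hs]; exact hM' _ (Or.inl ⟨_, rfl⟩)) hl (hp' ⟨g, hg⟩).2 (h4 ⟨g, hg⟩) (h3 ⟨g, hg⟩)
      exact ⟨k, ⟨h, a, H⟩, e'⟩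
    · obtain ⟨k, h, a, H, e'⟩ := conj_of_carry (g := g⁻¹) hyr hyc' e (h2 ⟨g, hg⟩) (h1 ⟨g, hg⟩)
        (hc ⟨g, hg⟩) hslow
        (by rw [hs]; exact hM' _ (Or.inr ⟨_, rfl⟩)) hl (hp ⟨g, hg⟩).2
        (by rw [← neg_sub, coeff_neg, h4 ⟨g, hg⟩, neg_zero])
        (by rw [inv_mul_eq_iff_eq_mul]; exact (h3 ⟨g, hg⟩).symm)
      refine ⟨k⁻¹, (perSub _).inv_mem ⟨h, a, H⟩, ?_⟩
      rw [inv_mul_eq_iff_eq_mul] at e'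
      rw [map_inv, eq_mul_inv_iff_mul_eq, mul_assoc]
      exact e'.symm
  | one => exact ⟨1, one_mem _, by rw [map_one, one_mul, mul_one]⟩
  | mul g g' _ _ h h' =>
    obtain ⟨k, hk, e'⟩ := h
    obtain ⟨k', hk', e''⟩ := h'
    exact ⟨k * k', mul_mem hk hk', by rw [map_mul, mul_assoc, e'', ← mul_assoc, e', mul_assoc]⟩
  | inv g _ h =>
    obtain ⟨k, hk, e'⟩ := h
    refine ⟨k⁻¹, inv_mem hk, ?_⟩
    rw [map_inv, eq_mul_inv_iff_mul_eq, mul_assoc, inv_mul_eq_iff_eq_mul]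
    exact e'.symm

/-- The reduction shows whether the value lies in the lower level, where triviality is decidable. -/
theorem decidableWP_next (hW : DecidableWP Λ.geo) (hD : Λ.DecidablePeriods) :
    DecidableWP Λ.next.geo := by
  intro ι _ _ f hf
  obtain ⟨m, F, red, hF, hred, hspec⟩ := exists_reduction hW hD hf
  refine (ComputablePred.exists_option (hW (Fin m) F hF) hred).of_eq fun w => ?_
  rw [Subgroup.mem_bot]
  constructor
  · rintro ⟨v, hv, h⟩
    rw [Subgroup.mem_bot] at h
    rw [(hspec w).1 v hv, h, map_one]
  · intro h
    rcases hv : red w with _ | v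
    · exact absurd (h.trans (map_one Λ.toNext).symm) ((hspec w).2 hv 1)
    · refine ⟨v, rfl, ?_⟩
      rw [(hspec w).1 v hv, ← map_one Λ.toNext] at h
      exact InvBiset.BisetGroup.base_injective h

/-- Only shifts of lower degree remain. For these `s⁻¹ w s` must reduce to the lower level, where it
is tested against the conjugated subgroup. -/
theorem decidablePeriods_next (hW : DecidableWP Λ.geo) (hD : Λ.DecidablePeriods) :
    Λ.next.DecidablePeriods := by
  intro y hy P hP
  refine decidableMem_of_lowPer hy hP fun ι _ _ f hf => ?_
  obtain ⟨s, hs, hslow, y', hy', hconj⟩ := exists_conj hy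
    (inf_le_right : P ⊓ lowPer y ≤ lowPer y)
  set Q := P ⊓ lowPer y
  have hsg : Λ.next.φ s ∈ Λ.next.geo := φ_mem_geo hs hslow
  obtain ⟨m, F, red, hF, hred, hspec⟩ := exists_reduction hW hD
    (f := (Sum.elim f fun b : Bool => cond b (Λ.next.φ s) (Λ.next.φ s)⁻¹ : ι ⊕ Bool → Λ.next.E)) (by
      rintro (i | (_ | _))
      · exact hf i
      · exact inv_mem hsg
      · exact hsg)
  -- It may be smaller than the full group of periods of `y'`, which is why the induction hypothesis
  -- covers all subgroups.
  let Q' : Subgroup Λ.E :=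
    Q.comap ((MulAut.conj (Λ.next.φ s) : Λ.next.E ≃* Λ.next.E).toMonoidHom.comp Λ.toNext)
  have hQ' : ∀ k, k ∈ Q' ↔ Λ.next.φ s * Λ.toNext k * (Λ.next.φ s)⁻¹ ∈ Q := fun k => Iff.rfl
  have hle : Q' ≤ perSub y' := by
    intro k hk
    obtain ⟨k', hk', e⟩ := hconj _ ((hQ' k).1 hk)
    rw [inv_mul_cancel_right, mul_right_inj] at e
    rwa [InvBiset.BisetGroup.base_injective e]
  have hcomp : Computable fun w : List ι =>
      (Sum.inr false : ι ⊕ Bool) :: (w.map Sum.inl ++ [Sum.inr true]) :=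
    Computable.list_cons.comp (Computable.const _) (Computable.list_append.comp
      (Computable.map_finite (Sum.inl : ι → ι ⊕ Bool)) (Computable.const _))
  have hval : ∀ w : List ι, wordProd
      (Sum.elim f fun b : Bool => cond b (Λ.next.φ s) (Λ.next.φ s)⁻¹ : ι ⊕ Bool → Λ.next.E)
      (Sum.inr false :: (w.map Sum.inl ++ [Sum.inr true])) =
        (Λ.next.φ s)⁻¹ * (wordProd f w * Λ.next.φ s) := by
    intro w
    rw [wordProd_cons, wordProd_append, wordProd_map, wordProd_cons, wordProd_nil, mul_one]
    rfl
  refine (ComputablePred.exists_option (hD y' hy' Q' hle (Fin m) F hF)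
    (hred.comp hcomp)).of_eq fun w => ?_
  have h1 := hspec (Sum.inr false :: (w.map Sum.inl ++ [Sum.inr true]))
  constructor
  · rintro ⟨v, hv, h⟩
    have h2 := (hval w).symm.trans (h1.1 v hv)
    rw [hQ', ← h2, mul_inv_cancel_left, mul_inv_cancel_right] at h
    exact h
  · intro h
    obtain ⟨k, hk, e⟩ := hconj _ h
    have h2 := hval w
    rw [e, inv_mul_cancel_left] at h2
    rcases hv : red (Sum.inr false :: (w.map Sum.inl ++ [Sum.inr true])) with _ | v
    · exact absurd h2 (h1.2 hv k)
    · refine ⟨v, rfl, ?_⟩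
      have h3 := h2.symm.trans (h1.1 v hv)
      rw [hQ', ← h3, ← e, mul_inv_cancel_right]
      exact h

end Level
end GroupExt

/-! ### The induction on the degree and both implications. -/

namespace GroupExt

open Polynomial

universe u

section WordProblem

variable {E : Type*} [Group E] {ι κ : Type} [Primcodable ι] [Primcodable κ]

theorem DecidableMem.of_words {p : κ → E} {P : Subgroup E} (h : DecidableMem p P) [Finite ι]
    {f : ι → E} (hf : ∀ i, ∃ w, wordProd p w = f i) : DecidableMem f P := by
  choose wd hwd using hf
  refine (h.comp (Computable.flatMap_finite wd)).of_eq fun w => ?_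
  rw [wordProd_flatMap]
  simp only [hwd]

theorem lift_mk_eq_wordProd {n : ℕ} (g : Fin n → E) (w : List (Fin n × Bool)) :
    FreeGroup.lift g (FreeGroup.mk w) = wordProd (fun x => cond x.2 (g x.1) (g x.1)⁻¹) w :=
  FreeGroup.lift_mk

theorem decidableWP_of_decidableWordProblem (h : DecidableWordProblem E) (L : Subgroup E) :
    DecidableWP L := by
  obtain ⟨n, g, hg, hdec⟩ := h
  intro ι _ _ f _
  have h1 : DecidableMem (fun x : Fin n × Bool => cond x.2 (g x.1) (g x.1)⁻¹) ⊥ :=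
    hdec.of_eq fun w => by rw [lift_mk_eq_wordProd, Subgroup.mem_bot]
  refine h1.of_words fun i => ?_
  have h2 : f i ∈ (FreeGroup.lift g).range := by
    rw [FreeGroup.range_lift_eq_closure, hg]
    trivial
  obtain ⟨x, hx⟩ := h2
  exact ⟨x.toWord, by rw [← lift_mk_eq_wordProd, FreeGroup.mk_toWord, hx]⟩

end WordProblem

variable {G : Type u} [Group G] {S : Set G}

namespace Level

/-- At level `0` the shift is an integer; if its only coefficient vanishes, then the shift is `0`
and the element is trivial. -/
theorem lowPer_eq_bot {Λ : Level S 0} (y : Λ.Cell) : lowPer y = ⊥ := by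
  rw [Subgroup.eq_bot_iff_forall]
  rintro g ⟨h, a, H, ha⟩
  have h0 := ZPoly.low_of_coeff H.low ha
  rw [mem_degreeLT, degree_lt_iff_coeff_zero] at h0
  exact (H.unique y.2.1 y.2.1 (Carry.refl y.2.2)).2 (Polynomial.ext fun n => h0 n n.zero_le)

theorem decidablePeriods_zero {Λ : Level S 0} (hW : DecidableWP Λ.geo) : Λ.DecidablePeriods := by
  intro y hy P hP
  refine decidableMem_of_lowPer hy hP fun ι _ _ f hf => ?_
  rw [lowPer_eq_bot, inf_bot_eq]
  exact hW ι f hf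

end Level

theorem decidable_tower (hgen : Subgroup.closure S = ⊤) (hone : (1 : G) ∉ S)
    (h : DecidableWordProblem G) (d : ℕ) :
    DecidableWP (tower hgen hone d).geo ∧ (tower hgen hone d).DecidablePeriods := by
  induction d with
  | zero =>
    have hW : DecidableWP (tower hgen hone 0).geo := decidableWP_of_decidableWordProblem h _
    exact ⟨hW, Level.decidablePeriods_zero hW⟩
  | succ d ih => exact ⟨Level.decidableWP_next ih.1 ih.2, Level.decidablePeriods_next ih.1 ih.2⟩

theorem computablePred_toExt (hgen : Subgroup.closure S = ⊤) (hone : (1 : G) ∉ S)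
    (h : DecidableWordProblem G) {n : ℕ}
    (δ : Fin n → AWord (Alphabet S)) (hδ : ∀ i, IsLocalGeodesic S (δ i)) :
    ComputablePred fun w : List (Fin n) => toExt S (geodesicProd S δ hδ w) = 1 := by
  choose D hD using fun i => ZPoly.exists_low (δ i).len
  obtain ⟨d, hd⟩ := Finite.exists_le D
  have hδd : ∀ i, (δ i).len ∈ degreeLT ℤ (d + 1) := fun i => hD i _ ((hd i).trans d.le_succ)
  have h1 := (decidable_tower hgen hone h d).1 (Fin n) (fun i => (tower hgen hone d).φ (δ i))
    fun i => Level.φ_mem_geo (hδ i) (hδd i)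
  exact h1.of_eq fun w => (toExt_geodesicProd_eq_one_iff hgen hone δ hδ hδd w).symm

/-- The family of all letters is compared with level `0`, which is `G` itself. -/
theorem decidableWordProblem_of_letters (hgen : Subgroup.closure S = ⊤) (hone : (1 : G) ∉ S)
    (hfin : S.Finite)
    (h : ∀ (n : ℕ) (a : Fin n → Alphabet S), ComputablePred fun w : List (Fin n) =>
      toExt S (geodesicProd S (fun i => AWord.letter (a i))
        (fun i => isLocalGeodesic_letter hone (a i)) w) = 1) :
    DecidableWordProblem G := by
  have : Finite (Alphabet S) := (hfin.union hfin.inv).to_subtype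
  obtain ⟨m, ⟨e⟩⟩ := Finite.exists_equiv_fin (Alphabet S)
  obtain ⟨n, g, hg⟩ := exists_fin_range hfin
  have h1 : DecidableMem (fun i => (e.symm i : G)) ⊥ := by
    refine (h m e.symm).of_eq fun w => ?_
    rw [toExt_geodesicProd_eq_one_iff hgen hone (d := 0) _ _ fun i =>
      mem_degreeLT.2 (by rw [AWord.len_letter]; simp), Subgroup.mem_bot]
    have := tower_φ_letter hgen hone 0 (w.map e.symm)
    rwa [List.map_map, eval, List.map_map] at this
  refine ⟨n, g, by rw [hg, hgen], ?_⟩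
  have h2 : DecidableMem (fun x : Fin n × Bool => cond x.2 (g x.1) (g x.1)⁻¹) ⊥ := by
    refine h1.of_words ?_
    have hS : ∀ i, g i ∈ S := fun i => hg ▸ Set.mem_range_self i
    have hletter : ∀ a : Alphabet S, ∃ w, wordProd (fun i => (e.symm i : G)) w = a := fun a =>
      ⟨[e a], by rw [wordProd_cons, wordProd_nil, mul_one, e.symm_apply_apply]⟩
    rintro ⟨i, _ | _⟩
    · exact hletter (letterInv S ⟨g i, Or.inl (hS i)⟩)
    · exact hletter ⟨g i, Or.inl (hS i)⟩
  exact h2.of_eq fun w => by rw [lift_mk_eq_wordProd, Subgroup.mem_bot]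

end GroupExt

theorem mainTheorem11 {G : Type*} [Group G] (S : Set G) (hfin : S.Finite)
    (hgen : Subgroup.closure S = ⊤) (hone : (1 : G) ∉ S) :
    GroupExt.DecidableWordProblem G ↔
      ∀ (n : ℕ) (δ : Fin n → AWord (GroupExt.Alphabet S))
        (hδ : ∀ i, GroupExt.IsLocalGeodesic S (δ i)),
        ComputablePred fun w : List (Fin n) =>
          GroupExt.toExt S (GroupExt.geodesicProd S δ hδ w) = 1 :=
  ⟨fun h _ δ hδ => GroupExt.computablePred_toExt hgen hone h δ hδ, fun h =>
    GroupExt.decidableWordProblem_of_letters hgen hone hfin fun n _ => h n _ _⟩
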